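/- **Setting.** A tensor network consists of a finite set $V$ of tensors, finitely many contracted legs $E$, each joining two tensors (several legs may join the same two tensors), and finitely many uncontracted boundary legs $\mathcal B$, each attached to a tensor; in addition every tensor has one uncontracted bulk leg. Let $p$ be a prime, the dimension of every leg (the bond dimension). A *stabilizer state* of $t$ qudits of dimension $p$ is a unit vector fixed by all elements of an abelian subgroup of order $p^t$ of the generalised Pauli group which contains no multiple of the identity other than the identity. In a *random stabilizer tensor network* the tensors are independent, each a uniformly random stabilizer state (up to phase) on its legs. Contracting the legs in $E$ and feeding a bulk state $\Phi\in(\mathbb C^p)^{\otimes V}$ into the bulk legs gives a vector on the boundary; $\rho_{\mathcal B}$ is the corresponding normalised density operator, and $\mathrm{Prob}$ is the probability conditional on this vector being nonzero (an event of positive probability). For a boundary region $A\subseteq\mathcal B$ (connected or not) put $\rho_A=\mathrm{tr}_{\mathcal B\setminus A}\,\rho_{\mathcal B}$ and $S(\rho_A)=-\mathrm{tr}\,\rho_A\ln\rho_A$. For $\Gamma\subseteq V$, the surface of $\Gamma$ is the set of all contracted legs that join $\Gamma$ to $V\setminus\Gamma$, of the legs in $A$ attached to tensors outside $\Gamma$,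 and of the boundary legs outside $A$ attached to tensors in $\Gamma$. Let $|\gamma_A|$ be the least number of legs in such a surface, $k=k(A)$ the number of distinct surfaces with $|\gamma_A|$ legs, and $S_{RT}(\rho_A)=|\gamma_A|\ln p$. **Lemma (Approximate Ryu–Takayanagi).** Fix a tensor network. There is a function $o(1)$ of $p$, tending to $0$ as $p\to\infty$ and depending only on the network, such that for all primes $p$, all boundary regions $A$ and all $a>0$: 1. for every product bulk state $\Phi=\bigotimes_{v\in V}\phi_v$ with unit vectors $\phi_v\in\mathbb C^p$, $$\mathrm{Prob}\big[S_{RT}(\rho_A)-S(\rho_A)\ge a\,(\ln k+o(1))\big]\le \tfrac1a ;$$ 2. for every product bulk state that is a stabilizer state, if $\ln p> a\,(\ln k+o(1))$, then $$\mathrm{Prob}\big[S_{RT}(\rho_A)=S(\rho_A)\big]\ge 1-\tfrac1a .$$ Hence, for all $a,\varepsilon>0$ and all sufficiently large primes $p$, one has $\mathrm{Prob}\big[|S_{RT}(\rho_A)-S(\rho_A)|<a\ln k+\varepsilon\big]\ge 1-\frac1a$ for all $A$ and all product bulk states; and for every $\varepsilon>0$ and all sufficiently large primes $p$, one has $\mathrm{Prob}[S_{RT}(\rho_A)=S(\rho_A)]\ge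 1-\varepsilon$ for all $A$ and all stabilizer product bulk states. -/

import Mathlib

open Filter Topology MeasureTheory ProbabilityTheory

noncomputable section

/-! ### Stabilizer states of qudits -/

/-- The computational basis labels of a register of qudits of dimension `p`, one qudit for each
element of `ι`. -/
abbrev QuditBasis (p : ℕ) (ι : Type*) : Type _ := ι → ZMod p

/-- The generalised Pauli operator `X^x Z^z`, that is
`|j⟩ ↦ exp (2πi (∑ l, z l * j l) / p) |j + x⟩`. -/
def pauliXZ {p : ℕ} [NeZero p] {ι : Type*} [Fintype ι] [DecidableEq ι] (x z : ι → ZMod p) :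
    Matrix (QuditBasis p ι) (QuditBasis p ι) ℂ :=
  Matrix.of fun i j => if i = j + x then ZMod.stdAddChar (∑ l, z l * j l) else 0

/-- Elements of the generalised Pauli group: phases times `X^x Z^z`. The phases are the `2p`-th
roots of unity (so `±1, ±i` for qubits; for odd `p` the additional sign `-1` never occurs in a
group of order a power of `p`). -/
def IsPauli {p : ℕ} [NeZero p] {ι : Type*} [Fintype ι] [DecidableEq ι]
    (U : Matrix.unitaryGroup (QuditBasis p ι) ℂ) : Prop :=
  ∃ (c : ℂ) (x z : ι → ZMod p), c ^ (2 * p) = 1 ∧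
    (U : Matrix (QuditBasis p ι) (QuditBasis p ι) ℂ) = c • pauliXZ x z

/-- A full stabilizer group: an abelian subgroup of the Pauli group, of order `p ^ t` for `t`
qudits, that contains no multiple of the identity but the identity itself. -/
structure IsStabilizerGroup {p : ℕ} [NeZero p] {ι : Type*} [Fintype ι] [DecidableEq ι]
    (S : Subgroup (Matrix.unitaryGroup (QuditBasis p ι) ℂ)) : Prop where
  pauli : ∀ U ∈ S, IsPauli U
  comm : ∀ U ∈ S, ∀ W ∈ S, U * W = W * U
  no_scalar : ∀ U ∈ S, ∀ c : ℂ,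
    (U : Matrix (QuditBasis p ι) (QuditBasis p ι) ℂ) = c • (1 : Matrix _ _ ℂ) → U = 1
  card : Nat.card S = p ^ Fintype.card ι

/-- A stabilizer state: a unit vector fixed by every element of a full stabilizer group. -/
def IsStabilizerState {p : ℕ} [NeZero p] {ι : Type*} [Fintype ι] [DecidableEq ι]
    (ψ : QuditBasis p ι → ℂ) : Prop :=
  ∑ i, ‖ψ i‖ ^ 2 = 1 ∧
    ∃ S : Subgroup (Matrix.unitaryGroup (QuditBasis p ι) ℂ), IsStabilizerGroup S ∧
      ∀ U ∈ S, Matrix.mulVec (U : Matrix (QuditBasis p ι) (QuditBasis p ι) ℂ) ψ = ψ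

/-- The (finite) set of stabilizer states as physical states, i.e. up to a global phase: a state
is represented by its density operator `|ψ⟩⟨ψ|`. -/
def StabState (p : ℕ) [NeZero p] (ι : Type*) [Fintype ι] [DecidableEq ι] : Type _ :=
  {σ : Matrix (QuditBasis p ι) (QuditBasis p ι) ℂ //
    ∃ ψ : QuditBasis p ι → ℂ, IsStabilizerState ψ ∧ σ = Matrix.vecMulVec ψ (star ψ)}

/-- A (pure) tensor-product state of the qudits `ι`, each factor being a unit vector. -/
def IsProductState {p : ℕ} [NeZero p] {ι : Type*} [Fintype ι]
    (Φ : QuditBasis p ι → ℂ) : Prop :=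
  ∃ φ : ι → ZMod p → ℂ, (∀ v, ∑ i, ‖φ v i‖ ^ 2 = 1) ∧ ∀ j, Φ j = ∏ v, φ v (j v)

/-! ### Entropy -/

/-- The von Neumann entropy `-tr (ρ ln ρ) = - ∑ λ ln λ` (sum over the eigenvalues of the
Hermitian matrix `ρ`). -/
def vonNeumannEntropy {n : Type*} [Fintype n] [DecidableEq n] (ρ : Matrix n n ℂ) : ℝ :=
  open Classical in
  if h : ρ.IsHermitian then ∑ i, Real.negMulLog (h.eigenvalues i) else 0

/-- The partial trace over all qudits outside `A`. -/
def reducedState {p : ℕ} [NeZero p] {B : Type*} [Fintype B] [DecidableEq B]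
    (A : Finset B) (ρ : Matrix (QuditBasis p B) (QuditBasis p B) ℂ) :
    Matrix (QuditBasis p {b // b ∈ A}) (QuditBasis p {b // b ∈ A}) ℂ :=
  Matrix.of fun i j => ∑ c : {b // b ∉ A} → ZMod p,
    ρ (fun b => if h : b ∈ A then i ⟨b, h⟩ else c ⟨b, h⟩)
      (fun b => if h : b ∈ A then j ⟨b, h⟩ else c ⟨b, h⟩)

/-! ### Tensor networks -/

/-- The geometry of a tensor network: a tensor at every vertex `v : V`, a contracted leg for each
`e : E`, joining the tensors at `src e` and `tgt e` (several legs may join the same two tensors),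
and an uncontracted boundary leg for each `b : B`, at the tensor `att b`. In addition every tensor
has one uncontracted bulk leg. -/
structure TensorNetwork (V E B : Type*) where
  src : E → V
  tgt : E → V
  att : B → V

namespace TensorNetwork

variable {V E B : Type*} [Fintype V] [DecidableEq V] [Fintype E] [DecidableEq E]
  [Fintype B] [DecidableEq B]

/-- The legs of the tensor at `v`: the bulk leg, the contracted legs starting at `v`, those ending
at `v`, and the boundary legs at `v`. -/
abbrev Leg (N : TensorNetwork V E B) (v : V) : Type _ :=
  Unit ⊕ {e // N.src e = v} ⊕ {e // N.tgt e = v} ⊕ {b // N.att b = v}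

/-- The values on the legs of the tensor at `v`, given values on all legs of the network. -/
def legVal {p : ℕ} (N : TensorNetwork V E B) (i : QuditBasis p V) (e : QuditBasis p E) (b : QuditBasis p B)
    (v : V) : QuditBasis p (N.Leg v) :=
  Sum.elim (fun _ => i v) (Sum.elim (fun f => e f) (Sum.elim (fun f => e f) (fun f => b f)))

/-- The choices of one stabilizer state for every tensor of the network. -/
def Choice (N : TensorNetwork V E B) (p : ℕ) [NeZero p] : Type _ :=
  ∀ v : V, StabState p (N.Leg v)

instance (N : TensorNetwork V E B) (p : ℕ) [NeZero p] : MeasurableSpace (N.Choice p) := ⊤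

/-- The unnormalised boundary density operator: all internal legs are contracted and the bulk
state `Φ` is fed into the bulk legs. If `T v = |t v⟩⟨t v|`, this is `|Ψ⟩⟨Ψ|` with
`Ψ b = ∑ i, ∑ e, Φ i * ∏ v, t v (N.legVal i e b v)`. -/
def rawState {p : ℕ} [NeZero p] (N : TensorNetwork V E B) (Φ : QuditBasis p V → ℂ) (T : N.Choice p) :
    Matrix (QuditBasis p B) (QuditBasis p B) ℂ :=
  Matrix.of fun b b' => ∑ i : QuditBasis p V, ∑ i' : QuditBasis p V,
    ∑ e : QuditBasis p E, ∑ e' : QuditBasis p E,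
      Φ i * star (Φ i') * ∏ v, (T v).1 (N.legVal i e b v) (N.legVal i' e' b' v)

/-- The boundary state `ρ_𝓑`, normalised to trace one (whenever it does not vanish). -/
def boundaryState {p : ℕ} [NeZero p] (N : TensorNetwork V E B) (Φ : QuditBasis p V → ℂ)
    (T : N.Choice p) : Matrix (QuditBasis p B) (QuditBasis p B) ℂ :=
  (N.rawState Φ T).trace⁻¹ • N.rawState Φ T

/-- The entanglement entropy `S(ρ_A)` of the boundary region `A`. -/
def entropy {p : ℕ} [NeZero p] (N : TensorNetwork V E B) (Φ : QuditBasis p V → ℂ)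
    (A : Finset B) (T : N.Choice p) : ℝ :=
  vonNeumannEntropy (reducedState A (N.boundaryState Φ T))

/-- The law of a random stabilizer tensor network with bulk state `Φ`: the tensors are independent
uniformly random stabilizer states (i.e. the family of tensors is uniform on `N.Choice p`),
conditioned on the boundary state being nonzero. -/
def law {p : ℕ} [NeZero p] (N : TensorNetwork V E B) (Φ : QuditBasis p V → ℂ) :
    Measure (N.Choice p) :=
  uniformOn {T | N.rawState Φ T ≠ 0}

/-- The surface bounding the set `Γ` of tensors together with the boundary region `A`: the
contracted legs joining `Γ` to its complement, the legs of `A` attached to tensors outside `Γ`, and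
the boundary legs outside `A` attached to tensors in `Γ`. -/
def surface (N : TensorNetwork V E B) (A : Finset B) (Γ : Finset V) : Finset (E ⊕ B) :=
  (Finset.univ.filter fun e => ¬ (N.src e ∈ Γ ↔ N.tgt e ∈ Γ)).disjSum
    (Finset.univ.filter fun b => ¬ (b ∈ A ↔ N.att b ∈ Γ))

/-- All surfaces through the network that separate `A` from its complement. -/
def surfaces (N : TensorNetwork V E B) (A : Finset B) : Finset (Finset (E ⊕ B)) :=
  Finset.univ.image (N.surface A)

/-- `|γ_A|`: the least number of legs crossed by a surface separating `A` from its complement. -/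
def minCut (N : TensorNetwork V E B) (A : Finset B) : ℕ :=
  ⨅ Γ : Finset V, (N.surface A Γ).card

/-- `k`: the number of minimal surfaces. -/
def numMinimal (N : TensorNetwork V E B) (A : Finset B) : ℕ :=
  ((N.surfaces A).filter fun γ => γ.card = N.minCut A).card

/-- The Ryu-Takayanagi entropy `S_RT = |γ_A| ln p` of an unentangled bulk. -/
def entropyRT (N : TensorNetwork V E B) (p : ℕ) (A : Finset B) : ℝ :=
  N.minCut A * Real.log p

end TensorNetwork

end

/-! The deficit $S_{RT}(\rho_A)-S(\rho_A)$ is nonnegative and its conditional mean is at most $\ln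
k+o(1)$; the tail bound is then Markov's inequality.

Nonnegativity is a rank bound. For a product bulk state, the boundary vector, read as a matrix
between the labels of $A$ and those of its complement, factors through the legs of any surface. So
the rank of $\rho_A$ is at most $p^{|\gamma_A|}$ (`exists_splitMatrix_eq_mul`,
`entropy_le_entropyRT`).

For the mean, $S(\rho_A)\ge-\ln\mathrm{tr}\,\rho_A^2$ reduces the question to second moments. For
prime $p$ the stabilizer states form a 2-design (`StabState.sum_mul`): the mean of
$\sigma\otimes\sigma$ is proportional to identity plus swap. Expanding the product over the tensors
gives a sum over the sets $\Gamma$ of swapped tensors. In units of the squared mean norm, $\Gamma$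
contributes at most $p^{-|\text{surface of }\Gamma|}$ to the mean unnormalised purity
(`exists_moments`). Minimal surfaces give $k\,p^{-|\gamma_A|}$, all others are smaller by a factor
$1/p$. For $A=\emptyset$ the purity is the squared norm and only the empty surface is minimal, so
the norm concentrates and may be replaced by its mean outside a small exceptional set
(`sum_le_of_le_log_div`).

The expansion counts sets $\Gamma$, whereas $k$ counts surfaces. Tensors in a component without
boundary legs can be added to $\Gamma$ without changing the surface; this would overcount and spoil
the concentration of the norm. Such components only rescale the boundary state
(`exists_rawState_eq_smul`). Hence only the tensors of `boundaryComponent` are averaged, where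
$\Gamma$ is determined by its surface (`injOn_surface`); independence of the remaining tensors
transfers the bound to the full conditional law (`sum_deficit_le`).

Stabilizer states are handled through `IsPauliRigid`, which is stable under products, contractions
and Pauli measurements. It yields the 2-design property without a detour through the Clifford group.
It also shows that for a stabilizer bulk $\rho_A$ is proportional to a projection whose rank is a
power of $p$ (`exists_entropy_eq`). Then the deficit is an integer multiple of $\ln p$, and vanishes
as soon as it is below $\ln p$. -/

noncomputable section

/-! ### The generalised Pauli operators -/

section Pauli

open Matrix ZMod

variable {p : ℕ} [NeZero p] {ι : Type*} [Fintype ι] [DecidableEq ι]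

lemma star_stdAddChar (a : ZMod p) : star (stdAddChar a : ℂ) = stdAddChar (-a) :=
  (AddChar.map_neg_eq_conj _ _).symm

lemma stdAddChar_ne_zero (a : ZMod p) : (stdAddChar a : ℂ) ≠ 0 := by
  intro h
  have := AddChar.norm_apply (stdAddChar : AddChar (ZMod p) ℂ) a
  simp [h] at this

lemma stdAddChar_eq_one_iff (a : ZMod p) : (stdAddChar a : ℂ) = 1 ↔ a = 0 := by
  rw [← AddChar.map_zero_eq_one (stdAddChar : AddChar (ZMod p) ℂ)]
  exact injective_stdAddChar.eq_iff

lemma stdAddChar_pow_self (a : ZMod p) : (stdAddChar a : ℂ) ^ p = 1 := by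
  rw [← AddChar.map_nsmul_eq_pow]; simp

/-- Orthogonality of the characters of `ι → ZMod p`. -/
lemma sum_stdAddChar_dotProduct (j : ι → ZMod p) :
    ∑ z : ι → ZMod p, (stdAddChar (z ⬝ᵥ j) : ℂ) = if j = 0 then (p : ℂ) ^ Fintype.card ι else 0 := by
  let f : AddChar (ι → ZMod p) ℂ :=
    { toFun := fun z => stdAddChar (z ⬝ᵥ j)
      map_zero_eq_one' := by simp
      map_add_eq_mul' := fun a b => by rw [add_dotProduct, AddChar.map_add_eq_mul] }
  split_ifs with h
  · simp [h, ZMod.card]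
  · refine AddChar.sum_eq_zero_iff_ne_zero (ψ := f) |>.2 fun hf => ?_
    obtain ⟨l, hl⟩ := Function.ne_iff.1 h
    have h1 : f (Pi.single l 1) = 1 := by rw [hf]; simp
    have h2 : (stdAddChar (Pi.single l 1 ⬝ᵥ j) : ℂ) = 1 := h1
    rw [stdAddChar_eq_one_iff] at h2
    simp at h2
    exact hl h2

lemma pauliXZ_apply (x z i j : ι → ZMod p) :
    pauliXZ x z i j = if i = j + x then (stdAddChar (z ⬝ᵥ j) : ℂ) else 0 := rfl

lemma pauliXZ_mulVec (x z : ι → ZMod p) (ψ : QuditBasis p ι → ℂ) (i : QuditBasis p ι) :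
    (pauliXZ x z *ᵥ ψ) i = stdAddChar (z ⬝ᵥ (i - x)) * ψ (i - x) := by
  rw [mulVec, dotProduct, Finset.sum_eq_single (i - x)]
  · simp [pauliXZ_apply]
  · intro j _ hj
    rw [pauliXZ_apply, if_neg, zero_mul]
    rintro rfl
    simp at hj
  · simp

lemma pauliXZ_zero : pauliXZ (0 : ι → ZMod p) 0 = 1 := by
  ext i j
  simp [pauliXZ_apply, Matrix.one_apply]

lemma pauliXZ_mul (x z x' z' : ι → ZMod p) :
    pauliXZ x z * pauliXZ x' z' = (stdAddChar (z ⬝ᵥ x') : ℂ) • pauliXZ (x + x') (z + z') := by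
  ext i j
  rw [mul_apply, Finset.sum_eq_single (j + x')]
  · simp only [pauliXZ_apply, if_true, Matrix.smul_apply, smul_eq_mul, add_dotProduct, dotProduct_add,
      AddChar.map_add_eq_mul, add_assoc, add_comm x']
    split_ifs <;> ring
  · intro k _ hk
    rw [pauliXZ_apply x', if_neg hk, mul_zero]
  · simp

lemma pauliXZ_conjTranspose_mul (x z : ι → ZMod p) : (pauliXZ x z)ᴴ * pauliXZ x z = 1 := by
  ext i j
  rw [mul_apply, Finset.sum_eq_single (j + x)]
  · simp only [conjTranspose_apply, pauliXZ_apply, if_true, add_left_inj, one_apply]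
    by_cases h : j = i
    · subst h
      simp only [if_true, star_stdAddChar, ← AddChar.map_add_eq_mul]
      simp
    · simp [h, Ne.symm h]
  · intro k _ hk
    rw [pauliXZ_apply, if_neg hk, mul_zero]
  · simp

lemma pauliXZ_conjTranspose (x z : ι → ZMod p) :
    (pauliXZ x z)ᴴ = (stdAddChar (z ⬝ᵥ x) : ℂ) • pauliXZ (-x) (-z) := by
  have h : pauliXZ x z * ((stdAddChar (z ⬝ᵥ x) : ℂ) • pauliXZ (-x) (-z)) = 1 := by
    rw [mul_smul_comm, pauliXZ_mul, smul_smul, ← AddChar.map_add_eq_mul]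
    simp [pauliXZ_zero]
  calc (pauliXZ x z)ᴴ = (pauliXZ x z)ᴴ * (pauliXZ x z * _) := by rw [h, mul_one]
    _ = _ := by rw [← mul_assoc, pauliXZ_conjTranspose_mul, one_mul]

/-- The symplectic form governing the commutation of Pauli operators. -/
def pauliForm (x z x' z' : ι → ZMod p) : ZMod p := z ⬝ᵥ x' - z' ⬝ᵥ x

lemma pauliXZ_comm (x z x' z' : ι → ZMod p) :
    pauliXZ x z * pauliXZ x' z' =
      (stdAddChar (pauliForm x z x' z') : ℂ) • (pauliXZ x' z' * pauliXZ x z) := by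
  rw [pauliXZ_mul, pauliXZ_mul, smul_smul, ← AddChar.map_add_eq_mul, pauliForm, sub_add_cancel,
    add_comm x, add_comm z]

lemma pauliXZ_pow (x z : ι → ZMod p) (n : ℕ) :
    pauliXZ x z ^ n = ((stdAddChar (z ⬝ᵥ x) : ℂ) ^ n.choose 2) • pauliXZ (n • x) (n • z) := by
  induction n with
  | zero => simp [pauliXZ_zero]
  | succ n ih =>
    rw [pow_succ, ih, smul_mul_assoc, pauliXZ_mul, smul_smul, succ_nsmul, succ_nsmul,
      smul_dotProduct, AddChar.map_nsmul_eq_pow, ← pow_add, Nat.choose_succ_succ' n 1,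
      Nat.choose_one_right, add_comm n]

lemma nsmul_self_zmod {p : ℕ} {ι : Type*} (x : ι → ZMod p) : p • x = 0 := by
  ext; simp

lemma pauliXZ_pow_self (x z : ι → ZMod p) :
    pauliXZ x z ^ p = ((stdAddChar (z ⬝ᵥ x) : ℂ) ^ p.choose 2) • 1 := by
  rw [pauliXZ_pow, nsmul_self_zmod, nsmul_self_zmod, pauliXZ_zero]

/-- The accumulated phase has exponent $\binom{2p}{2}=p(2p-1)$, a multiple of $p$ also when $p=2$.
Hence eigenvalues of Pauli operators are $2p$-th roots of unity, the phases admitted by `IsPauli`.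
-/
lemma pauliXZ_pow_two_mul_self (x z : ι → ZMod p) : pauliXZ x z ^ (2 * p) = 1 := by
  have h : (2 * p).choose 2 = p * (2 * p - 1) := by
    rw [Nat.choose_two_right, mul_assoc, Nat.mul_div_cancel_left _ two_pos]
  rw [pauliXZ_pow, mul_nsmul', mul_nsmul', nsmul_self_zmod, nsmul_self_zmod, h, pow_mul,
    stdAddChar_pow_self, one_pow, nsmul_zero, pauliXZ_zero, one_smul]

/-- Completeness of the Pauli operators. -/
lemma sum_pauliXZ_mul_star (i i' j j' : QuditBasis p ι) :
    ∑ x : ι → ZMod p, ∑ z : ι → ZMod p, pauliXZ x z i i' * star (pauliXZ x z j j') =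
      if i = j ∧ i' = j' then (p : ℂ) ^ Fintype.card ι else 0 := by
  rw [Finset.sum_eq_single (i - i')]
  · simp only [pauliXZ_apply, add_sub_cancel, if_true]
    by_cases h : j = j' + (i - i')
    · simp only [if_pos h, star_stdAddChar, ← AddChar.map_add_eq_mul, ← dotProduct_neg,
        ← dotProduct_add, sum_stdAddChar_dotProduct]
      refine if_congr ?_ rfl rfl
      rw [← sub_eq_add_neg, sub_eq_zero]
      constructor
      · rintro rfl; exact ⟨by rw [h]; abel, rfl⟩
      · exact fun h => h.2
    · simp only [if_neg h, star_zero, mul_zero, Finset.sum_const_zero]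
      rw [if_neg]
      rintro ⟨rfl, rfl⟩
      exact h (by abel)
  · intro x _ hx
    refine Finset.sum_eq_zero fun z _ => ?_
    rw [pauliXZ_apply, if_neg, zero_mul]
    rintro rfl
    exact hx (by abel)
  · simp

/-- Every matrix is a linear combination of Pauli operators. -/
lemma eq_sum_pauliXZ (ρ : Matrix (QuditBasis p ι) (QuditBasis p ι) ℂ) :
    ρ = ((p : ℂ) ^ Fintype.card ι)⁻¹ •
      ∑ u : (ι → ZMod p) × (ι → ZMod p), ((pauliXZ u.1 u.2)ᴴ * ρ).trace • pauliXZ u.1 u.2 := by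
  have hp : ((p : ℂ) ^ Fintype.card ι) ≠ 0 := pow_ne_zero _ (NeZero.ne _)
  ext i i'
  rw [Matrix.smul_apply, smul_eq_mul, eq_inv_mul_iff_mul_eq₀ hp, Matrix.sum_apply]
  simp only [Matrix.smul_apply, smul_eq_mul, trace, diag, mul_apply, conjTranspose_apply, Finset.sum_mul]
  rw [Finset.sum_comm]
  calc _ = ∑ j', ∑ j, if i = j ∧ i' = j' then (p : ℂ) ^ Fintype.card ι * ρ j j' else 0 := by
        rw [Fintype.sum_eq_single i', Fintype.sum_eq_single i]
        · simp
        · rintro j hj; simp [hj.symm]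
        · rintro j hj; simp [hj.symm]
    _ = _ := by
        refine Finset.sum_congr rfl fun j' _ => ?_
        rw [Finset.sum_comm]
        refine Finset.sum_congr rfl fun j _ => ?_
        have := sum_pauliXZ_mul_star i i' j j'
        rw [← Fintype.sum_prod_type'] at this
        calc _ = (if i = j ∧ i' = j' then (p : ℂ) ^ Fintype.card ι else 0) * ρ j j' := by simp
          _ = _ := by
            rw [← this, Finset.sum_mul]
            exact Finset.sum_congr rfl fun u _ => by ring

/-- Parseval's identity for the coefficients of a matrix with respect to the Pauli operators. -/
lemma sum_norm_trace_pauliXZ (ρ : Matrix (QuditBasis p ι) (QuditBasis p ι) ℂ) :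
    ∑ u : (ι → ZMod p) × (ι → ZMod p),
      ((pauliXZ u.1 u.2)ᴴ * ρ).trace * star ((pauliXZ u.1 u.2)ᴴ * ρ).trace =
      (p : ℂ) ^ Fintype.card ι * (ρ * ρᴴ).trace := by
  have hp : ((p : ℂ) ^ Fintype.card ι) ≠ 0 := pow_ne_zero _ (NeZero.ne _)
  have h : (ρ * ρᴴ).trace = ((p : ℂ) ^ Fintype.card ι)⁻¹ *
      ∑ u : (ι → ZMod p) × (ι → ZMod p),
        ((pauliXZ u.1 u.2)ᴴ * ρ).trace * star ((pauliXZ u.1 u.2)ᴴ * ρ).trace := by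
    refine (congrArg (fun M => (M * ρᴴ).trace) (eq_sum_pauliXZ ρ)).trans ?_
    rw [smul_mul_assoc, trace_smul, smul_eq_mul, Finset.sum_mul, trace_sum]
    congr 1
    refine Finset.sum_congr rfl fun u _ => ?_
    rw [smul_mul_assoc, trace_smul, smul_eq_mul, ← trace_conjTranspose, conjTranspose_mul,
      conjTranspose_conjTranspose, trace_mul_comm ρᴴ]
  rw [h, mul_inv_cancel_left₀ hp]

end Pauli

/-! ### Pauli expectation values of stabilizer states -/

section Rigid

open Matrix ZMod

lemma star_dotProduct_self {n : Type*} [Fintype n] (ψ : n → ℂ) :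
    star ψ ⬝ᵥ ψ = ((∑ i, ‖ψ i‖ ^ 2 : ℝ) : ℂ) := by
  simp only [dotProduct, Pi.star_apply, Complex.ofReal_sum, Complex.ofReal_pow]
  exact Finset.sum_congr rfl fun i _ => Complex.conj_mul' _

lemma sum_norm_sq_eq_one_iff {n : Type*} [Fintype n] (ψ : n → ℂ) :
    ∑ i, ‖ψ i‖ ^ 2 = 1 ↔ star ψ ⬝ᵥ ψ = 1 := by
  rw [star_dotProduct_self]
  norm_cast

lemma star_mul_self_of_pow {c : ℂ} {n : ℕ} (hn : n ≠ 0) (hc : c ^ n = 1) : star c * c = 1 := by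
  have h1 : ‖c‖ = 1 :=
    Complex.norm_eq_one_of_pow_eq_one hc hn
  have := Complex.conj_mul' c
  rw [h1] at this
  simpa using this

variable {p : ℕ} [NeZero p] {ι : Type*} [Fintype ι] [DecidableEq ι]

/-- The expectation value `⟨ψ, X^x Z^z ψ⟩`. -/
def pauliEv (ψ : QuditBasis p ι → ℂ) (x z : ι → ZMod p) : ℂ := star ψ ⬝ᵥ (pauliXZ x z *ᵥ ψ)

/-- A vector is Pauli-rigid if it is an eigenvector of every Pauli operator whose expectation
value does not vanish. The stabilizer states are the Pauli-rigid unit vectors. -/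
def IsPauliRigid (ψ : QuditBasis p ι → ℂ) : Prop :=
  ∀ x z, pauliEv ψ x z = 0 ∨ ∃ c : ℂ, pauliXZ x z *ᵥ ψ = c • ψ

lemma pauliXZ_inner (x z : ι → ZMod p) (ψ φ : QuditBasis p ι → ℂ) :
    star (pauliXZ x z *ᵥ ψ) ⬝ᵥ (pauliXZ x z *ᵥ φ) = star ψ ⬝ᵥ φ := by
  rw [star_mulVec, ← dotProduct_mulVec, mulVec_mulVec, pauliXZ_conjTranspose_mul, one_mulVec]

lemma star_mul_self_of_eigen {x z : ι → ZMod p} {ψ : QuditBasis p ι → ℂ} {c : ℂ}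
    (hψ : star ψ ⬝ᵥ ψ ≠ 0) (h : pauliXZ x z *ᵥ ψ = c • ψ) : star c * c = 1 := by
  have h1 := pauliXZ_inner x z ψ ψ
  rw [h, star_smul, smul_dotProduct, dotProduct_smul, smul_eq_mul, smul_eq_mul, ← mul_assoc] at h1
  exact mul_right_cancel₀ hψ (h1.trans (one_mul _).symm)

lemma pauliEv_of_eigen {x z : ι → ZMod p} {ψ : QuditBasis p ι → ℂ} {c : ℂ}
    (h : pauliXZ x z *ᵥ ψ = c • ψ) : pauliEv ψ x z = c * (star ψ ⬝ᵥ ψ) := by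
  rw [pauliEv, h, dotProduct_smul, smul_eq_mul]

lemma trace_pauliXZ_mul_vecMulVec (ψ : QuditBasis p ι → ℂ) (x z : ι → ZMod p) :
    (pauliXZ x z * vecMulVec ψ (star ψ)).trace = pauliEv ψ x z := by
  rw [mul_vecMulVec, trace_vecMulVec, dotProduct_comm, pauliEv]

lemma trace_conjTranspose_pauliXZ_mul (ψ : QuditBasis p ι → ℂ) (x z : ι → ZMod p) :
    ((pauliXZ x z)ᴴ * vecMulVec ψ (star ψ)).trace = star (pauliEv ψ x z) := by
  rw [← trace_pauliXZ_mul_vecMulVec, ← trace_conjTranspose, conjTranspose_mul,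
    conjTranspose_vecMulVec, star_star, trace_mul_comm]

lemma vecMulVec_eq_sum_pauliXZ (ψ : QuditBasis p ι → ℂ) :
    vecMulVec ψ (star ψ) = ((p : ℂ) ^ Fintype.card ι)⁻¹ •
      ∑ u : (ι → ZMod p) × (ι → ZMod p), star (pauliEv ψ u.1 u.2) • pauliXZ u.1 u.2 := by
  simpa only [trace_conjTranspose_pauliXZ_mul] using eq_sum_pauliXZ (vecMulVec ψ (star ψ))

/-- Parseval for $|\psi\rangle\langle\psi|$, whose Hilbert–Schmidt norm is one. Since each term is
at most one, this total is what ties rigidity to groups of order $p^t$. -/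
lemma sum_norm_pauliEv {ψ : QuditBasis p ι → ℂ} (hψ : star ψ ⬝ᵥ ψ = 1) :
    ∑ u : (ι → ZMod p) × (ι → ZMod p), ‖pauliEv ψ u.1 u.2‖ ^ 2 = (p : ℝ) ^ Fintype.card ι := by
  have h := sum_norm_trace_pauliXZ (vecMulVec ψ (star ψ))
  rw [conjTranspose_vecMulVec, star_star, vecMulVec_mul_vecMulVec, hψ, one_smul, trace_vecMulVec,
    dotProduct_comm, hψ, mul_one] at h
  have h2 : ((∑ u : (ι → ZMod p) × (ι → ZMod p), ‖pauliEv ψ u.1 u.2‖ ^ 2 : ℝ) : ℂ) =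
      (p : ℂ) ^ Fintype.card ι := by
    rw [← h, Complex.ofReal_sum]
    refine Finset.sum_congr rfl fun u _ => ?_
    rw [trace_conjTranspose_pauliXZ_mul, star_star, Complex.ofReal_pow]
    exact (Complex.conj_mul' _).symm
  exact_mod_cast h2

lemma norm_sq_eq_one_of_star_mul {c : ℂ} (h : star c * c = 1) : ‖c‖ ^ 2 = 1 := by
  have h1 : ((‖c‖ ^ 2 : ℝ) : ℂ) = 1 := by
    rw [← h, Complex.ofReal_pow]; exact (Complex.conj_mul' _).symm
  exact_mod_cast h1

lemma IsPauliRigid.eigen {ψ : QuditBasis p ι → ℂ} (h : IsPauliRigid ψ) (hψ : star ψ ⬝ᵥ ψ = 1)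
    {x z : ι → ZMod p} (hu : pauliEv ψ x z ≠ 0) :
    pauliXZ x z *ᵥ ψ = pauliEv ψ x z • ψ ∧ ‖pauliEv ψ x z‖ ^ 2 = 1 := by
  obtain ⟨c, hc⟩ := (h x z).resolve_left hu
  have h1 : pauliEv ψ x z = c := by rw [pauliEv_of_eigen hc, hψ, mul_one]
  rw [h1]
  exact ⟨hc, norm_sq_eq_one_of_star_mul (star_mul_self_of_eigen (by rw [hψ]; exact one_ne_zero) hc)⟩

lemma pauliXZ_smul_inj {x z x' z' : ι → ZMod p} {c c' : ℂ} (hc : c ≠ 0)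
    (h : c • pauliXZ x z = c' • pauliXZ x' z') : x = x' ∧ z = z' := by
  have hx : x = x' := by
    by_contra hne
    have := congrFun (congrFun h x) 0
    rw [Matrix.smul_apply, Matrix.smul_apply, pauliXZ_apply, pauliXZ_apply] at this
    simp [hne, hc] at this
  subst hx
  have hcc : c = c' := by
    have := congrFun (congrFun h x) 0
    rw [Matrix.smul_apply, Matrix.smul_apply, pauliXZ_apply, pauliXZ_apply] at this
    simpa using this
  subst hcc
  refine ⟨rfl, funext fun l => ?_⟩
  have := congrFun (congrFun h (Pi.single l 1 + x)) (Pi.single l 1)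
  rw [Matrix.smul_apply, Matrix.smul_apply, pauliXZ_apply, pauliXZ_apply] at this
  simp only [if_true, smul_eq_mul, dotProduct_single, mul_one] at this
  exact injective_stdAddChar (mul_left_cancel₀ hc this)

lemma mem_unitaryGroup_smul_pauliXZ {c : ℂ} (hc : star c * c = 1) (x z : ι → ZMod p) :
    c • pauliXZ x z ∈ unitaryGroup (QuditBasis p ι) ℂ := by
  rw [mem_unitaryGroup_iff', star_eq_conjTranspose, conjTranspose_smul, smul_mul_smul_comm, hc,
    pauliXZ_conjTranspose_mul, one_smul]

/-- The Pauli operators that fix a vector. -/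
def pauliStabilizer (ψ : QuditBasis p ι → ℂ) : Subgroup (unitaryGroup (QuditBasis p ι) ℂ) where
  carrier := {U | IsPauli U ∧ (U : Matrix _ _ ℂ) *ᵥ ψ = ψ}
  mul_mem' := by
    rintro U W ⟨⟨c, x, z, hc, hU⟩, hUψ⟩ ⟨⟨c', x', z', hc', hW⟩, hWψ⟩
    refine ⟨⟨c * c' * stdAddChar (z ⬝ᵥ x'), x + x', z + z', ?_, ?_⟩, ?_⟩
    · rw [mul_pow, mul_pow, hc, hc', mul_comm 2 p, pow_mul, stdAddChar_pow_self]; simp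
    · rw [UnitaryGroup.mul_val, hU, hW, smul_mul_smul_comm, pauliXZ_mul, smul_smul]
    · rw [UnitaryGroup.mul_val, ← mulVec_mulVec, hWψ, hUψ]
  one_mem' := ⟨⟨1, 0, 0, one_pow _, by simp [pauliXZ_zero]⟩, by simp⟩
  inv_mem' := by
    rintro U ⟨⟨c, x, z, hc, hU⟩, hUψ⟩
    refine ⟨⟨star c * stdAddChar (z ⬝ᵥ x), -x, -z, ?_, ?_⟩, ?_⟩
    · rw [mul_pow, ← star_pow, hc, mul_comm 2 p, pow_mul, stdAddChar_pow_self]; simp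
    · rw [UnitaryGroup.inv_val, hU, star_smul, star_eq_conjTranspose, pauliXZ_conjTranspose,
        smul_smul]
    · conv_lhs => rw [← hUψ]
      rw [mulVec_mulVec, ← UnitaryGroup.mul_val, inv_mul_cancel, UnitaryGroup.one_val, one_mulVec]

/-- Rigidity makes every squared modulus $0$ or $1$, so the Parseval sum counts the support. -/
lemma IsPauliRigid.card_support {ψ : QuditBasis p ι → ℂ} (h : IsPauliRigid ψ)
    (hψ : star ψ ⬝ᵥ ψ = 1) :
    Nat.card {u : (ι → ZMod p) × (ι → ZMod p) // pauliEv ψ u.1 u.2 ≠ 0} = p ^ Fintype.card ι := by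
  classical
  have h1 := sum_norm_pauliEv hψ
  have h2 : ∀ u : (ι → ZMod p) × (ι → ZMod p),
      ‖pauliEv ψ u.1 u.2‖ ^ 2 = if pauliEv ψ u.1 u.2 ≠ 0 then (1 : ℝ) else 0 := by
    intro u
    split_ifs with hu
    · exact (h.eigen hψ hu).2
    · rw [not_not.1 hu]; simp
  rw [Finset.sum_congr rfl fun u _ => h2 u, Finset.sum_boole] at h1
  rw [Nat.card_eq_fintype_card, Fintype.card_subtype]
  exact_mod_cast h1

lemma pauliXZ_pow_mulVec {x z : ι → ZMod p} {ψ : QuditBasis p ι → ℂ} {c : ℂ}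
    (h : pauliXZ x z *ᵥ ψ = c • ψ) (n : ℕ) :
    (pauliXZ x z ^ n) *ᵥ ψ = c ^ n • ψ := by
  induction n with
  | zero => simp
  | succ n ih => rw [pow_succ, ← mulVec_mulVec, h, mulVec_smul, ih, smul_smul, pow_succ']

lemma eigenvalue_pow {x z : ι → ZMod p} {ψ : QuditBasis p ι → ℂ} {c d : ℂ} {n : ℕ}
    (hψ : star ψ ⬝ᵥ ψ ≠ 0) (h : pauliXZ x z *ᵥ ψ = c • ψ) (hn : pauliXZ x z ^ n = d • 1) :
    c ^ n = d := by
  have h1 := pauliXZ_pow_mulVec h n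
  rw [hn, smul_mulVec, one_mulVec] at h1
  have h2 := congrArg (star ψ ⬝ᵥ ·) h1
  simp only [dotProduct_smul, smul_eq_mul] at h2
  exact (mul_right_cancel₀ hψ h2).symm

/-- The group is `pauliStabilizer ψ`. Commutation phases and scalars in it must be trivial because
they fix $\psi$. Each label with nonzero expectation occurs with exactly one phase, the inverse of
its eigenvalue, so the order is the size of the support. -/
lemma IsPauliRigid.isStabilizerState {ψ : QuditBasis p ι → ℂ} (h : IsPauliRigid ψ)
    (hψ : star ψ ⬝ᵥ ψ = 1) : IsStabilizerState ψ := by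
  have hψ0 : star ψ ⬝ᵥ ψ ≠ 0 := by rw [hψ]; exact one_ne_zero
  refine ⟨(sum_norm_sq_eq_one_iff ψ).2 hψ, pauliStabilizer ψ, ⟨fun U hU => hU.1, ?_, ?_, ?_⟩,
    fun U hU => hU.2⟩
  · rintro U ⟨⟨c, x, z, hc, hU⟩, hUψ⟩ W ⟨⟨c', x', z', hc', hW⟩, hWψ⟩
    have hcomm : (U.1 * W.1 : Matrix (QuditBasis p ι) (QuditBasis p ι) ℂ) =
        (stdAddChar (pauliForm x z x' z') : ℂ) • (W.1 * U.1) := by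
      rw [hU, hW, smul_mul_smul_comm, smul_mul_smul_comm, pauliXZ_comm, smul_smul, smul_smul,
        mul_comm c c', mul_comm (c' * c)]
    have h1 := congrArg (star ψ ⬝ᵥ · *ᵥ ψ) hcomm
    simp only [smul_mulVec, ← mulVec_mulVec, hUψ, hWψ, dotProduct_smul, hψ, smul_eq_mul,
      mul_one] at h1
    apply Subtype.ext
    rw [UnitaryGroup.mul_val, UnitaryGroup.mul_val, hcomm, ← h1, one_smul]
  · rintro U ⟨-, hUψ⟩ c hc
    rw [hc, smul_mulVec, one_mulVec] at hUψ
    have h2 := congrArg (star ψ ⬝ᵥ ·) hUψ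
    simp only [dotProduct_smul, hψ, smul_eq_mul, mul_one] at h2
    apply Subtype.ext
    rw [hc, h2, one_smul, UnitaryGroup.one_val]
  · rw [← h.card_support hψ]
    have hex : ∀ U : pauliStabilizer ψ, ∃ u : (ι → ZMod p) × (ι → ZMod p), ∃ c : ℂ,
        c ^ (2 * p) = 1 ∧ (U.1 : Matrix _ _ ℂ) = c • pauliXZ u.1 u.2 := by
      rintro ⟨U, ⟨c, x, z, hc, hU⟩, -⟩
      exact ⟨(x, z), c, hc, hU⟩
    choose f c hc hf using hex
    have hc0 : ∀ U, c U ≠ 0 := fun U h0 => by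
      have := hc U
      rw [h0, zero_pow (mul_ne_zero two_ne_zero (NeZero.ne p))] at this
      exact zero_ne_one this
    have heig : ∀ U, pauliXZ (f U).1 (f U).2 *ᵥ ψ = (c U)⁻¹ • ψ := fun U => by
      have h1 := U.2.2
      rw [hf, smul_mulVec] at h1
      rw [eq_inv_smul_iff₀ (hc0 U), h1]
    have hne : ∀ U, pauliEv ψ (f U).1 (f U).2 ≠ 0 := fun U => by
      rw [pauliEv_of_eigen (heig U), hψ, mul_one]; exact inv_ne_zero (hc0 U)
    refine Nat.card_congr (Equiv.ofBijective (fun U => ⟨f U, hne U⟩) ⟨fun U W hUW => ?_, ?_⟩)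
    · have h1 : f U = f W := congrArg Subtype.val hUW
      have h2 := heig U
      rw [h1, heig W] at h2
      have h3 := congrArg (star ψ ⬝ᵥ ·) h2
      simp only [dotProduct_smul, hψ, smul_eq_mul, mul_one] at h3
      apply Subtype.ext
      apply Subtype.ext
      rw [hf, hf, h1, _root_.inv_inj.1 h3]
    · rintro ⟨⟨x, z⟩, hu⟩
      obtain ⟨he, hn⟩ := h.eigen hψ hu
      simp only at he hn
      have hpow : pauliEv ψ x z ^ (2 * p) = 1 :=
        eigenvalue_pow hψ0 he (by rw [pauliXZ_pow_two_mul_self, one_smul])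
      have hpow' : (pauliEv ψ x z)⁻¹ ^ (2 * p) = 1 := by rw [inv_pow, hpow, inv_one]
      let U : pauliStabilizer ψ := ⟨⟨(pauliEv ψ x z)⁻¹ • pauliXZ x z,
        mem_unitaryGroup_smul_pauliXZ (star_mul_self_of_pow (mul_ne_zero two_ne_zero (NeZero.ne p)) hpow') x z⟩,
        ⟨_, x, z, hpow', rfl⟩, by
          change ((pauliEv ψ x z)⁻¹ • pauliXZ x z) *ᵥ ψ = ψ
          rw [smul_mulVec, he, inv_smul_smul₀ hu]⟩
      refine ⟨U, Subtype.ext ?_⟩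
      have h4 : (pauliEv ψ x z)⁻¹ • pauliXZ x z = c U • pauliXZ (f U).1 (f U).2 := hf U
      obtain ⟨h5, h6⟩ := pauliXZ_smul_inj (inv_ne_zero hu) h4
      exact Prod.ext h5.symm h6.symm

/-- The $p^t$ group elements have distinct labels, each with an expectation of modulus one. They
exhaust the Parseval sum, so all other expectations vanish. -/
lemma IsStabilizerState.isPauliRigid {ψ : QuditBasis p ι → ℂ} (h : IsStabilizerState ψ) :
    IsPauliRigid ψ ∧ star ψ ⬝ᵥ ψ = 1 := by
  classical
  obtain ⟨h1, S, hS, hfix⟩ := h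
  have hψ := (sum_norm_sq_eq_one_iff ψ).1 h1
  have hψ0 : star ψ ⬝ᵥ ψ ≠ 0 := by rw [hψ]; exact one_ne_zero
  refine ⟨?_, hψ⟩
  have hex : ∀ U : S, ∃ u : (ι → ZMod p) × (ι → ZMod p), ∃ c : ℂ,
      c ^ (2 * p) = 1 ∧ (U.1 : Matrix _ _ ℂ) = c • pauliXZ u.1 u.2 := by
    rintro ⟨U, hU⟩
    obtain ⟨c, x, z, hc, hU'⟩ := hS.pauli U hU
    exact ⟨(x, z), c, hc, hU'⟩
  choose f c hc hf using hex
  have hc0 : ∀ U, c U ≠ 0 := fun U h0 => by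
    have := hc U
    rw [h0, zero_pow (mul_ne_zero two_ne_zero (NeZero.ne p))] at this
    exact zero_ne_one this
  have heig : ∀ U, pauliXZ (f U).1 (f U).2 *ᵥ ψ = (c U)⁻¹ • ψ := fun U => by
    have h1 := hfix U.1 U.2
    rw [hf, smul_mulVec] at h1
    rw [eq_inv_smul_iff₀ (hc0 U), h1]
  have hinj : Function.Injective f := by
    intro U W hUW
    have h2 := heig U
    rw [hUW, heig W] at h2
    have h3 := congrArg (star ψ ⬝ᵥ ·) h2
    simp only [dotProduct_smul, hψ, smul_eq_mul, mul_one] at h3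
    apply Subtype.ext
    apply Subtype.ext
    rw [hf, hf, hUW, _root_.inv_inj.1 h3]
  have hfin : Finite S := Nat.finite_of_card_ne_zero (by
    rw [hS.card]; exact pow_ne_zero _ (NeZero.ne p))
  have : Fintype S := Fintype.ofFinite S
  have hsum := sum_norm_pauliEv hψ
  have hone : ∀ u ∈ Finset.univ.image f, ‖pauliEv ψ u.1 u.2‖ ^ 2 = 1 := by
    intro u hu
    obtain ⟨U, -, rfl⟩ := Finset.mem_image.1 hu
    rw [pauliEv_of_eigen (heig U), hψ, mul_one]
    exact norm_sq_eq_one_of_star_mul (star_mul_self_of_eigen hψ0 (heig U))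
  have hsub : ∑ u ∈ Finset.univ.image f, ‖pauliEv ψ u.1 u.2‖ ^ 2 = (p : ℝ) ^ Fintype.card ι := by
    rw [Finset.sum_congr rfl hone, Finset.sum_const, Finset.card_image_of_injective _ hinj,
      Finset.card_univ, ← Nat.card_eq_fintype_card, hS.card]
    simp
  intro x z
  by_cases hu : (x, z) ∈ Finset.univ.image f
  · obtain ⟨U, -, hU⟩ := Finset.mem_image.1 hu
    right
    have := heig U
    rw [hU] at this
    exact ⟨_, this⟩
  · left
    have h4 : ∑ u ∈ (Finset.univ.image f)ᶜ, ‖pauliEv ψ u.1 u.2‖ ^ 2 = 0 := by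
      have := Finset.sum_add_sum_compl (Finset.univ.image f)
        (fun u : (ι → ZMod p) × (ι → ZMod p) => ‖pauliEv ψ u.1 u.2‖ ^ 2)
      linarith
    rw [Finset.sum_eq_zero_iff_of_nonneg fun _ _ => by positivity] at h4
    have := h4 (x, z) (Finset.mem_compl.2 hu)
    simpa using this

end Rigid

/-! ### Projections onto eigenspaces of Pauli operators -/

section Projection

open Matrix ZMod

variable {p : ℕ} [NeZero p] {ι : Type*} [Fintype ι] [DecidableEq ι]

/-- Conjugation by the stabilizing operator preserves the expectation but multiplies the observable
by a phase different from one. -/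
lemma pauliEv_eq_zero_of_eigen {x z y w : ι → ZMod p} {φ : QuditBasis p ι → ℂ} {c : ℂ}
    (hc : star c * c = 1) (h : pauliXZ x z *ᵥ φ = c • φ) (hne : pauliForm y w x z ≠ 0) :
    pauliEv φ y w = 0 := by
  have h1 : pauliEv φ y w = stdAddChar (pauliForm y w x z) * pauliEv φ y w := by
    calc pauliEv φ y w = star c * c * pauliEv φ y w := by rw [hc, one_mul]
      _ = star φ ⬝ᵥ ((pauliXZ x z)ᴴ *ᵥ (pauliXZ y w *ᵥ (pauliXZ x z *ᵥ φ))) := by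
        rw [dotProduct_mulVec, ← star_mulVec, h, star_smul, mulVec_smul, smul_dotProduct,
          dotProduct_smul, smul_eq_mul, smul_eq_mul, pauliEv, mul_assoc]
      _ = _ := by
        rw [mulVec_mulVec, mulVec_mulVec, mul_assoc _ (pauliXZ y w), pauliXZ_comm y w,
          mul_smul_comm, ← mul_assoc, pauliXZ_conjTranspose_mul, one_mul, smul_mulVec,
          dotProduct_smul, smul_eq_mul, pauliEv]
  by_contra h0
  exact hne ((stdAddChar_eq_one_iff _).1 (mul_right_cancel₀ h0 (h1.symm.trans (one_mul _).symm)))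

/-- The projection onto the eigenspace of `X^x Z^z` with eigenvalue `c`. -/
def pauliProj (x z : ι → ZMod p) (c : ℂ) : Matrix (QuditBasis p ι) (QuditBasis p ι) ℂ :=
  (p : ℂ)⁻¹ • ∑ j ∈ Finset.range p, (c⁻¹ • pauliXZ x z) ^ j

variable {x z : ι → ZMod p} {c : ℂ}

lemma inv_smul_pauliXZ_pow_self (hc0 : c ≠ 0) (hc : pauliXZ x z ^ p = c ^ p • 1) :
    (c⁻¹ • pauliXZ x z) ^ p = 1 := by
  rw [smul_pow, hc, smul_smul, ← mul_pow, inv_mul_cancel₀ hc0, one_pow, one_smul]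

lemma mul_pauliProj (hc0 : c ≠ 0) (hc : pauliXZ x z ^ p = c ^ p • 1) :
    (c⁻¹ • pauliXZ x z) * pauliProj x z c = pauliProj x z c := by
  rw [pauliProj, mul_smul_comm]
  congr 1
  -- Multiplication shifts the powers cyclically: the sum over $0,\dots,p$ is split off at both
  -- ends, whose terms agree because the $p$-th power is $1$.
  have h1 := Finset.sum_range_succ (fun j => (c⁻¹ • pauliXZ x z) ^ j) p
  rw [Finset.sum_range_succ', inv_smul_pauliXZ_pow_self hc0 hc, pow_zero] at h1
  rw [Finset.mul_sum, ← add_right_cancel h1]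
  exact Finset.sum_congr rfl fun j _ => (pow_succ' _ _).symm

lemma commute_pauliProj {Q : Matrix (QuditBasis p ι) (QuditBasis p ι) ℂ}
    (hQ : Commute Q (c⁻¹ • pauliXZ x z)) : Commute Q (pauliProj x z c) :=
  (Commute.sum_right _ _ _ fun j _ => hQ.pow_right j).smul_right _

lemma pow_mul_pauliProj (hc0 : c ≠ 0) (hc : pauliXZ x z ^ p = c ^ p • 1) (j : ℕ) :
    (c⁻¹ • pauliXZ x z) ^ j * pauliProj x z c = pauliProj x z c := by
  induction j with
  | zero => simp
  | succ j ih => rw [pow_succ, mul_assoc, mul_pauliProj hc0 hc, ih]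

lemma pauliProj_mul_pow (hc0 : c ≠ 0) (hc : pauliXZ x z ^ p = c ^ p • 1) (j : ℕ) :
    pauliProj x z c * (c⁻¹ • pauliXZ x z) ^ j = pauliProj x z c := by
  rw [← (commute_pauliProj ((Commute.refl _).pow_left j)).eq, pow_mul_pauliProj hc0 hc]

lemma pauliXZ_mulVec_pauliProj (hc0 : c ≠ 0) (hc : pauliXZ x z ^ p = c ^ p • 1)
    (ψ : QuditBasis p ι → ℂ) :
    pauliXZ x z *ᵥ (pauliProj x z c *ᵥ ψ) = c • (pauliProj x z c *ᵥ ψ) := by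
  conv_rhs => rw [← mul_pauliProj hc0 hc, ← mulVec_mulVec, smul_mulVec, smul_inv_smul₀ hc0]

lemma inv_smul_pauliXZ_pow_inner (hc : star c * c = 1) (j : ℕ) (ψ φ : QuditBasis p ι → ℂ) :
    star ((c⁻¹ • pauliXZ x z) ^ j *ᵥ ψ) ⬝ᵥ ((c⁻¹ • pauliXZ x z) ^ j *ᵥ φ) = star ψ ⬝ᵥ φ := by
  induction j with
  | zero => simp
  | succ j ih =>
    rw [pow_succ', ← mulVec_mulVec, ← mulVec_mulVec, smul_mulVec, smul_mulVec, star_smul,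
      smul_dotProduct, dotProduct_smul, smul_smul, pauliXZ_inner, ih, star_inv₀, ← mul_inv, hc,
      inv_one, one_smul]

/-- This takes the place of self-adjointness and idempotence of the projection: each power on the
left is unitary, commutes with `Q`, and is absorbed by the projection on the right. -/
lemma star_pauliProj_dotProduct (hc0 : c ≠ 0) (hc1 : star c * c = 1)
    (hc : pauliXZ x z ^ p = c ^ p • 1) {Q : Matrix (QuditBasis p ι) (QuditBasis p ι) ℂ}
    (hQ : Commute Q (c⁻¹ • pauliXZ x z)) (ψ : QuditBasis p ι → ℂ) :
    star (pauliProj x z c *ᵥ ψ) ⬝ᵥ (Q *ᵥ (pauliProj x z c *ᵥ ψ)) =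
      star ψ ⬝ᵥ (Q *ᵥ (pauliProj x z c *ᵥ ψ)) := by
  have hp : (p : ℂ) ≠ 0 := NeZero.ne _
  have h1 : ∀ j, star ((c⁻¹ • pauliXZ x z) ^ j *ᵥ ψ) ⬝ᵥ (Q *ᵥ (pauliProj x z c *ᵥ ψ)) =
      star ψ ⬝ᵥ (Q *ᵥ (pauliProj x z c *ᵥ ψ)) := by
    intro j
    rw [← inv_smul_pauliXZ_pow_inner (x := x) (z := z) hc1 j ψ]
    congr 1
    rw [mulVec_mulVec, mulVec_mulVec, ← mul_assoc, ← (hQ.pow_right j).eq, mul_assoc,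
      pow_mul_pauliProj hc0 hc]
  conv_lhs =>
    enter [1]
    rw [pauliProj, smul_mulVec, sum_mulVec, star_smul, star_sum]
  rw [smul_dotProduct, sum_dotProduct, Finset.sum_congr rfl fun j _ => h1 j, Finset.sum_const,
    Finset.card_range, star_inv₀, star_natCast, nsmul_eq_mul, smul_eq_mul, inv_mul_cancel_left₀ hp]

lemma pauliXZ_mul_pow (y w : ι → ZMod p) (hc0 : c ≠ 0) (j : ℕ) :
    ∃ s : ℂ, s ≠ 0 ∧ pauliXZ y w * (c⁻¹ • pauliXZ x z) ^ j = s • pauliXZ (y + j • x) (w + j • z) := by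
  refine ⟨(c⁻¹) ^ j * (stdAddChar (z ⬝ᵥ x) ^ j.choose 2 * stdAddChar (w ⬝ᵥ (j • x))),
    mul_ne_zero (pow_ne_zero _ (inv_ne_zero hc0))
      (mul_ne_zero (pow_ne_zero _ (stdAddChar_ne_zero _)) (stdAddChar_ne_zero _)), ?_⟩
  rw [smul_pow, mul_smul_comm, pauliXZ_pow, mul_smul_comm, pauliXZ_mul, smul_smul, smul_smul,
    mul_assoc]

/-- A Pauli $Y$ not commuting with the measured operator $C$ has expectation zero. If $Y$ commutes,
its expectation is an average of $\langle\psi,YC^j\psi\rangle$ up to phases. Should one of these be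
nonzero, $\psi$ is an eigenvector of $YC^j$, and since the projection absorbs $C^j$, the projected
vector is an eigenvector of $Y$. -/
lemma IsPauliRigid.pauliProj {ψ : QuditBasis p ι → ℂ} (hψ : IsPauliRigid ψ) (hc0 : c ≠ 0)
    (hc1 : star c * c = 1) (hc : pauliXZ x z ^ p = c ^ p • 1) :
    IsPauliRigid (pauliProj x z c *ᵥ ψ) := by
  intro y w
  by_cases ht : pauliForm y w x z = 0
  · have hcomm : Commute (pauliXZ y w) (c⁻¹ • pauliXZ x z) := by
      refine Commute.smul_right ?_ _
      have := pauliXZ_comm y w x z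
      rwa [ht, AddChar.map_zero_eq_one, one_smul] at this
    by_cases hall : ∀ j ∈ Finset.range p,
        star ψ ⬝ᵥ ((pauliXZ y w * (c⁻¹ • pauliXZ x z) ^ j) *ᵥ ψ) = 0
    · left
      rw [pauliEv, star_pauliProj_dotProduct hc0 hc1 hc hcomm, mulVec_mulVec, _root_.pauliProj,
        mul_smul_comm, smul_mulVec, dotProduct_smul, Finset.mul_sum, sum_mulVec, dotProduct_sum,
        Finset.sum_eq_zero hall, smul_zero]
    · right
      push Not at hall
      obtain ⟨j, -, hj⟩ := hall
      obtain ⟨s, hs, hsj⟩ := pauliXZ_mul_pow (x := x) (z := z) y w hc0 j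
      rw [hsj, smul_mulVec, dotProduct_smul, smul_eq_mul] at hj
      obtain ⟨d, hd⟩ := (hψ _ _).resolve_left (right_ne_zero_of_mul hj)
      refine ⟨s * d, ?_⟩
      calc pauliXZ y w *ᵥ (_root_.pauliProj x z c *ᵥ ψ)
          = _root_.pauliProj x z c *ᵥ ((pauliXZ y w * (c⁻¹ • pauliXZ x z) ^ j) *ᵥ ψ) := by
            rw [mulVec_mulVec, mulVec_mulVec, (hcomm.pow_right j).eq, ← mul_assoc,
              pauliProj_mul_pow hc0 hc, (commute_pauliProj hcomm).eq]
        _ = _ := by rw [hsj, smul_mulVec, hd, mulVec_smul, mulVec_smul, smul_smul]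
  · left
    exact pauliEv_eq_zero_of_eigen hc1 (pauliXZ_mulVec_pauliProj hc0 hc ψ) ht

lemma pauliForm_swap {p : ℕ} {ι : Type*} [Fintype ι] (x z x' z' : ι → ZMod p) : pauliForm x z x' z' = -pauliForm x' z' x z := by
  rw [pauliForm, pauliForm, neg_sub]

lemma pauliForm_nsmul {p : ℕ} {ι : Type*} [Fintype ι] (j : ℕ) (x z x' z' : ι → ZMod p) :
    pauliForm (j • x) (j • z) x' z' = j • pauliForm x z x' z' := by
  rw [pauliForm, pauliForm, smul_dotProduct, dotProduct_smul, smul_sub]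

lemma nsmul_ne_zero_of_lt {p : ℕ} [Fact p.Prime] {t : ZMod p} (ht : t ≠ 0) {j : ℕ} (hj0 : j ≠ 0)
    (hj : j < p) : j • t ≠ 0 := by
  rw [nsmul_eq_mul]
  refine mul_ne_zero (fun h => ?_) ht
  rw [ZMod.natCast_eq_zero_iff] at h
  exact absurd (Nat.le_of_dvd (Nat.pos_of_ne_zero hj0) h) (by omega)

/-- A noncommuting Pauli operator moves $\psi$ into a different eigenspace, which the projection
kills. -/
lemma pauliProj_mulVec_eq_zero {x' z' : ι → ZMod p} {ψ : QuditBasis p ι → ℂ} (hc0 : c ≠ 0)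
    (hc : pauliXZ x z ^ p = c ^ p • 1) (h : pauliXZ x z *ᵥ ψ = c • ψ)
    (hne : pauliForm x z x' z' ≠ 0) : pauliProj x z c *ᵥ (pauliXZ x' z' *ᵥ ψ) = 0 := by
  have h1 : pauliProj x z c *ᵥ (pauliXZ x' z' *ᵥ ψ) =
      (stdAddChar (pauliForm x z x' z') : ℂ) • (pauliProj x z c *ᵥ (pauliXZ x' z' *ᵥ ψ)) := by
    conv_lhs => rw [← pauliProj_mul_pow hc0 hc 1]
    rw [pow_one, ← mulVec_mulVec, smul_mulVec, mulVec_mulVec, pauliXZ_comm, smul_mulVec,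
      ← mulVec_mulVec, h]
    simp only [mulVec_smul, smul_smul]
    rw [mul_comm _ c, inv_mul_cancel_left₀ hc0]
  by_contra h0
  have h2 : ((stdAddChar (pauliForm x z x' z') : ℂ) - 1) •
      (pauliProj x z c *ᵥ (pauliXZ x' z' *ᵥ ψ)) = 0 := by
    rw [sub_smul, ← h1, one_smul, sub_self]
  rcases smul_eq_zero.1 h2 with h3 | h3
  · exact hne ((stdAddChar_eq_one_iff _).1 (sub_eq_zero.1 h3))
  · exact h0 h3

/-- Measuring a Pauli operator which does not commute with a stabilizing Pauli operator gives a
stabilizer state from which the original one can be recovered. -/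
lemma IsPauliRigid.exists_measured [Fact p.Prime] {ψ : QuditBasis p ι → ℂ} (hψ : IsPauliRigid ψ)
    (h1 : star ψ ⬝ᵥ ψ = 1) (h : pauliXZ x z *ᵥ ψ = c • ψ) {x' z' : ι → ZMod p} {c' : ℂ}
    (hne : pauliForm x z x' z' ≠ 0) (hc1 : star c' * c' = 1)
    (hc : pauliXZ x' z' ^ p = c' ^ p • 1) :
    ∃ φ : QuditBasis p ι → ℂ, IsPauliRigid φ ∧ star φ ⬝ᵥ φ = 1 ∧ pauliXZ x' z' *ᵥ φ = c' • φ ∧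
      ψ = (√p : ℂ) • (_root_.pauliProj x z c *ᵥ φ) := by
  have hp0 : (0 : ℝ) < p := Nat.cast_pos.2 (NeZero.pos p)
  have hsq : ((√p : ℝ) : ℂ) * ((√p : ℝ) : ℂ) = p := by
    rw [← Complex.ofReal_mul, Real.mul_self_sqrt hp0.le, Complex.ofReal_natCast]
  have hp : (p : ℂ) ≠ 0 := NeZero.ne _
  have h10 : star ψ ⬝ᵥ ψ ≠ 0 := by rw [h1]; exact one_ne_zero
  have hcu := star_mul_self_of_eigen h10 h
  have hcu0 : c ≠ 0 := right_ne_zero_of_mul (by rw [hcu]; exact one_ne_zero)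
  have hcp : pauliXZ x z ^ p = c ^ p • 1 := by
    rw [pauliXZ_pow_self, eigenvalue_pow h10 h (pauliXZ_pow_self x z)]
  have hc0 : c' ≠ 0 := right_ne_zero_of_mul (by rw [hc1]; exact one_ne_zero)
  have hform : ∀ j ∈ Finset.range p, j ≠ 0 → pauliForm x z (0 + j • x') (0 + j • z') ≠ 0 := by
    intro j hj hj0
    rw [zero_add, zero_add, pauliForm_swap, pauliForm_nsmul, ← smul_neg, ← pauliForm_swap]
    exact nsmul_ne_zero_of_lt hne hj0 (Finset.mem_range.1 hj)
  have hpow : ∀ j : ℕ, ∃ s : ℂ, (c'⁻¹ • pauliXZ x' z') ^ j =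
      s • pauliXZ (0 + j • x') (0 + j • z') := by
    intro j
    obtain ⟨s, -, hs⟩ := pauliXZ_mul_pow (x := x') (z := z') 0 0 hc0 j
    rw [pauliXZ_zero, one_mul] at hs
    exact ⟨s, hs⟩
  have hmem : 0 ∈ Finset.range p := Finset.mem_range.2 (NeZero.pos p)
  -- The outcome $c'$ has probability $1/p$: in $\langle\psi,P'\psi\rangle$ only the power $j=0$ has
  -- nonzero expectation. Hence the normalisation $\sqrt p$.
  refine ⟨(√p : ℂ) • (_root_.pauliProj x' z' c' *ᵥ ψ), ?_, ?_, ?_, ?_⟩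
  · intro y w
    rcases hψ.pauliProj hc0 hc1 hc y w with h2 | ⟨d, hd⟩
    · left
      rw [pauliEv, star_smul, mulVec_smul, smul_dotProduct, dotProduct_smul]
      rw [pauliEv] at h2
      rw [h2, smul_zero, smul_zero]
    · right
      exact ⟨d, by rw [mulVec_smul, hd, smul_comm]⟩
  · have h2 := star_pauliProj_dotProduct hc0 hc1 hc (Commute.one_left _) ψ
    rw [one_mulVec] at h2
    rw [star_smul, smul_dotProduct, dotProduct_smul, h2, _root_.pauliProj, smul_mulVec, sum_mulVec,
      dotProduct_smul, dotProduct_sum, Finset.sum_eq_single_of_mem 0 hmem, pow_zero, one_mulVec, h1]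
    · simp only [smul_eq_mul, mul_one, Complex.star_def, Complex.conj_ofReal]
      rw [← mul_assoc, hsq, mul_inv_cancel₀ hp]
    · intro j hj hj0
      obtain ⟨s, hs⟩ := hpow j
      have h3 : pauliEv ψ (0 + j • x') (0 + j • z') = 0 := by
        refine pauliEv_eq_zero_of_eigen hcu h ?_
        rw [pauliForm_swap]
        exact neg_ne_zero.2 (hform j hj hj0)
      rw [pauliEv] at h3
      rw [hs, smul_mulVec, dotProduct_smul, h3, smul_zero]
  · rw [mulVec_smul, pauliXZ_mulVec_pauliProj hc0 hc, smul_comm]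
  · have h2 : _root_.pauliProj x z c *ᵥ ψ = ψ := by
      have h3 : ∀ j, (c⁻¹ • pauliXZ x z) ^ j *ᵥ ψ = ψ := by
        intro j
        rw [smul_pow, smul_mulVec, pauliXZ_pow_mulVec h, smul_smul, ← mul_pow,
          inv_mul_cancel₀ hcu0, one_pow, one_smul]
      rw [_root_.pauliProj, smul_mulVec, sum_mulVec, Finset.sum_congr rfl fun j _ => h3 j,
        Finset.sum_const, Finset.card_range, ← Nat.cast_smul_eq_nsmul ℂ, inv_smul_smul₀ hp]
    -- The two factors $\sqrt p$ cancel the $1/p$ of the inner projection. What remains is a sum of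
    -- projected vectors, in which every power $j\neq0$ is killed by the outer projection.
    rw [mulVec_smul, smul_smul, hsq, _root_.pauliProj.eq_def x' z' c', smul_mulVec, mulVec_smul,
      smul_inv_smul₀ hp, sum_mulVec, mulVec_sum, Finset.sum_eq_single_of_mem 0 hmem, pow_zero,
      one_mulVec, h2]
    intro j hj hj0
    obtain ⟨s, hs⟩ := hpow j
    rw [hs, smul_mulVec, mulVec_smul, pauliProj_mulVec_eq_zero hcu0 hcp h (hform j hj hj0),
      smul_zero]

end Projection

/-! ### The second moment of a random stabilizer state -/

namespace StabState

open Matrix ZMod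

variable {p : ℕ} [NeZero p] {ι : Type*} [Fintype ι] [DecidableEq ι]

lemma exists_vec (σ : StabState p ι) : ∃ ψ : QuditBasis p ι → ℂ, IsPauliRigid ψ ∧
    star ψ ⬝ᵥ ψ = 1 ∧ σ.1 = vecMulVec ψ (star ψ) := by
  obtain ⟨ψ, hψ, h⟩ := σ.2
  exact ⟨ψ, hψ.isPauliRigid.1, hψ.isPauliRigid.2, h⟩

/-- The state of a Pauli-rigid unit vector. -/
def ofVec (ψ : QuditBasis p ι → ℂ) (h : IsPauliRigid ψ) (h1 : star ψ ⬝ᵥ ψ = 1) : StabState p ι :=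
  ⟨vecMulVec ψ (star ψ), ψ, h.isStabilizerState h1, rfl⟩

/-- The expectation value of `X^x Z^z` in a stabilizer state. -/
def ev (σ : StabState p ι) (u : (ι → ZMod p) × (ι → ZMod p)) : ℂ := (pauliXZ u.1 u.2 * σ.1).trace

lemma ev_eq {σ : StabState p ι} {ψ : QuditBasis p ι → ℂ} (h : σ.1 = vecMulVec ψ (star ψ))
    (u : (ι → ZMod p) × (ι → ZMod p)) : σ.ev u = pauliEv ψ u.1 u.2 := by
  rw [ev, h, trace_pauliXZ_mul_vecMulVec]

lemma eq_sum_pauliXZ (σ : StabState p ι) : σ.1 = ((p : ℂ) ^ Fintype.card ι)⁻¹ •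
    ∑ u : (ι → ZMod p) × (ι → ZMod p), star (σ.ev u) • pauliXZ u.1 u.2 := by
  obtain ⟨ψ, -, -, h⟩ := σ.exists_vec
  simp only [ev_eq h]
  rw [h, ← vecMulVec_eq_sum_pauliXZ]

lemma ext_ev {σ τ : StabState p ι} (h : ∀ u, σ.ev u = τ.ev u) : σ = τ := by
  apply Subtype.ext
  rw [eq_sum_pauliXZ σ, eq_sum_pauliXZ τ]
  simp only [h]

lemma ev_zero (σ : StabState p ι) : σ.ev 0 = 1 := by
  obtain ⟨ψ, -, h1, h⟩ := σ.exists_vec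
  rw [ev_eq h, pauliEv, Prod.fst_zero, Prod.snd_zero, pauliXZ_zero, one_mulVec, h1]

lemma ev_pow (σ : StabState p ι) (u : (ι → ZMod p) × (ι → ZMod p)) :
    σ.ev u = 0 ∨ σ.ev u ^ (2 * p) = 1 := by
  obtain ⟨ψ, hr, h1, h⟩ := σ.exists_vec
  rw [ev_eq h]
  by_cases hu : pauliEv ψ u.1 u.2 = 0
  · exact Or.inl hu
  · exact Or.inr (eigenvalue_pow (by rw [h1]; exact one_ne_zero) (hr.eigen h1 hu).1
      (by rw [pauliXZ_pow_two_mul_self, one_smul]))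

lemma norm_ev (σ : StabState p ι) (u : (ι → ZMod p) × (ι → ZMod p)) :
    star (σ.ev u) * σ.ev u = if σ.ev u ≠ 0 then 1 else 0 := by
  split_ifs with h
  · exact star_mul_self_of_pow (mul_ne_zero two_ne_zero (NeZero.ne p)) ((σ.ev_pow u).resolve_left h)
  · rw [not_not.1 h, mul_zero]

/-- The Pauli expectations determine the state and take finitely many values: zero and the $2p$-th
roots of unity. -/
instance : Finite (StabState p ι) := by
  have hfin : Set.Finite {c : ℂ | c = 0 ∨ c ^ (2 * p) = 1} := by
    refine (Set.finite_singleton 0).union (Set.Finite.subset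
      ((Polynomial.nthRootsFinset (2 * p) (1 : ℂ)).finite_toSet) fun c hc => ?_)
    have hp : 0 < 2 * p := mul_pos two_pos (NeZero.pos p)
    exact Finset.mem_coe.2 ((Polynomial.mem_nthRootsFinset hp _).2 hc)
  have := hfin.to_subtype
  exact Finite.of_injective
    (fun (σ : StabState p ι) u => (⟨σ.ev u, σ.ev_pow u⟩ : {c : ℂ | c = 0 ∨ c ^ (2 * p) = 1}))
    fun σ τ h => ext_ev fun u => congrArg Subtype.val (congrFun h u)

instance : Fintype (StabState p ι) := Fintype.ofFinite _

lemma pauliRigid_single : IsPauliRigid (Pi.single 0 1 : QuditBasis p ι → ℂ) := by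
  intro x z
  by_cases hx : x = 0
  · right
    refine ⟨1, funext fun i => ?_⟩
    subst hx
    rw [pauliXZ_mulVec, one_smul, sub_zero]
    by_cases hi : i = 0
    · simp [hi]
    · simp [hi]
  · left
    rw [pauliEv, ← Pi.single_star, single_dotProduct, pauliXZ_mulVec]
    simp [hx]

instance : Nonempty (StabState p ι) := ⟨ofVec (Pi.single 0 1) pauliRigid_single (by simp)⟩

lemma star_apply (σ : StabState p ι) (i j : QuditBasis p ι) : star (σ.1 i j) = σ.1 j i := by
  obtain ⟨ψ, -, -, h⟩ := σ.exists_vec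
  rw [h, vecMulVec_apply, vecMulVec_apply, Pi.star_apply, Pi.star_apply, star_mul, star_star]

lemma trace_eq_one (σ : StabState p ι) : σ.1.trace = 1 := by
  have := σ.ev_zero
  rwa [ev, Prod.fst_zero, Prod.snd_zero, pauliXZ_zero, one_mul] at this

lemma mul_self (σ : StabState p ι) : σ.1 * σ.1 = σ.1 := by
  obtain ⟨ψ, -, h1, h⟩ := σ.exists_vec
  rw [h, vecMulVec_mul_vecMulVec, h1, one_smul]

/-- Conjugation by a Pauli operator acts on the expectations by a character, the symmetry behind the
orthogonality relation below. -/
lemma exists_conj (g : (ι → ZMod p) × (ι → ZMod p)) (σ : StabState p ι) : ∃ τ : StabState p ι,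
    ∀ u, τ.ev u = stdAddChar (pauliForm u.1 u.2 g.1 g.2) * σ.ev u := by
  obtain ⟨ψ, hr, h1, h⟩ := σ.exists_vec
  have hev : ∀ x z, pauliEv (pauliXZ g.1 g.2 *ᵥ ψ) x z =
      stdAddChar (pauliForm x z g.1 g.2) * pauliEv ψ x z := by
    intro x z
    rw [pauliEv, mulVec_mulVec, pauliXZ_comm, smul_mulVec, ← mulVec_mulVec, dotProduct_smul,
      pauliXZ_inner, smul_eq_mul, pauliEv]
  refine ⟨ofVec (pauliXZ g.1 g.2 *ᵥ ψ) (fun x z => ?_) ?_, fun u => ?_⟩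
  · rcases hr x z with h0 | ⟨c, hc⟩
    · left; rw [hev, h0, mul_zero]
    · right
      exact ⟨stdAddChar (pauliForm x z g.1 g.2) * c, by
        rw [mulVec_mulVec, pauliXZ_comm, smul_mulVec, ← mulVec_mulVec, hc, mulVec_smul, smul_smul]⟩
  · rw [pauliXZ_inner, h1]
  · rw [ev_eq rfl, hev, ev_eq h]

lemma exists_pauliForm_ne {u w : (ι → ZMod p) × (ι → ZMod p)} (h : u ≠ w) :
    ∃ g : (ι → ZMod p) × (ι → ZMod p), pauliForm u.1 u.2 g.1 g.2 ≠ pauliForm w.1 w.2 g.1 g.2 := by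
  by_contra! hall
  refine h (Prod.ext (funext fun l => ?_) (funext fun l => ?_))
  · simpa [pauliForm] using hall (0, Pi.single l 1)
  · simpa [pauliForm] using hall (Pi.single l 1, 0)

/-- Reindexing the sum by a Pauli conjugation that separates `u` from `w` multiplies it by a phase
other than one. -/
lemma sum_star_ev_mul_ev {u w : (ι → ZMod p) × (ι → ZMod p)} (h : u ≠ w) :
    ∑ σ : StabState p ι, star (σ.ev u) * σ.ev w = 0 := by
  obtain ⟨g, hg⟩ := exists_pauliForm_ne h
  choose f hf using exists_conj (p := p) (ι := ι) g
  have hinj : Function.Injective f := fun σ τ hστ => ext_ev fun u => by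
    have := hf σ u
    rw [hστ, hf τ u] at this
    exact (mul_left_cancel₀ (stdAddChar_ne_zero _) this).symm
  have hbij : Function.Bijective f := Finite.injective_iff_bijective.1 hinj
  have h1 : ∑ σ : StabState p ι, star (σ.ev u) * σ.ev w =
      stdAddChar (pauliForm w.1 w.2 g.1 g.2 - pauliForm u.1 u.2 g.1 g.2) *
        ∑ σ : StabState p ι, star (σ.ev u) * σ.ev w := by
    conv_lhs => rw [← hbij.sum_comp]
    rw [Finset.mul_sum]
    refine Finset.sum_congr rfl fun σ _ => ?_
    rw [hf, hf, star_mul, star_stdAddChar, sub_eq_neg_add, AddChar.map_add_eq_mul]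
    ring
  by_contra h0
  have h2 := (stdAddChar_eq_one_iff _).1
    (mul_right_cancel₀ h0 (h1.symm.trans (one_mul _).symm))
  exact hg (sub_eq_zero.1 h2).symm

/-- The number of stabilizer states with a nonzero expectation value of `X^x Z^z`. -/
def evCount (u : (ι → ZMod p) × (ι → ZMod p)) : ℕ :=
  open Classical in (Finset.univ.filter fun σ : StabState p ι => σ.ev u ≠ 0).card

lemma sum_norm_ev (u : (ι → ZMod p) × (ι → ZMod p)) :
    ∑ σ : StabState p ι, star (σ.ev u) * σ.ev u = evCount u := by
  classical
  rw [Finset.sum_congr rfl fun σ _ => norm_ev σ u, Finset.sum_boole, evCount]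

lemma evCount_zero : evCount (0 : (ι → ZMod p) × (ι → ZMod p)) = Fintype.card (StabState p ι) := by
  classical
  rw [evCount, Finset.filter_true_of_mem, Finset.card_univ]
  intro σ _
  rw [ev_zero]; exact one_ne_zero

/-- Measuring `w` in a state stabilized by a multiple of `u` gives a state stabilized by a multiple
of `w`. With the outcome prescribed as a function of the eigenvalue of `u`, the original state can
be recovered, so the map is injective. -/
lemma evCount_le_of_pauliForm [Fact p.Prime] {u w : (ι → ZMod p) × (ι → ZMod p)}
    (h : pauliForm u.1 u.2 w.1 w.2 ≠ 0) : evCount u ≤ evCount w := by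
  classical
  -- The $p$-th powers of the two operators may be different scalars. The factor `r` turns an
  -- eigenvalue of `u` into an admissible eigenvalue of `w`.
  obtain ⟨r, hr⟩ : ∃ r : ℂ, r ^ p * stdAddChar (u.2 ⬝ᵥ u.1) ^ p.choose 2 =
      stdAddChar (w.2 ⬝ᵥ w.1) ^ p.choose 2 := by
    obtain ⟨r, hr⟩ := IsAlgClosed.exists_pow_nat_eq
      ((stdAddChar (w.2 ⬝ᵥ w.1) : ℂ) ^ p.choose 2 / stdAddChar (u.2 ⬝ᵥ u.1) ^ p.choose 2)
      (NeZero.pos p)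
    exact ⟨r, by rw [hr, div_mul_cancel₀ _ (pow_ne_zero _ (stdAddChar_ne_zero _))]⟩
  have hr0 : r ≠ 0 := by
    rintro rfl
    rw [zero_pow (NeZero.ne p), zero_mul] at hr
    exact pow_ne_zero _ (stdAddChar_ne_zero _) hr.symm
  have hex : ∀ σ : StabState p ι, σ.ev u ≠ 0 → ∃ τ : StabState p ι, τ.ev w = r * σ.ev u ∧
      σ.1 = (p : ℂ) • (pauliProj u.1 u.2 (σ.ev u) * τ.1 * (pauliProj u.1 u.2 (σ.ev u))ᴴ) := by
    intro σ hσ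
    obtain ⟨ψ, hrig, h1, hσψ⟩ := σ.exists_vec
    rw [ev_eq hσψ] at hσ
    have h10 : star ψ ⬝ᵥ ψ ≠ 0 := by rw [h1]; exact one_ne_zero
    have heig := (hrig.eigen h1 hσ).1
    have hpow := eigenvalue_pow h10 heig (pauliXZ_pow_self _ _)
    have hpow' : (r * pauliEv ψ u.1 u.2) ^ p = stdAddChar (w.2 ⬝ᵥ w.1) ^ p.choose 2 := by
      rw [mul_pow, hpow, hr]
    have hc1 : star (r * pauliEv ψ u.1 u.2) * (r * pauliEv ψ u.1 u.2) = 1 := by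
      refine star_mul_self_of_pow (n := p * p) (mul_ne_zero (NeZero.ne p) (NeZero.ne p)) ?_
      rw [pow_mul, hpow', ← pow_mul, mul_comm, pow_mul, stdAddChar_pow_self, one_pow]
    obtain ⟨φ, hφ, hφ1, hφe, hφψ⟩ := hrig.exists_measured h1 heig h hc1
      (by rw [hpow', pauliXZ_pow_self])
    refine ⟨ofVec φ hφ hφ1, ?_, ?_⟩
    · rw [ev_eq rfl, pauliEv_of_eigen hφe, hφ1, mul_one, ev_eq hσψ]
    · have hsq : ((√p : ℝ) : ℂ) * ((√p : ℝ) : ℂ) = p := by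
        rw [← Complex.ofReal_mul, Real.mul_self_sqrt (Nat.cast_nonneg _), Complex.ofReal_natCast]
      have hvec : vecMulVec ψ (star ψ) = (p : ℂ) • (pauliProj u.1 u.2 (pauliEv ψ u.1 u.2) *
          vecMulVec φ (star φ) * (pauliProj u.1 u.2 (pauliEv ψ u.1 u.2))ᴴ) := by
        conv_lhs => rw [hφψ]
        rw [star_smul, smul_vecMulVec, vecMulVec_smul, smul_smul, Complex.star_def,
          Complex.conj_ofReal, hsq, star_mulVec, mul_vecMulVec, vecMulVec_mul]
      rw [ev_eq hσψ, hσψ]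
      exact hvec
  rw [evCount, evCount]
  choose! f hf hf' using hex
  refine Finset.card_le_card_of_injOn f (fun σ hσ => ?_) fun σ hσ τ hτ hστ => ?_
  · have hσ' : σ.ev u ≠ 0 := by simpa using hσ
    simpa [hf σ hσ', hr0] using hσ'
  · have hσ' : σ.ev u ≠ 0 := by simpa using hσ
    have hτ' : τ.ev u ≠ 0 := by simpa using hτ
    have h1 := hf σ hσ'
    rw [hστ, hf τ hτ'] at h1
    have h2 := mul_left_cancel₀ hr0 h1
    apply Subtype.ext
    rw [hf' σ hσ', hf' τ hτ', hστ, h2]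

/-- The orthogonal complements of `u` and `w` are proper subgroups, and two such never cover the
whole space: one of `a`, `b`, `a + b` avoids both. -/
lemma exists_pauliForm_ne_zero [Fact p.Prime] {u w : (ι → ZMod p) × (ι → ZMod p)} (hu : u ≠ 0)
    (hw : w ≠ 0) : ∃ g : (ι → ZMod p) × (ι → ZMod p),
      pauliForm u.1 u.2 g.1 g.2 ≠ 0 ∧ pauliForm g.1 g.2 w.1 w.2 ≠ 0 := by
  obtain ⟨a, ha⟩ := exists_pauliForm_ne hu
  obtain ⟨b, hb⟩ := exists_pauliForm_ne hw
  have hz : ∀ g : (ι → ZMod p) × (ι → ZMod p),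
      pauliForm (0 : (ι → ZMod p) × (ι → ZMod p)).1 (0 : (ι → ZMod p) × (ι → ZMod p)).2 g.1 g.2
        = 0 := fun g => by simp [pauliForm]
  rw [hz] at ha hb
  have hadd : ∀ v : (ι → ZMod p) × (ι → ZMod p), pauliForm v.1 v.2 (a + b).1 (a + b).2 =
      pauliForm v.1 v.2 a.1 a.2 + pauliForm v.1 v.2 b.1 b.2 := fun v => by
    simp only [pauliForm, Prod.fst_add, Prod.snd_add, dotProduct_add, add_dotProduct]
    ring
  by_cases hua : pauliForm w.1 w.2 a.1 a.2 = 0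
  · by_cases hub : pauliForm u.1 u.2 b.1 b.2 = 0
    · refine ⟨a + b, ?_, ?_⟩
      · rwa [hadd, hub, add_zero]
      · rwa [pauliForm_swap, neg_ne_zero, hadd, hua, zero_add]
    · exact ⟨b, hub, by rwa [pauliForm_swap, neg_ne_zero]⟩
  · exact ⟨a, ha, by rwa [pauliForm_swap, neg_ne_zero]⟩

/-- Any two nonzero labels are linked through a third one noncommuting with both. This transitivity
is what gives the 2-design property. -/
lemma evCount_eq [Fact p.Prime] {u w : (ι → ZMod p) × (ι → ZMod p)} (hu : u ≠ 0) (hw : w ≠ 0) :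
    evCount u = evCount w := by
  obtain ⟨g, h1, h2⟩ := exists_pauliForm_ne_zero hu hw
  refine le_antisymm ((evCount_le_of_pauliForm h1).trans (evCount_le_of_pauliForm h2)) ?_
  rw [pauliForm_swap, neg_ne_zero] at h1 h2
  exact (evCount_le_of_pauliForm h2).trans (evCount_le_of_pauliForm h1)

/-- Expanding both factors in Pauli operators, orthogonality leaves only the diagonal terms,
weighted by `evCount`. -/
lemma sum_mul_star_eq (i i' j j' : QuditBasis p ι) :
    ∑ σ : StabState p ι, σ.1 i i' * star (σ.1 j j') = (((p : ℂ) ^ Fintype.card ι)⁻¹) ^ 2 *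
      ∑ u : (ι → ZMod p) × (ι → ZMod p), (evCount u : ℂ) *
        (pauliXZ u.1 u.2 i i' * star (pauliXZ u.1 u.2 j j')) := by
  have hσ : ∀ (σ : StabState p ι) k k', σ.1 k k' = ((p : ℂ) ^ Fintype.card ι)⁻¹ *
      ∑ u : (ι → ZMod p) × (ι → ZMod p), star (σ.ev u) * pauliXZ u.1 u.2 k k' := by
    intro σ k k'
    conv_lhs => rw [eq_sum_pauliXZ σ]
    simp only [Matrix.smul_apply, Matrix.sum_apply, smul_eq_mul]
  calc ∑ σ : StabState p ι, σ.1 i i' * star (σ.1 j j')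
      = ∑ σ : StabState p ι, (((p : ℂ) ^ Fintype.card ι)⁻¹) ^ 2 *
        ∑ u : (ι → ZMod p) × (ι → ZMod p), ∑ w : (ι → ZMod p) × (ι → ZMod p),
          (star (σ.ev u) * σ.ev w) * (pauliXZ u.1 u.2 i i' * star (pauliXZ w.1 w.2 j j')) := by
        refine Finset.sum_congr rfl fun σ _ => ?_
        rw [hσ σ i i', hσ σ j j', star_mul', star_sum, star_inv₀, star_pow, star_natCast,
          mul_mul_mul_comm, ← sq, Finset.sum_mul_sum]
        congr 1
        refine Finset.sum_congr rfl fun u _ => Finset.sum_congr rfl fun w _ => ?_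
        rw [star_mul', star_star]
        ring
    _ = _ := by
        rw [← Finset.mul_sum, Finset.sum_comm]
        congr 1
        refine Finset.sum_congr rfl fun u _ => ?_
        rw [Finset.sum_comm, Finset.sum_eq_single u]
        · rw [← Finset.sum_mul, sum_norm_ev]
        · intro w _ hw
          rw [← Finset.sum_mul, sum_star_ev_mul_ev hw.symm, zero_mul]
        · simp

lemma sum_pauli_pair (i i' j j' : QuditBasis p ι) :
    ∑ u : (ι → ZMod p) × (ι → ZMod p), pauliXZ u.1 u.2 i i' * star (pauliXZ u.1 u.2 j j') =
      if i = j ∧ i' = j' then (p : ℂ) ^ Fintype.card ι else 0 := by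
  rw [← sum_pauliXZ_mul_star i i' j j', ← Fintype.sum_prod_type']

/-- The stabilizer states form a complex projective 2-design. -/
theorem sum_mul [Fact p.Prime] [Nonempty ι] (i i' j j' : QuditBasis p ι) :
    ∑ σ : StabState p ι, σ.1 i i' * σ.1 j j' =
      Fintype.card (StabState p ι) /
        ((p : ℂ) ^ Fintype.card ι * ((p : ℂ) ^ Fintype.card ι + 1)) *
        ((if i = i' ∧ j = j' then 1 else 0) + (if i = j' ∧ j = i' then 1 else 0)) := by
  classical
  set D : ℂ := (p : ℂ) ^ Fintype.card ι with hD
  set N : ℂ := (Fintype.card (StabState p ι) : ℂ) with hN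
  have hD0 : D ≠ 0 := pow_ne_zero _ (NeZero.ne _)
  have hDnat : D = ((p ^ Fintype.card ι : ℕ) : ℂ) := by rw [hD, Nat.cast_pow]
  have hp1 : 1 < p ^ Fintype.card ι :=
    Nat.one_lt_pow Fintype.card_ne_zero (Fact.out : p.Prime).one_lt
  have hD1 : D - 1 ≠ 0 := by
    rw [hDnat, sub_ne_zero]
    exact_mod_cast hp1.ne'
  have hD2 : D + 1 ≠ 0 := by
    rw [hDnat]
    exact_mod_cast Nat.succ_ne_zero (p ^ Fintype.card ι)
  obtain ⟨l⟩ := ‹Nonempty ι›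
  let u₀ : (ι → ZMod p) × (ι → ZMod p) := (Pi.single l 1, 0)
  have hu₀ : u₀ ≠ 0 := fun h => by
    have := congrFun (congrArg Prod.fst h) l
    simp [u₀] at this
  set M : ℂ := (evCount u₀ : ℂ) with hM
  -- The weight is constant off zero. The constant part gives the swap by completeness of the Pauli
  -- operators, the excess at zero gives the identity.
  have hcount : ∀ u : (ι → ZMod p) × (ι → ZMod p),
      (evCount u : ℂ) = M + if u = 0 then N - M else 0 := by
    intro u
    split_ifs with h
    · rw [h, evCount_zero, ← hN]; ring
    · rw [evCount_eq h hu₀, add_zero]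
  have key : ∀ i i' j j' : QuditBasis p ι, ∑ σ : StabState p ι, σ.1 i i' * σ.1 j j' =
      (D⁻¹) ^ 2 * (M * D * (if i = j' ∧ j = i' then 1 else 0) +
        (N - M) * (if i = i' ∧ j = j' then 1 else 0)) := by
    intro i i' j j'
    have h1 := sum_mul_star_eq i i' j' j
    simp only [star_apply] at h1
    rw [h1, ← hD]
    congr 1
    simp only [hcount, add_mul, Finset.sum_add_distrib, ite_mul, zero_mul, Finset.sum_ite_eq',
      Finset.mem_univ, if_true, ← Finset.mul_sum, sum_pauli_pair, Prod.fst_zero, Prod.snd_zero,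
      pauliXZ_zero, one_apply]
    have e1 : (i = j' ∧ i' = j) ↔ (i = j' ∧ j = i') := by rw [eq_comm (a := i')]
    have e2 : star (if j' = j then (1 : ℂ) else 0) = if j = j' then 1 else 0 := by
      by_cases h : j = j'
      · simp [h]
      · simp [h, Ne.symm h]
    simp only [e1, e2, mul_assoc, ← hD]
    clear h1
    split_ifs <;> first | ring1 | (exfalso; tauto)
  -- The unknown count `M` is determined by purity: the traces $\mathrm{tr}\,\sigma^2=1$ sum to `N`.
  have hpur : N = (D⁻¹) ^ 2 * (M * D * D ^ 2 + (N - M) * D) := by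
    have h1 : ∑ i : QuditBasis p ι, ∑ j : QuditBasis p ι,
        ∑ σ : StabState p ι, σ.1 i j * σ.1 j i = N := by
      calc _ = ∑ σ : StabState p ι, (σ.1 * σ.1).trace := by
            simp only [trace, diag, mul_apply]
            rw [Finset.sum_comm (s := (Finset.univ : Finset (StabState p ι)))]
            exact Finset.sum_congr rfl fun i _ => Finset.sum_comm
        _ = N := by simp [mul_self, trace_eq_one, hN]
    have hcard : (Fintype.card (QuditBasis p ι) : ℂ) = D := by
      rw [Fintype.card_fun, ZMod.card, hDnat]
    have h2 : ∑ i : QuditBasis p ι, ∑ j : QuditBasis p ι,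
        (if i = i ∧ j = j then (1 : ℂ) else 0) = D ^ 2 := by
      rw [← hcard]
      simp only [and_self, if_true, Finset.sum_const, Finset.card_univ, nsmul_eq_mul, mul_one, sq]
    have h3 : ∑ i : QuditBasis p ι, ∑ j : QuditBasis p ι,
        (if i = j ∧ j = i then (1 : ℂ) else 0) = D := by
      rw [← hcard]
      have : ∀ i j : QuditBasis p ι, (if i = j ∧ j = i then (1 : ℂ) else 0) =
          if i = j then 1 else 0 := fun i j => by simp only [eq_comm (a := j), and_self]
      simp only [this, Finset.sum_ite_eq, Finset.mem_univ, if_true, Finset.sum_const,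
        Finset.card_univ, nsmul_eq_mul, mul_one]
    rw [← h2, ← h3]
    conv_lhs => rw [← h1]
    simp only [key, ← Finset.mul_sum, Finset.sum_add_distrib]
    rw [h3]
  have hM' : M * (D + 1) = N := by
    have h2 : N * D = M * D ^ 2 + (N - M) := by
      have := congrArg (· * D) hpur
      rw [this]; field_simp
    have h3 : (M * (D + 1) - N) * (D - 1) = 0 := by linear_combination -h2
    exact sub_eq_zero.1 ((mul_eq_zero.1 h3).resolve_right hD1)
  rw [key]
  have hNM : N - M = M * D := by linear_combination -hM'
  rw [hNM, ← hM']
  field_simp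
  ring

/-- Averaging over all stabilizer states yields the maximally mixed state. -/
theorem sum_apply [Fact p.Prime] [Nonempty ι] (i i' : QuditBasis p ι) :
    ∑ σ : StabState p ι, σ.1 i i' = Fintype.card (StabState p ι) *
      (((p : ℂ) ^ Fintype.card ι)⁻¹ • (1 : Matrix (QuditBasis p ι) (QuditBasis p ι) ℂ)) i i' := by
  have hD : (p : ℂ) ^ Fintype.card ι ≠ 0 := pow_ne_zero _ (NeZero.ne _)
  have hD1 : (p : ℂ) ^ Fintype.card ι + 1 ≠ 0 := by
    exact_mod_cast (Nat.succ_ne_zero (p ^ Fintype.card ι))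
  have hcard : (Fintype.card (QuditBasis p ι) : ℂ) = (p : ℂ) ^ Fintype.card ι := by
    rw [Fintype.card_fun, ZMod.card, Nat.cast_pow]
  -- The first moment is a partial trace of the second, since each state has trace one.
  have h1 : ∑ σ : StabState p ι, σ.1 i i' = ∑ j, ∑ σ : StabState p ι, σ.1 i i' * σ.1 j j := by
    rw [Finset.sum_comm]
    refine Finset.sum_congr rfl fun σ _ => ?_
    rw [← Finset.mul_sum]
    exact (mul_one (σ.1 i i')).symm.trans (congrArg _ σ.trace_eq_one.symm)
  have h2 : ∑ j, ((if i = i' ∧ j = j then (1 : ℂ) else 0) + if i = j ∧ j = i' then 1 else 0) =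
      if i = i' then (p : ℂ) ^ Fintype.card ι + 1 else 0 := by
    simp only [and_true, ite_and, Finset.sum_add_distrib, Finset.sum_const, Finset.card_univ,
      nsmul_eq_mul, Finset.sum_ite_eq, Finset.mem_univ, if_true, hcard]
    split_ifs <;> simp
  rw [h1, Finset.sum_congr rfl fun j _ => sum_mul i i' j j, ← Finset.mul_sum, h2,
    Matrix.smul_apply, Matrix.one_apply, smul_eq_mul]
  split_ifs
  · field_simp
  · simp

end StabState

/-! ### Bounds on the von Neumann entropy -/

section Entropy

open Matrix
open scoped ComplexOrder

variable {n : Type*} [Fintype n] [DecidableEq n] {ρ : Matrix n n ℂ}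

lemma Matrix.IsHermitian.trace_mul_self_eq (h : ρ.IsHermitian) :
    (ρ * ρ).trace = ((∑ i, h.eigenvalues i ^ 2 : ℝ) : ℂ) := by
  conv_lhs => rw [h.spectral_theorem]
  rw [← map_mul, Unitary.conjStarAlgAut_apply, trace_mul_comm, ← mul_assoc]
  simp [sq, Matrix.trace_diagonal]

lemma Matrix.IsHermitian.sum_eigenvalues_eq_one (h : ρ.IsHermitian) (h1 : ρ.trace = 1) :
    ∑ i, h.eigenvalues i = 1 := by
  have h2 := h.trace_eq_sum_eigenvalues
  rw [h1] at h2
  have h3 : ((∑ i, h.eigenvalues i : ℝ) : ℂ) = 1 := by rw [h2]; simp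
  exact_mod_cast h3

lemma vonNeumannEntropy_eq (h : ρ.IsHermitian) :
    vonNeumannEntropy ρ = ∑ i, Real.negMulLog (h.eigenvalues i) := by
  rw [vonNeumannEntropy, dif_pos h]

lemma vonNeumannEntropy_nonneg (hρ : ρ.PosSemidef) (h1 : ρ.trace = 1) :
    0 ≤ vonNeumannEntropy ρ := by
  rw [vonNeumannEntropy_eq hρ.1]
  refine Finset.sum_nonneg fun i _ => Real.negMulLog_nonneg (hρ.eigenvalues_nonneg i) ?_
  rw [← hρ.1.sum_eigenvalues_eq_one h1]
  exact Finset.single_le_sum (fun j _ => hρ.eigenvalues_nonneg j) (Finset.mem_univ i)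

/-- Comparison with the uniform distribution on $d$ points: $\ln x\le x-1$ is applied to
$x=1/(\lambda d)$ for each nonzero eigenvalue $\lambda$. -/
lemma vonNeumannEntropy_le_log_of_rank_le (hρ : ρ.PosSemidef) (h1 : ρ.trace = 1) {d : ℕ}
    (hd : ρ.rank ≤ d) : vonNeumannEntropy ρ ≤ Real.log d := by
  have hs := hρ.1.sum_eigenvalues_eq_one h1
  rw [hρ.1.rank_eq_card_non_zero_eigs, Fintype.card_subtype] at hd
  have hd0 : (0 : ℝ) < d := by
    refine Nat.cast_pos.2 (lt_of_lt_of_le (Finset.card_pos.2 ?_) hd)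
    by_contra h
    rw [Finset.not_nonempty_iff_eq_empty, Finset.filter_eq_empty_iff] at h
    rw [Finset.sum_eq_zero fun i hi => not_not.1 (h hi)] at hs
    exact zero_ne_one hs
  have hpt : ∀ i, Real.negMulLog (hρ.1.eigenvalues i) ≤ hρ.1.eigenvalues i * Real.log d +
      ((if hρ.1.eigenvalues i ≠ 0 then 1 else 0) / d - hρ.1.eigenvalues i) := by
    intro i
    rcases (hρ.eigenvalues_nonneg i).eq_or_lt with h0 | h0
    · simp [← h0]
    · rw [if_pos h0.ne', Real.negMulLog]
      have h2 := Real.log_le_sub_one_of_pos (inv_pos.2 (mul_pos h0 hd0))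
      rw [Real.log_inv, Real.log_mul h0.ne' hd0.ne'] at h2
      have h3 := mul_le_mul_of_nonneg_left h2 h0.le
      have h4 : hρ.1.eigenvalues i * ((hρ.1.eigenvalues i * d)⁻¹ - 1) =
          1 / d - hρ.1.eigenvalues i := by field_simp
      rw [h4] at h3
      linarith
  have hcard : ((Finset.univ.filter fun i => hρ.1.eigenvalues i ≠ 0).card : ℝ) / d ≤ 1 :=
    (div_le_one hd0).2 (by exact_mod_cast hd)
  rw [vonNeumannEntropy_eq hρ.1]
  refine (Finset.sum_le_sum fun i _ => hpt i).trans ?_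
  rw [Finset.sum_add_distrib, ← Finset.sum_mul, hs, Finset.sum_sub_distrib, hs, ← Finset.sum_div,
    Finset.sum_boole]
  linarith

/-- The entropy dominates the Rényi-2 entropy: $\ln x\le x-1$ at $x=\lambda/s$, weighted by
$\lambda$. -/
lemma neg_log_purity_le_vonNeumannEntropy (hρ : ρ.PosSemidef) (h1 : ρ.trace = 1) {s : ℝ}
    (hs : (ρ * ρ).trace = s) : 0 < s ∧ -Real.log s ≤ vonNeumannEntropy ρ := by
  have hsum := hρ.1.sum_eigenvalues_eq_one h1
  have hs2 : ∑ i, hρ.1.eigenvalues i ^ 2 = s := by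
    rw [hρ.1.trace_mul_self_eq] at hs
    exact_mod_cast hs
  have hs0 : 0 < s := by
    rw [← hs2]
    refine (Finset.sum_nonneg fun i _ => sq_nonneg _).lt_of_ne fun h => ?_
    rw [eq_comm, Finset.sum_eq_zero_iff_of_nonneg fun i _ => sq_nonneg _] at h
    rw [Finset.sum_eq_zero fun i hi => pow_eq_zero_iff two_ne_zero |>.1 (h i hi)] at hsum
    exact zero_ne_one hsum
  refine ⟨hs0, ?_⟩
  have hpt : ∀ i, hρ.1.eigenvalues i * -Real.log s + (hρ.1.eigenvalues i -
      hρ.1.eigenvalues i ^ 2 / s) ≤ Real.negMulLog (hρ.1.eigenvalues i) := by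
    intro i
    rcases (hρ.eigenvalues_nonneg i).eq_or_lt with h0 | h0
    · simp [← h0]
    · rw [Real.negMulLog]
      have h2 := Real.log_le_sub_one_of_pos (div_pos h0 hs0)
      rw [Real.log_div h0.ne' hs0.ne'] at h2
      have h3 := mul_le_mul_of_nonneg_left h2 h0.le
      have h4 : hρ.1.eigenvalues i * (hρ.1.eigenvalues i / s - 1) =
          hρ.1.eigenvalues i ^ 2 / s - hρ.1.eigenvalues i := by ring
      rw [h4] at h3
      linarith
  rw [vonNeumannEntropy_eq hρ.1]
  refine le_trans ?_ (Finset.sum_le_sum fun i _ => hpt i)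
  rw [Finset.sum_add_distrib, ← Finset.sum_mul, hsum, Finset.sum_sub_distrib, hsum,
    ← Finset.sum_div, hs2, div_self hs0.ne']
  linarith

/-- A density matrix proportional to a projection has the entropy of a uniform distribution. -/
lemma vonNeumannEntropy_of_mul_self (hρ : ρ.IsHermitian) (h1 : ρ.trace = 1) {h q : ℕ} (hq : q ≠ 0)
    (hmul : ρ * ρ = ((h : ℂ) / q) • ρ) :
    ∃ r : ℕ, r * h = q ∧ vonNeumannEntropy ρ = Real.log r := by
  have hsum := hρ.sum_eigenvalues_eq_one h1
  have hq0 : (q : ℝ) ≠ 0 := Nat.cast_ne_zero.2 hq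
  have heig : ∀ i, hρ.eigenvalues i = if hρ.eigenvalues i ≠ 0 then (h : ℝ) / q else 0 := by
    intro i
    split_ifs with h0
    · have h2 := hρ.mulVec_eigenvectorBasis i
      have h3 := congrArg (· *ᵥ ⇑(hρ.eigenvectorBasis i)) hmul
      simp only [← mulVec_mulVec, smul_mulVec, h2, mulVec_smul] at h3
      have hv : (⇑(hρ.eigenvectorBasis i) : n → ℂ) ≠ 0 := by
        intro hv
        refine hρ.eigenvectorBasis.orthonormal.ne_zero i ?_
        ext j
        exact congrFun hv j
      have h4 : ((hρ.eigenvalues i : ℂ) * hρ.eigenvalues i -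
          (h : ℂ) / q * hρ.eigenvalues i) • (⇑(hρ.eigenvectorBasis i) : n → ℂ) = 0 := by
        rw [sub_smul, mul_smul, mul_smul]
        exact sub_eq_zero.2 h3
      have h5 := (smul_eq_zero.1 h4).resolve_right hv
      have h6 : hρ.eigenvalues i * hρ.eigenvalues i = (h : ℝ) / q * hρ.eigenvalues i := by
        apply Complex.ofReal_injective
        push_cast
        exact sub_eq_zero.1 h5
      exact mul_right_cancel₀ h0 h6
    · exact not_not.1 h0
  -- Every nonzero eigenvalue equals `h / q`, so trace one gives `r * h = q` for the rank `r`. For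
  -- prime-power `q` the rank is therefore a prime power.
  set r := (Finset.univ.filter fun i => hρ.eigenvalues i ≠ 0).card with hr
  have hrsum : (r : ℝ) * (h / q) = 1 := by
    rw [← hsum, Finset.sum_congr rfl fun i _ => heig i, ← Finset.sum_filter, Finset.sum_const,
      nsmul_eq_mul]
  have hrh : (r : ℝ) * h = q := by
    field_simp at hrsum
    exact hrsum
  have hr0 : (r : ℝ) ≠ 0 := left_ne_zero_of_mul (by rw [hrh]; exact hq0)
  refine ⟨r, by exact_mod_cast hrh, ?_⟩
  have hval : (h : ℝ) / q = (r : ℝ)⁻¹ := by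
    rw [eq_comm, inv_eq_of_mul_eq_one_right hrsum]
  have hneg : ∀ i, Real.negMulLog (hρ.eigenvalues i) =
      if hρ.eigenvalues i ≠ 0 then (r : ℝ)⁻¹ * Real.log r else 0 := by
    intro i
    have := heig i
    split_ifs at this ⊢ with h0
    · rw [this, hval, Real.negMulLog, Real.log_inv]; ring
    · rw [this, Real.negMulLog_zero]
  rw [vonNeumannEntropy_eq hρ, Finset.sum_congr rfl fun i _ => hneg i, ← Finset.sum_filter,
    Finset.sum_const, nsmul_eq_mul, ← hr, mul_inv_cancel_left₀ hr0]

end Entropy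

/-! ### Products and contractions of stabilizer states -/

section Contraction

open Matrix ZMod

variable {p : ℕ} [NeZero p] {κ β : Type*} [Fintype κ] [DecidableEq κ] [Fintype β] [DecidableEq β]

lemma pauliXZ_mulVec_sumElim (x₁ z₁ : κ → ZMod p) (x₂ z₂ : β → ZMod p)
    (f : QuditBasis p (κ ⊕ β) → ℂ) (k : QuditBasis p κ) (b : QuditBasis p β) :
    (pauliXZ (Sum.elim x₁ x₂) (Sum.elim z₁ z₂) *ᵥ f) (Sum.elim k b) =
      (pauliXZ x₁ z₁ *ᵥ fun k' => stdAddChar (z₂ ⬝ᵥ (b - x₂)) * f (Sum.elim k' (b - x₂))) k := by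
  have h : (Sum.elim k b - Sum.elim x₁ x₂ : κ ⊕ β → ZMod p) = Sum.elim (k - x₁) (b - x₂) := by
    ext (i | i) <;> rfl
  rw [pauliXZ_mulVec, pauliXZ_mulVec, h, sumElim_dotProduct_sumElim, AddChar.map_add_eq_mul,
    mul_assoc]

lemma stdAddChar_sum {V : Type*} (s : Finset V) (f : V → ZMod p) :
    (stdAddChar (∑ v ∈ s, f v) : ℂ) = ∏ v ∈ s, stdAddChar (f v) := by
  classical
  induction s using Finset.induction_on with
  | empty => simp
  | insert v s hv ih => rw [Finset.sum_insert hv, Finset.prod_insert hv, AddChar.map_add_eq_mul, ih]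

lemma sum_quditBasis_sum (f : QuditBasis p (κ ⊕ β) → ℂ) :
    ∑ j, f j = ∑ b : QuditBasis p β, ∑ k : QuditBasis p κ, f (Sum.elim k b) := by
  rw [Finset.sum_comm, ← Fintype.sum_prod_type',
    ← (Equiv.sumArrowEquivProdArrow κ β (ZMod p)).symm.sum_comp]
  rfl

/-- Contracting a vector with a Pauli-rigid vector preserves Pauli-rigidity. -/
lemma IsPauliRigid.contract {η : QuditBasis p κ → ℂ} (hη : IsPauliRigid η)
    {τ : QuditBasis p (κ ⊕ β) → ℂ} (hτ : IsPauliRigid τ) :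
    IsPauliRigid (fun b : QuditBasis p β => ∑ k, star (η k) * τ (Sum.elim k b)) := by
  intro x z
  set ψ : QuditBasis p β → ℂ := fun b => ∑ k, star (η k) * τ (Sum.elim k b) with hψ
  let g : QuditBasis p β → QuditBasis p κ → ℂ :=
    fun b k => stdAddChar (z ⬝ᵥ (b - x)) * τ (Sum.elim k (b - x))
  have hP : ∀ b, (pauliXZ x z *ᵥ ψ) b = star η ⬝ᵥ g b := by
    intro b
    change _ = ∑ k, star (η k) * (stdAddChar (z ⬝ᵥ (b - x)) * τ (Sum.elim k (b - x)))
    rw [pauliXZ_mulVec, hψ, Finset.mul_sum]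
    exact Finset.sum_congr rfl fun k _ => by ring
  have hτg : ∀ u : (κ → ZMod p) × (κ → ZMod p), ∀ b k,
      (pauliXZ (Sum.elim u.1 x) (Sum.elim u.2 z) *ᵥ τ) (Sum.elim k b) =
        (pauliXZ u.1 u.2 *ᵥ g b) k := fun u b k => pauliXZ_mulVec_sumElim _ _ _ _ _ _ _
  -- The expectation on the remaining legs is an average over labels `u` of products of expectations
  -- of `η` and `τ`. Either every product vanishes, or one `u` makes both vectors eigenvectors.
  by_cases hall : ∀ u : (κ → ZMod p) × (κ → ZMod p), pauliEv η u.1 u.2 ≠ 0 →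
      pauliEv τ (Sum.elim u.1 x) (Sum.elim u.2 z) = 0
  · left
    have h1 : pauliEv ψ x z = ((p : ℂ) ^ Fintype.card κ)⁻¹ *
        ∑ u : (κ → ZMod p) × (κ → ZMod p), star (pauliEv η u.1 u.2) *
          pauliEv τ (Sum.elim u.1 x) (Sum.elim u.2 z) := by
      have h2 : ∀ b, star (ψ b) * (pauliXZ x z *ᵥ ψ) b = ∑ k, ∑ k', star (τ (Sum.elim k b)) *
          (vecMulVec η (star η) k k' * g b k') := by
        intro b
        rw [hP, hψ, star_sum, dotProduct, Finset.sum_mul_sum]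
        refine Finset.sum_congr rfl fun k _ => Finset.sum_congr rfl fun k' _ => ?_
        rw [star_mul', star_star, vecMulVec_apply]
        ring
      have h3 : ∀ u : (κ → ZMod p) × (κ → ZMod p),
          pauliEv τ (Sum.elim u.1 x) (Sum.elim u.2 z) =
            ∑ b, ∑ k, ∑ k', star (τ (Sum.elim k b)) * (pauliXZ u.1 u.2 k k' * g b k') := by
        intro u
        rw [pauliEv, dotProduct, sum_quditBasis_sum]
        refine Finset.sum_congr rfl fun b _ => Finset.sum_congr rfl fun k _ => ?_
        rw [hτg, mulVec, dotProduct, Finset.mul_sum]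
        rfl
      rw [pauliEv, dotProduct]
      simp only [Pi.star_apply, h2, h3]
      rw [vecMulVec_eq_sum_pauliXZ]
      simp only [Matrix.smul_apply, Matrix.sum_apply, smul_eq_mul, Finset.mul_sum, Finset.sum_mul]
      symm
      rw [Finset.sum_comm]
      refine Finset.sum_congr rfl fun b _ => ?_
      rw [Finset.sum_comm]
      refine Finset.sum_congr rfl fun k _ => ?_
      rw [Finset.sum_comm]
      refine Finset.sum_congr rfl fun k' _ => Finset.sum_congr rfl fun u _ => ?_
      ring
    rw [h1, Finset.sum_eq_zero, mul_zero]
    intro u _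
    by_cases hu : pauliEv η u.1 u.2 = 0
    · rw [hu, star_zero, zero_mul]
    · rw [hall u hu, mul_zero]
  · right
    push Not at hall
    obtain ⟨u, hu, hne⟩ := hall
    obtain ⟨d, hd⟩ := (hη u.1 u.2).resolve_left hu
    obtain ⟨c, hc⟩ := (hτ _ _).resolve_left hne
    refine ⟨star d * c, funext fun b => ?_⟩
    -- The Pauli operator `u` is inserted on both sides of the inner product by unitarity; it acts
    -- on `η` by `d`, and on `τ` it completes the operator of eigenvalue `c`.
    rw [hP, ← pauliXZ_inner u.1 u.2, hd, star_smul, smul_dotProduct]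
    have h4 : pauliXZ u.1 u.2 *ᵥ g b = c • fun k => τ (Sum.elim k b) := by
      funext k
      rw [← hτg, hc]
      rfl
    rw [h4, dotProduct_smul, smul_smul]
    rfl

/-- The sum over all values of the legs of a product of functions of disjoint sets of legs. -/
lemma sum_prod_sigma {V K : Type*} [Fintype V] [DecidableEq V] [Fintype K] {ι : V → Type*}
    [∀ v, Fintype (ι v)] [∀ v, DecidableEq (ι v)] (r : (Σ v, ι v) ≃ κ)
    (F : ∀ v, (ι v → K) → ℂ) :
    ∑ j : κ → K, ∏ v, F v (fun l => j (r ⟨v, l⟩)) = ∏ v, ∑ y, F v y := by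
  rw [Fintype.prod_sum, ← ((Equiv.arrowCongr r (Equiv.refl K)).symm.trans
    (Equiv.piCurry fun (v : V) (_ : ι v) => K)).sum_comp]
  rfl

/-- Pauli operators act factorwise, so the expectation is a product: one vanishing factor kills it,
otherwise the eigenvalues multiply. -/
lemma IsPauliRigid.prod {V : Type*} [Fintype V] [DecidableEq V] {ι : V → Type*}
    [∀ v, Fintype (ι v)] [∀ v, DecidableEq (ι v)] (r : (Σ v, ι v) ≃ κ)
    {t : ∀ v, QuditBasis p (ι v) → ℂ} (ht : ∀ v, IsPauliRigid (t v)) :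
    IsPauliRigid (fun j : QuditBasis p κ => ∏ v, t v (fun l => j (r ⟨v, l⟩))) := by
  intro x z
  have hP : ∀ j : QuditBasis p κ,
      (pauliXZ x z *ᵥ fun j : QuditBasis p κ => ∏ v, t v (fun l => j (r ⟨v, l⟩))) j =
        ∏ v, (pauliXZ (fun l => x (r ⟨v, l⟩)) (fun l => z (r ⟨v, l⟩)) *ᵥ t v)
          (fun l => j (r ⟨v, l⟩)) := by
    intro j
    simp only [pauliXZ_mulVec]
    rw [Finset.prod_mul_distrib]
    congr 1
    rw [dotProduct, ← r.sum_comp, Fintype.sum_sigma, stdAddChar_sum]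
    rfl
  by_cases hall : ∀ v, pauliEv (t v) (fun l => x (r ⟨v, l⟩)) (fun l => z (r ⟨v, l⟩)) ≠ 0
  · right
    choose c hc using fun v => (ht v _ _).resolve_left (hall v)
    refine ⟨∏ v, c v, funext fun j => ?_⟩
    rw [hP, Pi.smul_apply, smul_eq_mul, ← Finset.prod_mul_distrib]
    exact Finset.prod_congr rfl fun v _ => by rw [hc v]; rfl
  · left
    push Not at hall
    obtain ⟨v, hv⟩ := hall
    rw [pauliEv, dotProduct]
    simp only [hP, Pi.star_apply, star_prod, ← Finset.prod_mul_distrib]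
    rw [sum_prod_sigma r fun v y => star (t v y) *
      (pauliXZ (fun l => x (r ⟨v, l⟩)) (fun l => z (r ⟨v, l⟩)) *ᵥ t v) y]
    exact Finset.prod_eq_zero (Finset.mem_univ v) hv

/-- Complex conjugation replaces $X^xZ^z$ by $X^xZ^{-z}$. -/
lemma IsPauliRigid.conj {ψ : QuditBasis p κ → ℂ} (h : IsPauliRigid ψ) : IsPauliRigid (star ψ) := by
  intro x z
  have hP : pauliXZ x z *ᵥ star ψ = star (pauliXZ x (-z) *ᵥ ψ) := by
    funext i
    rw [Pi.star_apply, pauliXZ_mulVec, pauliXZ_mulVec, star_mul', star_stdAddChar, neg_dotProduct,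
      neg_neg]
    rfl
  rcases h x (-z) with h0 | ⟨c, hc⟩
  · left
    rw [pauliEv, hP, star_dotProduct_star, dotProduct_comm, ← pauliEv, h0, star_zero]
  · right
    exact ⟨star c, by rw [hP, hc, star_smul]⟩

/-- The unnormalised maximally entangled state. -/
def maxEntangled (p : ℕ) (κ : Type*) : QuditBasis p (κ ⊕ κ) → ℂ :=
  open Classical in fun k => if k ∘ Sum.inl = k ∘ Sum.inr then 1 else 0

/-- If the two halves of `x` differ, the support is moved off itself. If they agree, the operator
acts by a character of the diagonal, which is trivial exactly when the halves of `z` cancel and sums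
to zero otherwise. -/
lemma isPauliRigid_maxEntangled : IsPauliRigid (maxEntangled p κ) := by
  intro x z
  by_cases hx : x ∘ Sum.inl = x ∘ Sum.inr
  · have hP : ∀ k, maxEntangled p κ (k - x) = maxEntangled p κ k := by
      intro k
      have : (k - x) ∘ Sum.inl = (k - x) ∘ Sum.inr ↔ k ∘ Sum.inl = k ∘ Sum.inr := by
        constructor
        · intro h
          calc k ∘ Sum.inl = (k - x) ∘ Sum.inl + x ∘ Sum.inl := by ext; simp
            _ = (k - x) ∘ Sum.inr + x ∘ Sum.inr := by rw [h, hx]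
            _ = k ∘ Sum.inr := by ext; simp
        · intro h
          calc (k - x) ∘ Sum.inl = k ∘ Sum.inl - x ∘ Sum.inl := by ext; simp
            _ = k ∘ Sum.inr - x ∘ Sum.inr := by rw [h, hx]
            _ = (k - x) ∘ Sum.inr := by ext; simp
      by_cases hk : k ∘ Sum.inl = k ∘ Sum.inr
      · rw [maxEntangled, maxEntangled, if_pos hk, if_pos (this.2 hk)]
      · rw [maxEntangled, maxEntangled, if_neg hk, if_neg (mt this.1 hk)]
    have hdot : ∀ k : QuditBasis p (κ ⊕ κ), k ∘ Sum.inl = k ∘ Sum.inr →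
        z ⬝ᵥ (k - x) = (z ∘ Sum.inl + z ∘ Sum.inr) ⬝ᵥ (k ∘ Sum.inl - x ∘ Sum.inl) := by
      intro k hk
      rw [add_dotProduct]
      conv_rhs =>
        rw [hk, hx]
        enter [1]
        rw [← hk, ← hx]
      rw [dotProduct, Fintype.sum_sum_type]
      rfl
    by_cases hz : z ∘ Sum.inl + z ∘ Sum.inr = 0
    · right
      refine ⟨1, funext fun k => ?_⟩
      rw [pauliXZ_mulVec, one_smul, hP]
      by_cases hk : k ∘ Sum.inl = k ∘ Sum.inr
      · rw [hdot k hk, hz, zero_dotProduct, AddChar.map_zero_eq_one, one_mul]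
      · simp [maxEntangled, hk]
    · left
      rw [pauliEv, dotProduct, sum_quditBasis_sum]
      simp only [pauliXZ_mulVec, hP, Pi.star_apply]
      have h1 : ∀ b k : QuditBasis p κ, star (maxEntangled p κ (Sum.elim k b)) *
          (stdAddChar (z ⬝ᵥ (Sum.elim k b - x)) * maxEntangled p κ (Sum.elim k b)) =
          if k = b then (stdAddChar ((z ∘ Sum.inl + z ∘ Sum.inr) ⬝ᵥ (b - x ∘ Sum.inl)) : ℂ)
            else 0 := by
        intro b k
        split_ifs with h
        · subst h
          rw [hdot _ rfl]
          simp [maxEntangled]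
        · simp [maxEntangled, h]
      simp only [h1, Finset.sum_ite_eq', Finset.mem_univ, if_true]
      refine (Fintype.sum_equiv (Equiv.subRight (x ∘ Sum.inl)) _
        (fun b => (stdAddChar ((z ∘ Sum.inl + z ∘ Sum.inr) ⬝ᵥ b) : ℂ)) fun _ => rfl).trans ?_
      simp only [dotProduct_comm (z ∘ Sum.inl + z ∘ Sum.inr)]
      rw [sum_stdAddChar_dotProduct, if_neg hz]
  · left
    rw [pauliEv, dotProduct]
    refine Finset.sum_eq_zero fun k _ => ?_
    rw [pauliXZ_mulVec, Pi.star_apply]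
    by_cases hk : k ∘ Sum.inl = k ∘ Sum.inr
    · have : ¬ (k - x) ∘ Sum.inl = (k - x) ∘ Sum.inr := by
        intro h
        apply hx
        calc x ∘ Sum.inl = k ∘ Sum.inl - (k - x) ∘ Sum.inl := by ext; simp
          _ = k ∘ Sum.inr - (k - x) ∘ Sum.inr := by rw [h, hk]
          _ = x ∘ Sum.inr := by ext; simp
      simp [maxEntangled, this]
    · simp [maxEntangled, hk]

end Contraction

/-! ### Reduced states -/

section Reduced

open Matrix ZMod

variable {p : ℕ} [NeZero p] {B : Type*} [DecidableEq B] (A : Finset B)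

/-- Labels on `A` and on the complement of `A` combine to labels on everything. -/
def joinLegs {K : Type*} : ({b // b ∈ A} → K) × ({b // b ∉ A} → K) ≃ (B → K) :=
  (Equiv.piEquivPiSubtypeProd (· ∈ A) fun _ => K).symm

lemma joinLegs_apply {K : Type*} (a : {b // b ∈ A} → K) (c : {b // b ∉ A} → K) (b : B) :
    joinLegs A (a, c) b = if h : b ∈ A then a ⟨b, h⟩ else c ⟨b, h⟩ := rfl

lemma joinLegs_mem {K : Type*} (a : {b // b ∈ A} → K) (c : {b // b ∉ A} → K) {b : B} (h : b ∈ A) :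
    joinLegs A (a, c) b = a ⟨b, h⟩ := by rw [joinLegs_apply, dif_pos h]

lemma joinLegs_notMem {K : Type*} (a : {b // b ∈ A} → K) (c : {b // b ∉ A} → K) {b : B}
    (h : b ∉ A) : joinLegs A (a, c) b = c ⟨b, h⟩ := by rw [joinLegs_apply, dif_neg h]

/-- The labels that agree with `x` on `A` and with `y` outside of `A`. -/
def mixLegs {K : Type*} (x y : B → K) (b : B) : K := if b ∈ A then x b else y b

lemma joinLegs_eq_mixLegs {K : Type*} (a a' : {b // b ∈ A} → K) (c c' : {b // b ∉ A} → K) :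
    joinLegs A (a, c) = mixLegs A (joinLegs A (a, c')) (joinLegs A (a', c)) := by
  ext b
  rw [mixLegs, joinLegs_apply, joinLegs_apply, joinLegs_apply]
  split_ifs <;> rfl

variable [Fintype B]

lemma sum_joinLegs {K : Type*} [Fintype K] (f : (B → K) → ℂ) :
    ∑ b, f b = ∑ a : {b // b ∈ A} → K, ∑ c : {b // b ∉ A} → K, f (joinLegs A (a, c)) := by
  rw [← Fintype.sum_prod_type', ← (joinLegs A).sum_comp]

lemma reducedState_apply (ρ : Matrix (QuditBasis p B) (QuditBasis p B) ℂ)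
    (i j : QuditBasis p {b // b ∈ A}) :
    reducedState A ρ i j = ∑ c, ρ (joinLegs A (i, c)) (joinLegs A (j, c)) := rfl

lemma reducedState_smul (c : ℂ) (ρ : Matrix (QuditBasis p B) (QuditBasis p B) ℂ) :
    reducedState A (c • ρ) = c • reducedState A ρ := by
  ext i j
  simp only [reducedState_apply, Matrix.smul_apply, Finset.smul_sum]

lemma trace_reducedState (ρ : Matrix (QuditBasis p B) (QuditBasis p B) ℂ) :
    (reducedState A ρ).trace = ρ.trace := by
  simp only [trace, diag, reducedState_apply]
  rw [sum_joinLegs A]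

/-- The swap form of the purity: two copies of the state with their labels on `A` exchanged. This is
the shape to which the second moment applies. -/
lemma trace_reducedState_mul_self (ρ : Matrix (QuditBasis p B) (QuditBasis p B) ℂ) :
    (reducedState A ρ * reducedState A ρ).trace =
      ∑ b : QuditBasis p B, ∑ b' : QuditBasis p B,
        ρ b (mixLegs A b' b) * ρ b' (mixLegs A b b') := by
  rw [sum_joinLegs A]
  simp only [sum_joinLegs A (K := ZMod p), trace, diag, mul_apply, reducedState_apply,
    Finset.sum_mul_sum, ← joinLegs_eq_mixLegs]
  refine Finset.sum_congr rfl fun a _ => ?_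
  rw [Finset.sum_comm]

/-- A vector of the qudits `B` as a matrix with rows labelled by `A`. -/
def splitMatrix (ψ : QuditBasis p B → ℂ) :
    Matrix (QuditBasis p {b // b ∈ A}) (QuditBasis p {b // b ∉ A}) ℂ :=
  Matrix.of fun a c => ψ (joinLegs A (a, c))

lemma reducedState_vecMulVec (ψ : QuditBasis p B → ℂ) :
    reducedState A (vecMulVec ψ (star ψ)) = splitMatrix A ψ * (splitMatrix A ψ)ᴴ := by
  ext i j
  rw [reducedState_apply, mul_apply]
  rfl

/-- The labels on everything that vanish outside of `A`. -/
def extendLegs (x : {b // b ∈ A} → ZMod p) : B → ZMod p := joinLegs A (x, 0)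

omit [NeZero p] in
lemma extendLegs_dotProduct (z : {b // b ∈ A} → ZMod p) (a : {b // b ∈ A} → ZMod p)
    (c : {b // b ∉ A} → ZMod p) : extendLegs A z ⬝ᵥ joinLegs A (a, c) = z ⬝ᵥ a := by
  rw [dotProduct, ← Fintype.sum_subtype_add_sum_subtype (· ∈ A), dotProduct]
  have h1 : ∀ b : {b // b ∈ A}, extendLegs A z b * joinLegs A (a, c) b = z b * a b := fun b => by
    rw [extendLegs, joinLegs_mem A _ _ b.2, joinLegs_mem A _ _ b.2]
  have h2 : ∀ b : {b // b ∉ A}, extendLegs A z b * joinLegs A (a, c) b = 0 := fun b => by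
    rw [extendLegs, joinLegs_notMem A _ _ b.2, Pi.zero_apply, zero_mul]
  simp only [h1, h2, Finset.sum_const_zero, add_zero]
  exact Finset.sum_congr (by ext; simp) fun _ _ => rfl

lemma splitMatrix_pauliXZ (x z : {b // b ∈ A} → ZMod p) (ψ : QuditBasis p B → ℂ) :
    splitMatrix A (pauliXZ (extendLegs A x) (extendLegs A z) *ᵥ ψ) =
      pauliXZ x z * splitMatrix A ψ := by
  ext a c
  have h1 : joinLegs A (a, c) - extendLegs A x = joinLegs A (a - x, c) := by
    ext b
    rw [Pi.sub_apply, extendLegs, joinLegs_apply, joinLegs_apply, joinLegs_apply]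
    split_ifs <;> simp
  have h2 : (pauliXZ x z * splitMatrix A ψ) a c =
      (pauliXZ x z *ᵥ fun a' => splitMatrix A ψ a' c) a := rfl
  rw [h2, pauliXZ_mulVec]
  change (pauliXZ (extendLegs A x) (extendLegs A z) *ᵥ ψ) (joinLegs A (a, c)) = _
  rw [pauliXZ_mulVec, h1, extendLegs_dotProduct]
  rfl

lemma trace_pauliXZ_mul_reducedState (x z : {b // b ∈ A} → ZMod p) (ψ : QuditBasis p B → ℂ) :
    (pauliXZ x z * reducedState A (vecMulVec ψ (star ψ))).trace =
      pauliEv ψ (extendLegs A x) (extendLegs A z) := by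
  rw [reducedState_vecMulVec, ← Matrix.mul_assoc, ← splitMatrix_pauliXZ, pauliEv, dotProduct,
    sum_joinLegs A]
  simp only [trace, diag, mul_apply]
  refine Finset.sum_congr rfl fun a _ => Finset.sum_congr rfl fun c _ => ?_
  rw [mul_comm]
  rfl

/-- The reduced states of a stabilizer state are proportional to projections. -/
lemma IsPauliRigid.reducedState_mul_self {ψ : QuditBasis p B → ℂ} (hψ : IsPauliRigid ψ) :
    ∃ h : ℕ, reducedState A (vecMulVec ψ (star ψ)) * reducedState A (vecMulVec ψ (star ψ)) =
      ((h : ℂ) / (p ^ A.card : ℕ) * (vecMulVec ψ (star ψ)).trace) •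
        reducedState A (vecMulVec ψ (star ψ)) := by
  classical
  set R := reducedState A (vecMulVec ψ (star ψ)) with hR
  have htr : R.trace = (vecMulVec ψ (star ψ)).trace := trace_reducedState A _
  -- A Pauli operator with nonzero coefficient stabilizes `R` up to a phase, which the coefficient
  -- cancels. So each contributing term of the Pauli expansion times `R` is the same multiple of
  -- `R`.
  have hdich : ∀ u : ({b // b ∈ A} → ZMod p) × ({b // b ∈ A} → ZMod p),
      ((pauliXZ u.1 u.2)ᴴ * R).trace • (pauliXZ u.1 u.2 * R) =
        (if ((pauliXZ u.1 u.2)ᴴ * R).trace ≠ 0 then R.trace else 0) • R := by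
    intro u
    split_ifs with hu
    · have hRH : Rᴴ = R := by
        rw [hR, reducedState_vecMulVec, conjTranspose_mul, conjTranspose_conjTranspose]
      have hu' : pauliEv ψ (extendLegs A u.1) (extendLegs A u.2) ≠ 0 := by
        intro h0
        rw [← trace_pauliXZ_mul_reducedState, ← hR] at h0
        apply hu
        rw [← star_eq_zero, ← trace_conjTranspose, conjTranspose_mul, conjTranspose_conjTranspose,
          hRH, trace_mul_comm, h0]
      obtain ⟨c, hc⟩ := (hψ _ _).resolve_left hu'
      have hPR : pauliXZ u.1 u.2 * R = c • R := by
        rw [hR, reducedState_vecMulVec, ← Matrix.mul_assoc, ← splitMatrix_pauliXZ, hc]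
        exact Matrix.smul_mul _ _ _
      have hPR' : R = c • ((pauliXZ u.1 u.2)ᴴ * R) := by
        rw [← mul_smul_comm, ← hPR, ← mul_assoc, pauliXZ_conjTranspose_mul, one_mul]
      rw [hPR, smul_smul]
      congr 1
      conv_rhs => rw [hPR', trace_smul, smul_eq_mul]
      rw [mul_comm]
    · rw [not_not.1 hu, zero_smul, zero_smul]
  refine ⟨(Finset.univ.filter fun u : ({b // b ∈ A} → ZMod p) × ({b // b ∈ A} → ZMod p) =>
    ((pauliXZ u.1 u.2)ᴴ * R).trace ≠ 0).card, ?_⟩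
  conv_lhs =>
    enter [1]
    rw [eq_sum_pauliXZ R]
  rw [smul_mul_assoc, Finset.sum_mul]
  simp only [smul_mul_assoc, hdich]
  rw [← Finset.sum_smul, smul_smul, ← Finset.sum_filter, Finset.sum_const, nsmul_eq_mul, htr,
    Fintype.card_coe, Nat.cast_pow]
  congr 1
  ring

end Reduced

/-! ### The boundary vector of a tensor network -/

namespace TensorNetwork

open Matrix ZMod

variable {V E B : Type*} [Fintype V] [DecidableEq V] [Fintype E] [DecidableEq E]
  [Fintype B] [DecidableEq B]

variable {p : ℕ} [NeZero p] (N : TensorNetwork V E B)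

/-- The boundary vector obtained by contracting the tensors `t`. -/
def boundaryVec (Φ : QuditBasis p V → ℂ) (t : ∀ v, QuditBasis p (N.Leg v) → ℂ) :
    QuditBasis p B → ℂ :=
  fun b => ∑ i : QuditBasis p V, ∑ e : QuditBasis p E, Φ i * ∏ v, t v (N.legVal i e b v)

lemma rawState_eq_vecMulVec (Φ : QuditBasis p V → ℂ) (T : N.Choice p)
    {t : ∀ v, QuditBasis p (N.Leg v) → ℂ} (ht : ∀ v, (T v).1 = vecMulVec (t v) (star (t v))) :
    N.rawState Φ T = vecMulVec (N.boundaryVec Φ t) (star (N.boundaryVec Φ t)) := by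
  ext b b'
  rw [vecMulVec_apply, Pi.star_apply, boundaryVec, boundaryVec, star_sum, Finset.sum_mul_sum]
  refine Finset.sum_congr rfl fun i _ => Finset.sum_congr rfl fun i' _ => ?_
  rw [star_sum, Finset.sum_mul_sum]
  refine Finset.sum_congr rfl fun e _ => Finset.sum_congr rfl fun e' _ => ?_
  simp only [ht, vecMulVec_apply, Pi.star_apply, Finset.prod_mul_distrib, star_mul', star_prod]
  ring

/-- Every leg of a tensor is a bulk leg, one of the two ends of a contracted leg, or a boundary
leg. -/
def legEquiv {V E B : Type*} (N : TensorNetwork V E B) : (Σ v, N.Leg v) ≃ V ⊕ ((E ⊕ E) ⊕ B) where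
  toFun x := match x with
    | ⟨v, Sum.inl _⟩ => Sum.inl v
    | ⟨_, Sum.inr (Sum.inl e)⟩ => Sum.inr (Sum.inl (Sum.inl e))
    | ⟨_, Sum.inr (Sum.inr (Sum.inl e))⟩ => Sum.inr (Sum.inl (Sum.inr e))
    | ⟨_, Sum.inr (Sum.inr (Sum.inr b))⟩ => Sum.inr (Sum.inr b)
  invFun x := match x with
    | Sum.inl v => ⟨v, Sum.inl ()⟩
    | Sum.inr (Sum.inl (Sum.inl e)) => ⟨N.src e, Sum.inr (Sum.inl ⟨e, rfl⟩)⟩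
    | Sum.inr (Sum.inl (Sum.inr e)) => ⟨N.tgt e, Sum.inr (Sum.inr (Sum.inl ⟨e, rfl⟩))⟩
    | Sum.inr (Sum.inr b) => ⟨N.att b, Sum.inr (Sum.inr (Sum.inr ⟨b, rfl⟩))⟩
  left_inv := by rintro ⟨v, (_ | ⟨e, rfl⟩ | ⟨e, rfl⟩ | ⟨b, rfl⟩)⟩ <;> rfl
  right_inv := by rintro (v | ((e | e) | b)) <;> rfl

lemma legVal_eq {V E B : Type*} {p : ℕ} (N : TensorNetwork V E B) (i : QuditBasis p V)
    (e : QuditBasis p E) (b : QuditBasis p B) (v : V) :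
    N.legVal i e b v = fun l => Sum.elim i (Sum.elim (Sum.elim e e) b) (N.legEquiv ⟨v, l⟩) := by
  ext (_ | _ | _ | _) <;> rfl

/-- Contracting stabilizer states with a bulk stabilizer state gives a multiple of a stabilizer
state. -/
lemma isPauliRigid_boundaryVec {Φ : QuditBasis p V → ℂ} (hΦ : IsPauliRigid Φ)
    {t : ∀ v, QuditBasis p (N.Leg v) → ℂ} (ht : ∀ v, IsPauliRigid (t v)) :
    IsPauliRigid (N.boundaryVec Φ t) := by
  classical
  -- `contract` conjugates its first argument, so the bulk enters as `star Φ`. Contracting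
  -- afterwards with the maximally entangled state on `E ⊕ E` glues the two ends of every contracted
  -- leg.
  have h1 := (isPauliRigid_maxEntangled (p := p) (κ := E)).contract
    (hΦ.conj.contract (IsPauliRigid.prod N.legEquiv ht))
  refine (congrArg IsPauliRigid ?_).mp h1
  funext b
  rw [boundaryVec, sum_quditBasis_sum, Finset.sum_comm (s := Finset.univ (α := QuditBasis p V))]
  refine Finset.sum_congr rfl fun e _ => ?_
  rw [Finset.sum_eq_single e]
  · have : maxEntangled p E (Sum.elim e e) = 1 := by simp [maxEntangled]
    rw [this, star_one, one_mul]
    refine Finset.sum_congr rfl fun i _ => ?_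
    simp only [legVal_eq, Pi.star_apply, star_star]
  · intro k _ hk
    have : maxEntangled p E (Sum.elim k e) = 0 := by simp [maxEntangled, hk]
    rw [this, star_zero, zero_mul]
  · simp

variable {N}

lemma exists_boundaryVec (Φ : QuditBasis p V → ℂ) (T : N.Choice p) :
    ∃ t : ∀ v, QuditBasis p (N.Leg v) → ℂ, (∀ v, IsPauliRigid (t v)) ∧
      N.rawState Φ T = vecMulVec (N.boundaryVec Φ t) (star (N.boundaryVec Φ t)) := by
  choose t ht _ ht2 using fun v => (T v).exists_vec
  exact ⟨t, ht, N.rawState_eq_vecMulVec Φ T ht2⟩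

open scoped ComplexOrder

/-- The squared norm of the boundary vector. -/
def normSq (Φ : QuditBasis p V → ℂ) (T : N.Choice p) : ℝ := (N.rawState Φ T).trace.re

lemma trace_rawState (Φ : QuditBasis p V → ℂ) (T : N.Choice p) :
    (N.rawState Φ T).trace = N.normSq Φ T := by
  obtain ⟨t, -, ht⟩ := exists_boundaryVec Φ T
  rw [normSq, ht, trace_vecMulVec, dotProduct_comm, star_dotProduct_self, Complex.ofReal_re]

lemma normSq_nonneg (Φ : QuditBasis p V → ℂ) (T : N.Choice p) : 0 ≤ N.normSq Φ T := by
  obtain ⟨t, -, ht⟩ := exists_boundaryVec Φ T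
  rw [normSq, ht, trace_vecMulVec, dotProduct_comm, star_dotProduct_self, Complex.ofReal_re]
  positivity

lemma normSq_eq_zero_iff (Φ : QuditBasis p V → ℂ) (T : N.Choice p) :
    N.normSq Φ T = 0 ↔ N.rawState Φ T = 0 := by
  refine ⟨fun h => ?_, fun h => by rw [normSq, h]; simp⟩
  have h1 := trace_rawState Φ T
  obtain ⟨t, -, ht⟩ := exists_boundaryVec Φ T
  rw [h, ht, trace_vecMulVec, dotProduct_comm, Complex.ofReal_zero, dotProduct_star_self_eq_zero] at h1
  rw [ht, h1, zero_vecMulVec]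

lemma reducedState_boundaryState (Φ : QuditBasis p V → ℂ) (A : Finset B) (T : N.Choice p) :
    reducedState A (N.boundaryState Φ T) =
      ((N.normSq Φ T)⁻¹ : ℂ) • reducedState A (N.rawState Φ T) := by
  rw [boundaryState, reducedState_smul, trace_rawState]

lemma posSemidef_reducedState (Φ : QuditBasis p V → ℂ) (A : Finset B) (T : N.Choice p) :
    (reducedState A (N.boundaryState Φ T)).PosSemidef := by
  obtain ⟨t, -, ht⟩ := exists_boundaryVec Φ T
  rw [reducedState_boundaryState, ht, reducedState_vecMulVec]
  refine (posSemidef_self_mul_conjTranspose _).smul ?_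
  rw [← Complex.ofReal_inv]
  exact Complex.zero_le_real.2 (inv_nonneg.2 (normSq_nonneg Φ T))

lemma trace_reducedState_boundaryState {Φ : QuditBasis p V → ℂ} (A : Finset B) {T : N.Choice p}
    (h : N.normSq Φ T ≠ 0) : (reducedState A (N.boundaryState Φ T)).trace = 1 := by
  rw [reducedState_boundaryState, trace_smul, trace_reducedState, trace_rawState, smul_eq_mul,
    inv_mul_cancel₀ (Complex.ofReal_ne_zero.2 h)]

lemma entropy_nonneg {Φ : QuditBasis p V → ℂ} (A : Finset B) {T : N.Choice p}
    (h : N.normSq Φ T ≠ 0) : 0 ≤ N.entropy Φ A T :=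
  vonNeumannEntropy_nonneg (posSemidef_reducedState Φ A T) (trace_reducedState_boundaryState A h)

/-- The unnormalised purity of the reduced state. -/
def rawPurity (Φ : QuditBasis p V → ℂ) (A : Finset B) (T : N.Choice p) : ℝ :=
  (reducedState A (N.rawState Φ T) * reducedState A (N.rawState Φ T)).trace.re

lemma trace_reducedState_rawState_mul_self (Φ : QuditBasis p V → ℂ) (A : Finset B)
    (T : N.Choice p) :
    (reducedState A (N.rawState Φ T) * reducedState A (N.rawState Φ T)).trace =
      N.rawPurity Φ A T := by
  obtain ⟨t, -, ht⟩ := exists_boundaryVec Φ T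
  have h : (reducedState A (N.rawState Φ T)).IsHermitian := by
    rw [ht, reducedState_vecMulVec]
    exact isHermitian_mul_conjTranspose_self _
  rw [rawPurity, h.trace_mul_self_eq, Complex.ofReal_re]

lemma neg_log_le_entropy {Φ : QuditBasis p V → ℂ} (A : Finset B) {T : N.Choice p}
    (h : N.normSq Φ T ≠ 0) : 0 < N.rawPurity Φ A T ∧
      -Real.log (N.rawPurity Φ A T / N.normSq Φ T ^ 2) ≤ N.entropy Φ A T := by
  have h1 : (reducedState A (N.boundaryState Φ T) * reducedState A (N.boundaryState Φ T)).trace =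
      ((N.rawPurity Φ A T / N.normSq Φ T ^ 2 : ℝ) : ℂ) := by
    rw [reducedState_boundaryState, smul_mul_smul_comm, trace_smul,
      trace_reducedState_rawState_mul_self]
    push_cast
    rw [smul_eq_mul]
    ring
  obtain ⟨h2, h3⟩ := neg_log_purity_le_vonNeumannEntropy (posSemidef_reducedState Φ A T)
    (trace_reducedState_boundaryState A h) h1
  refine ⟨?_, h3⟩
  have h4 : 0 < N.normSq Φ T ^ 2 := by positivity
  have := mul_pos h2 h4
  rwa [div_mul_cancel₀ _ h4.ne'] at this

/-- In a stabilizer network, entropies are integer multiples of `log p`. -/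
lemma exists_entropy_eq [Fact p.Prime] {Φ : QuditBasis p V → ℂ} (hΦ : IsStabilizerState Φ)
    (A : Finset B) {T : N.Choice p} (h : N.normSq Φ T ≠ 0) :
    ∃ m : ℕ, N.entropy Φ A T = m * Real.log p := by
  obtain ⟨t, htr, ht⟩ := exists_boundaryVec Φ T
  have hrig := N.isPauliRigid_boundaryVec hΦ.isPauliRigid.1 htr
  obtain ⟨h0, hh⟩ := hrig.reducedState_mul_self A
  rw [← ht, trace_rawState] at hh
  have hn : (N.normSq Φ T : ℂ) ≠ 0 := Complex.ofReal_ne_zero.2 h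
  have hp : p ^ A.card ≠ 0 := pow_ne_zero _ (NeZero.ne p)
  obtain ⟨r, hr, hS⟩ := vonNeumannEntropy_of_mul_self (posSemidef_reducedState Φ A T).1
    (trace_reducedState_boundaryState A h) hp (h := h0) (by
      rw [reducedState_boundaryState, smul_mul_smul_comm, hh, smul_smul, smul_smul]
      congr 1
      field_simp)
  obtain ⟨m, -, rfl⟩ := (Nat.dvd_prime_pow Fact.out).1 (Dvd.intro _ hr)
  exact ⟨m, by rw [entropy, hS, Nat.cast_pow, Real.log_pow]⟩

end TensorNetwork

/-! ### The entropy is bounded by the size of any separating surface -/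

/-- The sum of a product of two functions of complementary sets of variables factorizes. -/
lemma sum_mul_eq_of_complementary {X K : Type*} [Fintype X] [DecidableEq X] [Fintype K] [Zero K]
    (P : X → Prop) [DecidablePred P] (F G : (X → K) → ℂ)
    (hF : ∀ u u', (∀ x, P x → u x = u' x) → F u = F u')
    (hG : ∀ u u', (∀ x, ¬ P x → u x = u' x) → G u = G u') :
    ∑ u, F u * G u =
      (∑ u : {x // P x} → K, F fun x => if h : P x then u ⟨x, h⟩ else 0) *
        ∑ u : {x // ¬ P x} → K, G fun x => if h : P x then 0 else u ⟨x, h⟩ := by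
  rw [Finset.sum_mul_sum, ← Fintype.sum_prod_type',
    ← (Equiv.piEquivPiSubtypeProd P fun _ => K).symm.sum_comp]
  refine Finset.sum_congr rfl fun u _ => ?_
  congr 1
  · refine hF _ _ fun x hx => ?_
    simp [Equiv.piEquivPiSubtypeProd, hx]
  · refine hG _ _ fun x hx => ?_
    simp [Equiv.piEquivPiSubtypeProd, hx]

namespace TensorNetwork

open Matrix ZMod

variable {V E B : Type*}

lemma legVal_congr {p : ℕ} (N : TensorNetwork V E B) {i i' : QuditBasis p V}
    {e e' : QuditBasis p E} {b b' : QuditBasis p B} {v : V} (hi : i v = i' v)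
    (hs : ∀ x, N.src x = v → e x = e' x) (ht : ∀ x, N.tgt x = v → e x = e' x)
    (hb : ∀ x, N.att x = v → b x = b' x) : N.legVal i e b v = N.legVal i' e' b' v := by
  ext (_ | x | x | x)
  · exact hi
  · exact hs x.1 x.2
  · exact ht x.1 x.2
  · exact hb x.1 x.2

variable [Fintype V] [DecidableEq V] [Fintype E] [DecidableEq E] [Fintype B] [DecidableEq B]

variable {p : ℕ} [NeZero p] (N : TensorNetwork V E B)

omit [Fintype V] [DecidableEq E] in
lemma card_surface (A : Finset B) (Γ : Finset V) : (N.surface A Γ).card =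
    Fintype.card {e // ¬ (N.src e ∈ Γ ↔ N.tgt e ∈ Γ)} +
      (Fintype.card {b // b ∈ A ∧ N.att b ∉ Γ} + Fintype.card {b // b ∉ A ∧ N.att b ∈ Γ}) := by
  rw [surface, Finset.card_disjSum, Fintype.card_subtype, Fintype.card_subtype,
    Fintype.card_subtype, ← Finset.card_union_of_disjoint]
  · congr 2
    ext b
    simp only [Finset.mem_filter, Finset.mem_univ, true_and, Finset.mem_union]
    tauto
  · rw [Finset.disjoint_left]
    intro b
    simp only [Finset.mem_filter, Finset.mem_univ, true_and]
    tauto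

/-- The labels of the legs in a surface. -/
abbrev SurfaceBasis {V E B : Type*} [DecidableEq V] (N : TensorNetwork V E B) (p : ℕ)
    (A : Finset B) (Γ : Finset V) : Type _ :=
  ({e // ¬ (N.src e ∈ Γ ↔ N.tgt e ∈ Γ)} → ZMod p) ×
    ({b // b ∈ A ∧ N.att b ∉ Γ} → ZMod p) × ({b // b ∉ A ∧ N.att b ∈ Γ} → ZMod p)

omit [Fintype B] [DecidableEq B] in
/-- Given labels of the contracted legs that a set of tensors cuts, the boundary vector is the
product of the contractions of the tensors inside and outside of that set. -/
lemma exists_boundaryVec_eq_sum (Γ : Finset V) (φ : V → ZMod p → ℂ)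
    (t : ∀ v, QuditBasis p (N.Leg v) → ℂ) :
    ∃ F G : ({e // ¬ (N.src e ∈ Γ ↔ N.tgt e ∈ Γ)} → ZMod p) → QuditBasis p B → ℂ,
      (∀ s b b', (∀ x, N.att x ∈ Γ → b x = b' x) → F s b = F s b') ∧
      (∀ s b b', (∀ x, N.att x ∉ Γ → b x = b' x) → G s b = G s b') ∧
      ∀ b, N.boundaryVec (fun i => ∏ v, φ v (i v)) t b = ∑ s, F s b * G s b := by
  classical
  -- Since the bulk state is a product, each bulk leg can be summed locally into its tensor.
  let g : V → QuditBasis p E → QuditBasis p B → ℂ := fun v e b =>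
    ∑ x, φ v x * t v (N.legVal (fun _ => x) e b v)
  have hg : ∀ v e e' b b', (∀ x, N.src x = v → e x = e' x) → (∀ x, N.tgt x = v → e x = e' x) →
      (∀ x, N.att x = v → b x = b' x) → g v e b = g v e' b' := by
    intro v e e' b b' hs ht hb
    exact Finset.sum_congr rfl fun x _ => by rw [N.legVal_congr rfl hs ht hb]
  have hvec : ∀ b, N.boundaryVec (fun i => ∏ v, φ v (i v)) t b = ∑ e, ∏ v, g v e b := by
    intro b
    rw [boundaryVec, Finset.sum_comm]
    refine Finset.sum_congr rfl fun e _ => ?_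
    rw [Fintype.prod_sum]
    refine Finset.sum_congr rfl fun i _ => ?_
    rw [← Finset.prod_mul_distrib]
    refine Finset.prod_congr rfl fun v _ => ?_
    rw [N.legVal_congr (i := i) (i' := fun _ => i v) rfl (fun _ _ => rfl) (fun _ _ => rfl)
      fun _ _ => rfl]
  let F : QuditBasis p E → QuditBasis p B → ℂ := fun e b => ∏ v ∈ Γ, g v e b
  let G : QuditBasis p E → QuditBasis p B → ℂ := fun e b => ∏ v ∈ Γᶜ, g v e b
  let cut : E → Prop := fun e => ¬ (N.src e ∈ Γ ↔ N.tgt e ∈ Γ)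
  let join : ({e // cut e} → ZMod p) → ({e // ¬ cut e} → ZMod p) → QuditBasis p E :=
    fun s u => (Equiv.piEquivPiSubtypeProd cut fun _ => ZMod p).symm (s, u)
  have hjoin : ∀ s u u' (x : E), (∀ h : ¬ cut x, u ⟨x, h⟩ = u' ⟨x, h⟩) →
      join s u x = join s u' x := by
    intro s u u' x h
    change (if h : cut x then s ⟨x, h⟩ else u ⟨x, h⟩) = if h : cut x then s ⟨x, h⟩ else u' ⟨x, h⟩
    split_ifs with hx
    · rfl
    · exact h hx
  let F' : ({e // cut e} → ZMod p) → QuditBasis p B → ℂ := fun s b =>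
    ∑ u : {x : {e // ¬ cut e} // N.src x.1 ∈ Γ} → ZMod p,
      F (join s fun x => if h : N.src x.1 ∈ Γ then u ⟨x, h⟩ else 0) b
  let G' : ({e // cut e} → ZMod p) → QuditBasis p B → ℂ := fun s b =>
    ∑ u : {x : {e // ¬ cut e} // ¬ N.src x.1 ∈ Γ} → ZMod p,
      G (join s fun x => if h : N.src x.1 ∈ Γ then 0 else u ⟨x, h⟩) b
  have hF' : ∀ s b b', (∀ x, N.att x ∈ Γ → b x = b' x) → F' s b = F' s b' := by
    intro s b b' h
    refine Finset.sum_congr rfl fun u _ => Finset.prod_congr rfl fun v hv => ?_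
    exact hg _ _ _ _ _ (fun _ _ => rfl) (fun _ _ => rfl) fun x hx => h x (hx ▸ hv)
  have hG' : ∀ s b b', (∀ x, N.att x ∉ Γ → b x = b' x) → G' s b = G' s b' := by
    intro s b b' h
    refine Finset.sum_congr rfl fun u _ => Finset.prod_congr rfl fun v hv => ?_
    exact hg _ _ _ _ _ (fun _ _ => rfl) (fun _ _ => rfl) fun x hx =>
      h x (hx ▸ Finset.mem_compl.1 hv)
  have hsum : ∀ b, ∑ e, ∏ v, g v e b = ∑ s, F' s b * G' s b := by
    intro b
    rw [← (Equiv.piEquivPiSubtypeProd cut fun _ => ZMod p).symm.sum_comp, Fintype.sum_prod_type]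
    refine Finset.sum_congr rfl fun s _ => ?_
    -- An uncut leg has both ends inside `Γ` or both outside, so the position of its source decides
    -- which factor depends on it.
    rw [← sum_mul_eq_of_complementary (fun x : {e // ¬ cut e} => N.src x.1 ∈ Γ)
      (fun u => F (join s u) b) (fun u => G (join s u) b)]
    · exact Finset.sum_congr rfl fun u _ => (Finset.prod_mul_prod_compl Γ _).symm
    · intro u u' h
      refine Finset.prod_congr rfl fun v hv => hg _ _ _ _ _ (fun x hx => ?_) (fun x hx => ?_)
        fun _ _ => rfl
      · exact hjoin _ _ _ _ fun hc => h ⟨x, hc⟩ (hx ▸ hv)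
      · exact hjoin _ _ _ _ fun hc => h ⟨x, hc⟩ ((not_not.1 hc).2 (hx ▸ hv))
    · intro u u' h
      refine Finset.prod_congr rfl fun v hv => hg _ _ _ _ _ (fun x hx => ?_) (fun x hx => ?_)
        fun _ _ => rfl
      · exact hjoin _ _ _ _ fun hc => h ⟨x, hc⟩ (hx ▸ Finset.mem_compl.1 hv)
      · exact hjoin _ _ _ _ fun hc => h ⟨x, hc⟩
          fun hm => (hx ▸ Finset.mem_compl.1 hv : N.tgt x ∉ Γ) ((not_not.1 hc).1 hm)
  exact ⟨F', G', hF', hG', fun b => (hvec b).trans (hsum b)⟩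

/-- Across the cut defined by a set of tensors, the boundary vector factors through the legs of
the surface. -/
lemma exists_splitMatrix_eq_mul (A : Finset B) (Γ : Finset V) (φ : V → ZMod p → ℂ)
    (t : ∀ v, QuditBasis p (N.Leg v) → ℂ) :
    ∃ (L : Matrix (QuditBasis p {b // b ∈ A}) (N.SurfaceBasis p A Γ) ℂ)
      (R : Matrix (N.SurfaceBasis p A Γ) (QuditBasis p {b // b ∉ A}) ℂ),
      splitMatrix A (N.boundaryVec (fun i => ∏ v, φ v (i v)) t) = L * R := by
  classical
  obtain ⟨F', G', hF', hG', hsum⟩ := N.exists_boundaryVec_eq_sum Γ φ t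
  let bL : QuditBasis p {b // b ∈ A} → ({b // b ∉ A ∧ N.att b ∈ Γ} → ZMod p) → QuditBasis p B :=
    fun a β b => if h : b ∈ A then a ⟨b, h⟩ else if h' : N.att b ∈ Γ then β ⟨b, h, h'⟩ else 0
  let bR : ({b // b ∈ A ∧ N.att b ∉ Γ} → ZMod p) → QuditBasis p {b // b ∉ A} → QuditBasis p B :=
    fun α c b => if h : b ∈ A then (if h' : N.att b ∉ Γ then α ⟨b, h, h'⟩ else 0) else c ⟨b, h⟩
  let rA : QuditBasis p {b // b ∈ A} → ({b // b ∈ A ∧ N.att b ∉ Γ} → ZMod p) :=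
    fun a b => a ⟨b.1, b.2.1⟩
  let rC : QuditBasis p {b // b ∉ A} → ({b // b ∉ A ∧ N.att b ∈ Γ} → ZMod p) :=
    fun c b => c ⟨b.1, b.2.1⟩
  -- Boundary legs on the wrong side of the cut are passed through by Kronecker deltas: those of `A`
  -- attached outside `Γ` go to `R`, those outside `A` attached inside `Γ` go to `L`. The inner
  -- index thus runs over the legs of the surface.
  refine ⟨Matrix.of fun a s => if s.2.1 = rA a then F' s.1 (bL a s.2.2) else 0,
    Matrix.of fun s c => if s.2.2 = rC c then G' s.1 (bR s.2.1 c) else 0, ?_⟩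
  ext a c
  rw [mul_apply, Fintype.sum_prod_type]
  change N.boundaryVec _ t (joinLegs A (a, c)) = _
  rw [hsum]
  refine Finset.sum_congr rfl fun s _ => ?_
  rw [Fintype.sum_prod_type, Fintype.sum_eq_single (rA a), Fintype.sum_eq_single (rC c)]
  · have hL : F' s (joinLegs A (a, c)) = F' s (bL a (rC c)) := hF' _ _ _ fun x hx => by
      simp only [joinLegs_apply, bL, rC, hx, dif_pos]
    have hR : G' s (joinLegs A (a, c)) = G' s (bR (rA a) c) := hG' _ _ _ fun x hx => by
      simp only [joinLegs_apply, bR, rA, hx, not_false_eq_true, dif_pos]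
    rw [of_apply, of_apply, if_pos rfl, if_pos rfl, hL, hR]
  · intro β hβ
    simp [hβ]
  · intro α hα
    simp [hα]

/-- The reduced state factors through the labels of the surface, so its rank is at most $p$ to the
number of legs. -/
lemma entropy_le_card_surface {Φ : QuditBasis p V → ℂ} (hΦ : IsProductState Φ) (A : Finset B)
    (Γ : Finset V) {T : N.Choice p} (h : N.normSq Φ T ≠ 0) :
    N.entropy Φ A T ≤ (N.surface A Γ).card * Real.log p := by
  obtain ⟨φ, -, hφ⟩ := hΦ
  obtain rfl : Φ = fun i => ∏ v, φ v (i v) := funext hφ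
  obtain ⟨t, -, ht⟩ := exists_boundaryVec (fun i => ∏ v, φ v (i v)) T
  obtain ⟨L, R, hLR⟩ := N.exists_splitMatrix_eq_mul A Γ φ t
  rw [← Real.log_pow, ← Nat.cast_pow]
  refine vonNeumannEntropy_le_log_of_rank_le (posSemidef_reducedState _ A T)
    (trace_reducedState_boundaryState A h) ?_
  rw [reducedState_boundaryState, ht, reducedState_vecMulVec, hLR, Matrix.mul_assoc,
    ← Matrix.smul_mul]
  refine (rank_mul_le_left _ _).trans ((rank_le_card_width _).trans (le_of_eq ?_))
  simp only [Fintype.card_prod, Fintype.card_fun, ZMod.card, ← pow_add, card_surface]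

omit [Fintype V] [DecidableEq E] in
lemma exists_card_surface_eq_minCut (A : Finset B) :
    ∃ Γ : Finset V, (N.surface A Γ).card = N.minCut A :=
  Nat.sInf_mem (Set.range_nonempty fun Γ : Finset V => (N.surface A Γ).card)

omit [Fintype V] [DecidableEq E] in
lemma minCut_le (A : Finset B) (Γ : Finset V) : N.minCut A ≤ (N.surface A Γ).card :=
  Nat.sInf_le ⟨Γ, rfl⟩

lemma entropy_le_entropyRT {Φ : QuditBasis p V → ℂ} (hΦ : IsProductState Φ) (A : Finset B)
    {T : N.Choice p} (h : N.normSq Φ T ≠ 0) : N.entropy Φ A T ≤ N.entropyRT p A := by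
  obtain ⟨Γ, hΓ⟩ := N.exists_card_surface_eq_minCut A
  rw [entropyRT, ← hΓ]
  exact N.entropy_le_card_surface hΦ A Γ h

end TensorNetwork

/-! ### Contractions of families of matrices -/

section MixLegs

variable {X K : Type*} [DecidableEq X] (S : Finset X)

lemma mixLegs_mixLegs (x y : X → K) : mixLegs S (mixLegs S x y) (mixLegs S y x) = x := by
  ext i
  simp only [mixLegs]
  split_ifs <;> rfl

lemma mixLegs_of_mem {x y : X → K} {i : X} (h : i ∈ S) : mixLegs S x y i = x i := if_pos h

lemma mixLegs_of_notMem {x y : X → K} {i : X} (h : i ∉ S) : mixLegs S x y i = y i := if_neg h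

lemma eq_mixLegs_iff {x y z : X → K} :
    z = mixLegs S x y ↔ ∀ i, (i ∈ S → z i = x i) ∧ (i ∉ S → z i = y i) := by
  rw [funext_iff]
  refine forall_congr' fun i => ?_
  rw [mixLegs]
  split_ifs with h <;> simp [h]

/-- The number of pairs of labels which agree on a given set of legs. -/
lemma sum_eqOn_mul [Fintype X] [Fintype K] [DecidableEq K] (P : X → Prop) [DecidablePred P] :
    (∑ q : (X → K) × (X → K), if ∀ x, P x → q.1 x = q.2 x then (1 : ℂ) else 0) *
      (Fintype.card K : ℂ) ^ (Finset.univ.filter P).card =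
        (Fintype.card K : ℂ) ^ (2 * Fintype.card X) := by
  have h1 : ∀ x, (∑ s : K × K, if P x → s.1 = s.2 then (1 : ℂ) else 0) *
      (if P x then (Fintype.card K : ℂ) else 1) = (Fintype.card K : ℂ) ^ 2 := by
    intro x
    by_cases hx : P x
    · simp only [hx, forall_const, if_true, Fintype.sum_prod_type, Finset.sum_ite_eq,
        Finset.mem_univ, Finset.sum_const, Finset.card_univ, nsmul_eq_mul, mul_one, sq]
    · simp [hx, sq]
  have h2 : (∑ q : (X → K) × (X → K), if ∀ x, P x → q.1 x = q.2 x then (1 : ℂ) else 0) =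
      ∏ x, ∑ s : K × K, if P x → s.1 = s.2 then (1 : ℂ) else 0 := by
    rw [Fintype.prod_sum, ← (Equiv.arrowProdEquivProdArrow X (fun _ => K) (fun _ => K)).sum_comp]
    refine Finset.sum_congr rfl fun q _ => ?_
    rw [Finset.prod_ite_zero]
    simp
  rw [h2, ← Finset.prod_const, Finset.prod_filter, ← Finset.prod_mul_distrib,
    Finset.prod_congr rfl fun x _ => h1 x, Finset.prod_const, Finset.card_univ, pow_mul]

end MixLegs

namespace TensorNetwork

open Matrix ZMod

variable {V E B : Type*}

lemma legVal_eq_iff {p : ℕ} (N : TensorNetwork V E B) {i i' : QuditBasis p V}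
    {e e' : QuditBasis p E} {b b' : QuditBasis p B} {v : V} :
    N.legVal i e b v = N.legVal i' e' b' v ↔ i v = i' v ∧ (∀ x, N.src x = v → e x = e' x) ∧
      (∀ x, N.tgt x = v → e x = e' x) ∧ (∀ x, N.att x = v → b x = b' x) := by
  refine ⟨fun h => ⟨congrFun h (Sum.inl ()), fun x hx => congrFun h (Sum.inr (Sum.inl ⟨x, hx⟩)),
    fun x hx => congrFun h (Sum.inr (Sum.inr (Sum.inl ⟨x, hx⟩))),
    fun x hx => congrFun h (Sum.inr (Sum.inr (Sum.inr ⟨x, hx⟩)))⟩,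
    fun h => N.legVal_congr h.1 h.2.1 h.2.2.1 h.2.2.2⟩

variable [Fintype V] [DecidableEq V] [Fintype E] [DecidableEq E] [Fintype B] [DecidableEq B]

variable {p : ℕ} [NeZero p] (N : TensorNetwork V E B)

/-- Matrices on the legs of all tensors. -/
abbrev LegMatrices (N : TensorNetwork V E B) (p : ℕ) : Type _ :=
  ∀ v, Matrix (QuditBasis p (N.Leg v)) (QuditBasis p (N.Leg v)) ℂ

/-- One term of a contraction. -/
def contractionTerm (φ : V → ZMod p → ℂ) (M : N.LegMatrices p) (b b' : QuditBasis p B)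
    (x x' : QuditBasis p V × QuditBasis p E) (v : V) : ℂ :=
  φ v (x.1 v) * star (φ v (x'.1 v)) * M v (N.legVal x.1 x.2 b v) (N.legVal x'.1 x'.2 b' v)

/-- The contraction of a family of matrices with a bulk product state. -/
def contraction (φ : V → ZMod p → ℂ) (M : N.LegMatrices p) :
    Matrix (QuditBasis p B) (QuditBasis p B) ℂ :=
  Matrix.of fun b b' => ∑ x, ∑ x', ∏ v, N.contractionTerm φ M b b' x x' v

lemma rawState_eq_contraction (φ : V → ZMod p → ℂ) (T : N.Choice p) :
    N.rawState (fun i => ∏ v, φ v (i v)) T = N.contraction φ fun v => (T v).1 := by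
  ext b b'
  change ∑ i : QuditBasis p V, ∑ i' : QuditBasis p V, ∑ e : QuditBasis p E, ∑ e' : QuditBasis p E,
    (∏ v, φ v (i v)) * star (∏ v, φ v (i' v)) *
      ∏ v, (T v).1 (N.legVal i e b v) (N.legVal i' e' b' v) = ∑ x, ∑ x', _
  simp only [Fintype.sum_prod_type]
  refine Finset.sum_congr rfl fun i _ => ?_
  rw [Finset.sum_comm]
  refine Finset.sum_congr rfl fun e _ => Finset.sum_congr rfl fun i' _ =>
    Finset.sum_congr rfl fun e' _ => ?_
  rw [star_prod, ← Finset.prod_mul_distrib, ← Finset.prod_mul_distrib]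
  rfl

omit [Fintype B] [DecidableEq B] in
lemma contraction_mul_contraction (φ : V → ZMod p → ℂ) (M M' : N.LegMatrices p)
    (b b' c c' : QuditBasis p B) :
    N.contraction φ M b b' * N.contraction φ M' c c' =
      ∑ q : (QuditBasis p V × QuditBasis p E) × (QuditBasis p V × QuditBasis p E),
      ∑ q' : (QuditBasis p V × QuditBasis p E) × (QuditBasis p V × QuditBasis p E),
        ∏ v, (N.contractionTerm φ M b b' q.1 q'.1 v * N.contractionTerm φ M' c c' q.2 q'.2 v) := by
  change (∑ x, ∑ x', ∏ v, _) * (∑ x, ∑ x', ∏ v, _) = _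
  simp only [Fintype.sum_prod_type (α₁ := QuditBasis p V × QuditBasis p E), Finset.sum_mul_sum,
    Finset.prod_mul_distrib]

/-- The matrices `M` inside a set of tensors and `M'` outside of it. -/
def mixMatrices (W : Finset V) (M M' : N.LegMatrices p) : N.LegMatrices p :=
  fun v => if v ∈ W then M v else M' v

/-- A set of tensors that no contracted leg leaves and outside of which there is no boundary leg. -/
structure IsClosed (W : Finset V) : Prop where
  att_mem : ∀ b, N.att b ∈ W
  src_mem_iff : ∀ e, N.src e ∈ W ↔ N.tgt e ∈ W

omit [Fintype B] [DecidableEq B] in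
/-- The contraction factorizes over closed sets of tensors, stated as an exchange identity. -/
lemma contraction_exchange (φ : V → ZMod p → ℂ) {W : Finset V} (hW : N.IsClosed W)
    (M M' : N.LegMatrices p) (b b' c c' : QuditBasis p B) :
    N.contraction φ M b b' * N.contraction φ M' c c' =
      N.contraction φ (N.mixMatrices W M M') b b' *
        N.contraction φ (N.mixMatrices W M' M) c c' := by
  let S : Finset E := Finset.univ.filter fun e => N.src e ∈ W
  -- The two copies exchange their internal labels outside `W`. No leg crosses from `W`, and tensors
  -- outside `W` do not see the boundary labels, so only the matrices there change places.
  let f : (QuditBasis p V × QuditBasis p E) × (QuditBasis p V × QuditBasis p E) →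
      (QuditBasis p V × QuditBasis p E) × (QuditBasis p V × QuditBasis p E) := fun q =>
    ((mixLegs W q.1.1 q.2.1, mixLegs S q.1.2 q.2.2), (mixLegs W q.2.1 q.1.1, mixLegs S q.2.2 q.1.2))
  have hf : Function.Involutive f := fun q => by simp only [f, mixLegs_mixLegs]
  have hS : ∀ e, e ∈ S ↔ N.src e ∈ W := fun e => by simp [S]
  have hS' : ∀ e, e ∈ S ↔ N.tgt e ∈ W := fun e => by rw [hS, hW.src_mem_iff]
  have hin : ∀ (x y : QuditBasis p V × QuditBasis p E) (b : QuditBasis p B) (v : V), v ∈ W →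
      N.legVal (mixLegs W x.1 y.1) (mixLegs S x.2 y.2) b v = N.legVal x.1 x.2 b v := by
    intro x y b v hv
    refine N.legVal_congr (mixLegs_of_mem W hv) (fun e he => mixLegs_of_mem S ?_)
      (fun e he => mixLegs_of_mem S ?_) fun _ _ => rfl
    · rwa [hS, he]
    · rwa [hS', he]
  have hout : ∀ (x y : QuditBasis p V × QuditBasis p E) (b c : QuditBasis p B) (v : V), v ∉ W →
      N.legVal (mixLegs W x.1 y.1) (mixLegs S x.2 y.2) b v = N.legVal y.1 y.2 c v := by
    intro x y b c v hv
    refine N.legVal_congr (mixLegs_of_notMem W hv) (fun e he => mixLegs_of_notMem S ?_)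
      (fun e he => mixLegs_of_notMem S ?_) fun x hx => absurd (hx ▸ hW.att_mem x) hv
    · rwa [hS, he]
    · rwa [hS', he]
  rw [contraction_mul_contraction, contraction_mul_contraction,
    ← Equiv.sum_comp (Function.Involutive.toPerm f hf)]
  refine Finset.sum_congr rfl fun q _ => ?_
  rw [← Equiv.sum_comp (Function.Involutive.toPerm f hf)]
  refine Finset.sum_congr rfl fun q' _ => Finset.prod_congr rfl fun v _ => ?_
  simp only [Function.Involutive.coe_toPerm, f, contractionTerm, mixMatrices]
  by_cases hv : v ∈ W
  · simp only [hin _ _ _ _ hv, mixLegs_of_mem W hv, if_pos hv]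
  · rw [hout q.1 q.2 b c v hv, hout q.2 q.1 c b v hv, hout q'.1 q'.2 b' c' v hv,
      hout q'.2 q'.1 c' b' v hv]
    simp only [mixLegs_of_notMem W hv, if_neg hv]
    ring

end TensorNetwork

/-! ### Moments of random contractions -/

namespace TensorNetwork

open Matrix ZMod

variable {V E B : Type*} [Fintype V] [DecidableEq V] [Fintype E] [DecidableEq E]
  [Fintype B] [DecidableEq B]

variable {p : ℕ} [NeZero p] (N : TensorNetwork V E B)

/-- The dimension of the space of the tensor at `v`. -/
def tensorDim (p : ℕ) (v : V) : ℂ := (p : ℂ) ^ Fintype.card (N.Leg v)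

omit [Fintype V] [DecidableEq E] [DecidableEq B] in
lemma tensorDim_ne_zero (v : V) : N.tensorDim p v ≠ 0 := pow_ne_zero _ (NeZero.ne _)

/-- The maximally mixed state at every tensor. -/
def mixedMatrices : N.LegMatrices p := fun v => (N.tensorDim p v)⁻¹ • 1

lemma prod_mul_star_self {φ : V → ZMod p → ℂ} (hφ : ∀ v, ∑ i, ‖φ v i‖ ^ 2 = 1) :
    ∑ i : QuditBasis p V, ∏ v, (φ v (i v) * star (φ v (i v))) = 1 := by
  rw [← Fintype.prod_sum fun v x => φ v x * star (φ v x)]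
  refine Finset.prod_eq_one fun v _ => ?_
  have h := (sum_norm_sq_eq_one_iff (φ v)).1 (hφ v)
  rw [dotProduct_comm] at h
  exact h

/-- Identity matrices force the two label families to agree, and the normalised bulk vectors sum to
one; only contracted and boundary labels are left to count. -/
lemma trace_contraction_mixedMatrices {φ : V → ZMod p → ℂ} (hφ : ∀ v, ∑ i, ‖φ v i‖ ^ 2 = 1) :
    (N.contraction φ N.mixedMatrices).trace =
      (∏ v, (N.tensorDim p v)⁻¹) * (p : ℂ) ^ (Fintype.card E + Fintype.card B) := by
  have h1 : ∀ b : QuditBasis p B, N.contraction φ N.mixedMatrices b b =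
      (∏ v, (N.tensorDim p v)⁻¹) * (p : ℂ) ^ Fintype.card E := by
    intro b
    have hterm : ∀ x x' : QuditBasis p V × QuditBasis p E,
        ∏ v, N.contractionTerm φ N.mixedMatrices b b x x' v =
          if x' = x then (∏ v, (N.tensorDim p v)⁻¹) * ∏ v, (φ v (x.1 v) * star (φ v (x.1 v)))
            else 0 := by
      intro x x'
      split_ifs with h
      · subst h
        rw [← Finset.prod_mul_distrib]
        refine Finset.prod_congr rfl fun v _ => ?_
        simp only [contractionTerm, mixedMatrices, Matrix.smul_apply, one_apply_eq, smul_eq_mul,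
          mul_one]
        ring
      · by_contra h0
        have hv : ∀ v, N.legVal x.1 x.2 b v = N.legVal x'.1 x'.2 b v := by
          intro v
          by_contra hne
          refine h0 (Finset.prod_eq_zero (Finset.mem_univ v) ?_)
          simp only [contractionTerm, mixedMatrices, Matrix.smul_apply, one_apply_ne hne,
            smul_zero, mul_zero]
        simp only [legVal_eq_iff] at hv
        refine h (Prod.ext (funext fun v => (hv v).1.symm) (funext fun e => ?_))
        exact ((hv (N.src e)).2.1 e rfl).symm
    change ∑ x, ∑ x', ∏ v, _ = _
    simp only [hterm, Finset.sum_ite_eq', Finset.mem_univ, if_true]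
    rw [← Finset.mul_sum, Fintype.sum_prod_type, Finset.sum_comm]
    simp only [prod_mul_star_self hφ, Finset.sum_const, Finset.card_univ, nsmul_eq_mul, mul_one,
      Fintype.card_fun, ZMod.card, Nat.cast_pow]
  simp only [trace, diag, h1, Finset.sum_const, Finset.card_univ, Fintype.card_fun, ZMod.card,
    nsmul_eq_mul, Nat.cast_pow, pow_add]
  ring

/-- The index contractions enforced by swapping the two copies of the tensors in `Γ`. -/
def SwapCond (Γ : Finset V) (b b' c c' : QuditBasis p B)
    (q q' : (QuditBasis p V × QuditBasis p E) × (QuditBasis p V × QuditBasis p E)) (v : V) : Prop :=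
  (v ∈ Γ → N.legVal q.1.1 q.1.2 b v = N.legVal q'.2.1 q'.2.2 c' v ∧
    N.legVal q.2.1 q.2.2 c v = N.legVal q'.1.1 q'.1.2 b' v) ∧
  (v ∉ Γ → N.legVal q.1.1 q.1.2 b v = N.legVal q'.1.1 q'.1.2 b' v ∧
    N.legVal q.2.1 q.2.2 c v = N.legVal q'.2.1 q'.2.2 c' v)

/-- Swapping the indices of two copies of the tensors in `Γ`. -/
def swapIndex (Γ : Finset V)
    (q : (QuditBasis p V × QuditBasis p E) × (QuditBasis p V × QuditBasis p E)) :
    (QuditBasis p V × QuditBasis p E) × (QuditBasis p V × QuditBasis p E) :=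
  ((mixLegs Γ q.2.1 q.1.1, mixLegs (Finset.univ.filter fun e => N.src e ∈ Γ) q.2.2 q.1.2),
    (mixLegs Γ q.1.1 q.2.1, mixLegs (Finset.univ.filter fun e => N.src e ∈ Γ) q.1.2 q.2.2))

omit [Fintype V] [Fintype B] [DecidableEq B] [NeZero p] in
-- The conditions at the source of each leg determine `q'` from `q`. The condition at its target is
-- then automatic unless the leg is cut, where it equates the two copies. Each cut leg thus costs a
-- factor $p$.
lemma forall_swapCond_iff (Γ : Finset V) (b b' c c' : QuditBasis p B)
    (q q' : (QuditBasis p V × QuditBasis p E) × (QuditBasis p V × QuditBasis p E)) :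
    (∀ v, N.SwapCond Γ b b' c c' q q' v) ↔ q' = N.swapIndex Γ q ∧
      (∀ e, ¬ (N.src e ∈ Γ ↔ N.tgt e ∈ Γ) → q.1.2 e = q.2.2 e) ∧
      ∀ x, (N.att x ∈ Γ → b x = c' x ∧ c x = b' x) ∧ (N.att x ∉ Γ → b x = b' x ∧ c x = c' x) := by
  obtain ⟨⟨i, e⟩, ⟨j, f⟩⟩ := q
  obtain ⟨⟨i', e'⟩, ⟨j', f'⟩⟩ := q'
  simp only [SwapCond, swapIndex, legVal_eq_iff, Prod.mk.injEq, eq_mixLegs_iff, Finset.mem_filter,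
    Finset.mem_univ, true_and]
  constructor
  · intro h
    refine ⟨⟨⟨fun v => ⟨fun hv => ?_, fun hv => ?_⟩, fun x => ⟨fun hx => ?_, fun hx => ?_⟩⟩,
      fun v => ⟨fun hv => ?_, fun hv => ?_⟩, fun x => ⟨fun hx => ?_, fun hx => ?_⟩⟩,
      fun x hx => ?_, fun x => ⟨fun hx => ⟨?_, ?_⟩, fun hx => ⟨?_, ?_⟩⟩⟩
    · exact ((h v).1 hv).2.1.symm
    · exact ((h v).2 hv).1.1.symm
    · exact (((h _).1 hx).2.2.1 x rfl).symm
    · exact (((h _).2 hx).1.2.1 x rfl).symm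
    · exact ((h v).1 hv).1.1.symm
    · exact ((h v).2 hv).2.1.symm
    · exact (((h _).1 hx).1.2.1 x rfl).symm
    · exact (((h _).2 hx).2.2.1 x rfl).symm
    · by_cases hs : N.src x ∈ Γ
      · have ht : N.tgt x ∉ Γ := fun ht => hx ⟨fun _ => ht, fun _ => hs⟩
        exact (((h _).2 ht).1.2.2.1 x rfl).trans (((h _).1 hs).2.2.1 x rfl).symm
      · have ht : N.tgt x ∈ Γ := by
          by_contra ht
          exact hx ⟨fun h => absurd h hs, fun h => absurd h ht⟩
        exact (((h _).2 hs).1.2.1 x rfl).trans (((h _).1 ht).2.2.2.1 x rfl).symm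
    · exact ((h _).1 hx).1.2.2.2 x rfl
    · exact ((h _).1 hx).2.2.2.2 x rfl
    · exact ((h _).2 hx).1.2.2.2 x rfl
    · exact ((h _).2 hx).2.2.2.2 x rfl
  · rintro ⟨⟨⟨hi, he⟩, hj, hf⟩, hcut, hb⟩ v
    have hcut1 : ∀ x, N.src x ∈ Γ → N.tgt x ∉ Γ → e x = f x := fun x h1 h2 =>
      hcut x fun h => h2 (h.1 h1)
    have hcut2 : ∀ x, N.src x ∉ Γ → N.tgt x ∈ Γ → e x = f x := fun x h1 h2 =>
      hcut x fun h => h1 (h.2 h2)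
    refine ⟨fun hv => ⟨⟨((hj v).1 hv).symm, ?_, ?_, ?_⟩, ((hi v).1 hv).symm, ?_, ?_, ?_⟩,
      fun hv => ⟨⟨((hi v).2 hv).symm, ?_, ?_, ?_⟩, ((hj v).2 hv).symm, ?_, ?_, ?_⟩⟩
    · rintro x rfl; exact ((hf x).1 hv).symm
    · rintro x rfl
      by_cases hs : N.src x ∈ Γ
      · exact ((hf x).1 hs).symm
      · exact (hcut2 x hs hv).trans ((hf x).2 hs).symm
    · rintro x rfl; exact ((hb x).1 hv).1
    · rintro x rfl; exact ((he x).1 hv).symm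
    · rintro x rfl
      by_cases hs : N.src x ∈ Γ
      · exact ((he x).1 hs).symm
      · exact (hcut2 x hs hv).symm.trans ((he x).2 hs).symm
    · rintro x rfl; exact ((hb x).1 hv).2
    · rintro x rfl; exact ((he x).2 hv).symm
    · rintro x rfl
      by_cases hs : N.src x ∈ Γ
      · exact (hcut1 x hs hv).trans ((he x).1 hs).symm
      · exact ((he x).2 hs).symm
    · rintro x rfl; exact ((hb x).2 hv).1
    · rintro x rfl; exact ((hf x).2 hv).symm
    · rintro x rfl
      by_cases hs : N.src x ∈ Γ
      · exact (hcut1 x hs hv).symm.trans ((hf x).1 hs).symm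
      · exact ((hf x).2 hs).symm
    · rintro x rfl; exact ((hb x).2 hv).2

open Classical in
/-- The contribution of swapping the tensors in `Γ` to the second moment. -/
def swapTerm (φ : V → ZMod p → ℂ) (Γ : Finset V) (b b' c c' : QuditBasis p B) : ℂ :=
  ∑ q : (QuditBasis p V × QuditBasis p E) × (QuditBasis p V × QuditBasis p E),
  ∑ q' : (QuditBasis p V × QuditBasis p E) × (QuditBasis p V × QuditBasis p E),
    ∏ v, (φ v (q.1.1 v) * star (φ v (q'.1.1 v)) * (φ v (q.2.1 v) * star (φ v (q'.2.1 v))) *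
      if N.SwapCond Γ b b' c c' q q' v then 1 else 0)

omit [Fintype B] [DecidableEq B] in
-- Swapping permutes the bulk labels among the two copies, so the bulk weights still sum to one, and
-- what is left is the count of contracted labels agreeing on the cut.
lemma swapTerm_mul {φ : V → ZMod p → ℂ} (hφ : ∀ v, ∑ i, ‖φ v i‖ ^ 2 = 1) (Γ : Finset V)
    (b b' c c' : QuditBasis p B) [Decidable (∀ x, (N.att x ∈ Γ → b x = c' x ∧ c x = b' x) ∧
      (N.att x ∉ Γ → b x = b' x ∧ c x = c' x))] :
    N.swapTerm φ Γ b b' c c' *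
      (p : ℂ) ^ (Finset.univ.filter fun e => ¬ (N.src e ∈ Γ ↔ N.tgt e ∈ Γ)).card =
      (p : ℂ) ^ (2 * Fintype.card E) *
        if ∀ x, (N.att x ∈ Γ → b x = c' x ∧ c x = b' x) ∧
          (N.att x ∉ Γ → b x = b' x ∧ c x = c' x) then 1 else 0 := by
  classical
  set β : ℂ := if ∀ x, (N.att x ∈ Γ → b x = c' x ∧ c x = b' x) ∧
          (N.att x ∉ Γ → b x = b' x ∧ c x = c' x) then 1 else 0 with hβ
  let w : QuditBasis p V → ℂ := fun i => ∏ v, (φ v (i v) * star (φ v (i v)))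
  let γ : QuditBasis p E → QuditBasis p E → ℂ := fun e f =>
    if ∀ x, ¬ (N.src x ∈ Γ ↔ N.tgt x ∈ Γ) → e x = f x then 1 else 0
  have h1 : ∀ q q' : (QuditBasis p V × QuditBasis p E) × (QuditBasis p V × QuditBasis p E),
      ∏ v, (φ v (q.1.1 v) * star (φ v (q'.1.1 v)) * (φ v (q.2.1 v) * star (φ v (q'.2.1 v))) *
        if N.SwapCond Γ b b' c c' q q' v then 1 else 0) =
      if q' = N.swapIndex Γ q then w q.1.1 * w q.2.1 * γ q.1.2 q.2.2 * β else 0 := by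
    intro q q'
    rw [Finset.prod_mul_distrib, Finset.prod_ite_zero]
    simp only [Finset.mem_univ, forall_const, Finset.prod_const_one, forall_swapCond_iff]
    by_cases hq : q' = N.swapIndex Γ q
    · have h2 : ∏ v, (φ v (q.1.1 v) * star (φ v (q'.1.1 v)) *
          (φ v (q.2.1 v) * star (φ v (q'.2.1 v)))) = w q.1.1 * w q.2.1 := by
        rw [← Finset.prod_mul_distrib]
        refine Finset.prod_congr rfl fun v _ => ?_
        rw [hq]
        simp only [swapIndex]
        by_cases hv : v ∈ Γ
        · rw [mixLegs_of_mem Γ hv, mixLegs_of_mem Γ hv]; ring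
        · rw [mixLegs_of_notMem Γ hv, mixLegs_of_notMem Γ hv]
      have h3 : (if q' = N.swapIndex Γ q ∧
          (∀ e, ¬ (N.src e ∈ Γ ↔ N.tgt e ∈ Γ) → q.1.2 e = q.2.2 e) ∧
          ∀ x, (N.att x ∈ Γ → b x = c' x ∧ c x = b' x) ∧
            (N.att x ∉ Γ → b x = b' x ∧ c x = c' x) then (1 : ℂ) else 0) =
          γ q.1.2 q.2.2 * β := by
        simp only [γ, hβ, hq, true_and, ite_and, ite_mul, one_mul, zero_mul]
      rw [h2, if_pos hq, h3, mul_assoc (w q.1.1 * w q.2.1)]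
    · rw [if_neg hq, if_neg (fun h => hq h.1), mul_zero]
  have hw : ∑ i, w i = 1 := prod_mul_star_self hφ
  have h3 : N.swapTerm φ Γ b b' c c' = (∑ s : QuditBasis p E × QuditBasis p E, γ s.1 s.2) * β := by
    rw [swapTerm]
    simp only [h1, Finset.sum_ite_eq', Finset.mem_univ, if_true, Fintype.sum_prod_type]
    calc _ = ∑ i, ∑ e, ∑ j, ∑ f, w i * (w j * (γ e f * β)) := by simp only [mul_assoc]
      _ = ∑ i, w i * ∑ e, ∑ j, w j * ∑ f, γ e f * β := by simp only [Finset.mul_sum]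
      _ = _ := by
        rw [← Finset.sum_mul, hw, one_mul, Finset.sum_mul]
        refine Finset.sum_congr rfl fun e _ => ?_
        rw [← Finset.sum_mul, hw, one_mul, Finset.sum_mul]
  have h4 := sum_eqOn_mul (K := ZMod p) fun e => ¬ (N.src e ∈ Γ ↔ N.tgt e ∈ Γ)
  rw [ZMod.card] at h4
  rw [h3, mul_right_comm, ← h4]

/-- The contribution of a surface to the second moment. -/
lemma sum_swapTerm {φ : V → ZMod p → ℂ} (hφ : ∀ v, ∑ i, ‖φ v i‖ ^ 2 = 1) (A : Finset B)
    (Γ : Finset V) :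
    (∑ b, ∑ c, N.swapTerm φ Γ b (mixLegs A c b) c (mixLegs A b c)) *
      (p : ℂ) ^ (N.surface A Γ).card = (p : ℂ) ^ (2 * (Fintype.card E + Fintype.card B)) := by
  classical
  -- Purity exchanges the copies on `A`, the tensors exchange them on `Γ`. The copies are forced to
  -- agree exactly at the boundary legs where the two prescriptions differ, which are those of the
  -- surface.
  have h1 : ∀ b c : QuditBasis p B, (∀ x, (N.att x ∈ Γ → b x = mixLegs A b c x ∧
      c x = mixLegs A c b x) ∧ (N.att x ∉ Γ → b x = mixLegs A c b x ∧ c x = mixLegs A b c x)) ↔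
      ∀ x, ¬ (x ∈ A ↔ N.att x ∈ Γ) → b x = c x := by
    intro b c
    refine forall_congr' fun x => ?_
    by_cases hA : x ∈ A <;> by_cases hx : N.att x ∈ Γ <;> simp [mixLegs, hA, hx, eq_comm]
  have h2 := sum_eqOn_mul (K := ZMod p) fun x => ¬ (x ∈ A ↔ N.att x ∈ Γ)
  rw [ZMod.card, Fintype.sum_prod_type] at h2
  rw [surface, Finset.card_disjSum, mul_add 2, pow_add, pow_add, ← h2, ← mul_assoc, ← mul_assoc]
  congr 1
  simp only [Finset.sum_mul, Finset.mul_sum]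
  refine Finset.sum_congr rfl fun b _ => Finset.sum_congr rfl fun c _ => ?_
  rw [N.swapTerm_mul hφ]
  congr 1
  exact if_congr (h1 b c) rfl rfl

/-- The tensors of a choice inside `W`, and maximally mixed states outside. -/
def partialMatrices (W : Finset V) (T : N.Choice p) : N.LegMatrices p :=
  N.mixMatrices W (fun v => (T v).1) N.mixedMatrices

instance : Fintype (N.Choice p) := inferInstanceAs (Fintype (∀ v, StabState p (N.Leg v)))

instance : Nonempty (N.Choice p) := inferInstanceAs (Nonempty (∀ v, StabState p (N.Leg v)))

lemma card_choice : (Fintype.card (N.Choice p) : ℂ) =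
    ∏ v, (Fintype.card (StabState p (N.Leg v)) : ℂ) := by
  have : Fintype.card (N.Choice p) = ∏ v, Fintype.card (StabState p (N.Leg v)) :=
    Fintype.card_pi
  rw [this, Nat.cast_prod]

lemma sum_choice_prod (h : ∀ v, StabState p (N.Leg v) → ℂ) :
    ∑ T : N.Choice p, ∏ v, h v (T v) = ∏ v, ∑ σ, h v σ :=
  (Fintype.prod_sum h).symm

/-- The normalization of the second moment. -/
def momentConst (p : ℕ) [NeZero p] (W : Finset V) (v : V) : ℂ :=
  if v ∈ W then (N.tensorDim p v * (N.tensorDim p v + 1))⁻¹ else ((N.tensorDim p v)⁻¹) ^ 2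

omit [Fintype V] in
-- The 2-design property at a random tensor, and a deterministic mixed state elsewhere, put in a
-- common form; outside `W` the swap term is absent.
lemma sum_partialMatrices_mul [Fact p.Prime] (W : Finset V) (v : V)
    (l l' m m' : QuditBasis p (N.Leg v)) :
    (∑ σ : StabState p (N.Leg v), (if v ∈ W then σ.1 else N.mixedMatrices v) l l' *
      (if v ∈ W then σ.1 else N.mixedMatrices v) m m') =
      Fintype.card (StabState p (N.Leg v)) * (N.momentConst p W v *
        ((if v ∈ W then (if l = m' ∧ m = l' then 1 else 0) else 0) +
          if l = l' ∧ m = m' then 1 else 0)) := by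
  by_cases hv : v ∈ W
  · simp only [if_pos hv, momentConst, StabState.sum_mul, tensorDim]
    rw [add_comm (if l = l' ∧ m = m' then _ else _), div_eq_mul_inv, mul_assoc]
  · simp only [if_neg hv, momentConst, zero_add, mixedMatrices, Matrix.smul_apply, one_apply,
      smul_eq_mul, Finset.sum_const, Finset.card_univ, nsmul_eq_mul]
    by_cases h1 : l = l' <;> by_cases h2 : m = m' <;> simp [h1, h2, sq]

/-- By independence the mean of the product is a product of means, each a swap plus an identity.
Multiplying out chooses a set `Γ` of swapped tensors. -/
lemma sum_contraction_mul_contraction [Fact p.Prime] (φ : V → ZMod p → ℂ) (W : Finset V)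
    (b b' c c' : QuditBasis p B) :
    ∑ T : N.Choice p, N.contraction φ (N.partialMatrices W T) b b' *
      N.contraction φ (N.partialMatrices W T) c c' =
      Fintype.card (N.Choice p) * ((∏ v, N.momentConst p W v) *
        ∑ Γ ∈ W.powerset, N.swapTerm φ Γ b b' c c') := by
  classical
  simp only [contraction_mul_contraction, swapTerm]
  rw [Finset.sum_comm, card_choice, ← mul_assoc, ← Finset.prod_mul_distrib, Finset.sum_comm (s := W.powerset),
    Finset.mul_sum]
  refine Finset.sum_congr rfl fun q _ => ?_
  rw [Finset.sum_comm, Finset.sum_comm (s := W.powerset), Finset.mul_sum]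
  refine Finset.sum_congr rfl fun q' _ => ?_
  let X : V → ℂ := fun v =>
    φ v (q.1.1 v) * star (φ v (q'.1.1 v)) * (φ v (q.2.1 v) * star (φ v (q'.2.1 v)))
  let l := fun v => N.legVal q.1.1 q.1.2 b v
  let l' := fun v => N.legVal q'.1.1 q'.1.2 b' v
  let m := fun v => N.legVal q.2.1 q.2.2 c v
  let m' := fun v => N.legVal q'.2.1 q'.2.2 c' v
  let h : ∀ v, StabState p (N.Leg v) → ℂ := fun v σ =>
    X v * ((if v ∈ W then σ.1 else N.mixedMatrices v) (l v) (l' v) *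
      (if v ∈ W then σ.1 else N.mixedMatrices v) (m v) (m' v))
  have h1 : ∀ T : N.Choice p, ∏ v, (N.contractionTerm φ (N.partialMatrices W T) b b' q.1 q'.1 v *
      N.contractionTerm φ (N.partialMatrices W T) c c' q.2 q'.2 v) = ∏ v, h v (T v) := by
    intro T
    refine Finset.prod_congr rfl fun v _ => ?_
    simp only [contractionTerm, partialMatrices, mixMatrices, h, X, l, l', m, m']
    ring
  rw [Finset.sum_congr rfl fun T _ => h1 T, sum_choice_prod]
  have h2 : ∀ v, ∑ σ, h v σ = (Fintype.card (StabState p (N.Leg v)) * N.momentConst p W v) *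
      (X v * (if v ∈ W then (if l v = m' v ∧ m v = l' v then 1 else 0) else 0) +
        X v * if l v = l' v ∧ m v = m' v then 1 else 0) := by
    intro v
    rw [← Finset.mul_sum, sum_partialMatrices_mul]
    ring
  rw [Finset.prod_congr rfl fun v _ => h2 v, Finset.prod_mul_distrib]
  congr 1
  -- Sets not contained in `W` contribute a zero factor.
  rw [Fintype.prod_add, ← Finset.sum_subset (Finset.subset_univ W.powerset)]
  · refine Finset.sum_congr rfl fun Γ hΓ => ?_
    rw [← Finset.prod_mul_prod_compl Γ]
    congr 1
    · refine Finset.prod_congr rfl fun v hv => ?_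
      rw [if_pos (Finset.mem_powerset.1 hΓ hv)]
      congr 1
      refine if_congr ?_ rfl rfl
      simp only [SwapCond, hv, forall_const, not_true_eq_false, IsEmpty.forall_iff, and_true]
      rfl
    · refine Finset.prod_congr rfl fun v hv => ?_
      congr 1
      refine if_congr ?_ rfl rfl
      simp only [SwapCond, Finset.mem_compl.1 hv, forall_const, not_false_eq_true,
        IsEmpty.forall_iff, true_and]
      rfl
  · intro Γ _ hΓ
    obtain ⟨v, hv, hvW⟩ := Finset.not_subset.1 (mt Finset.mem_powerset.2 hΓ)
    rw [Finset.prod_eq_zero hv, zero_mul]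
    rw [if_neg hvW, mul_zero]

lemma sum_contraction [Fact p.Prime] (φ : V → ZMod p → ℂ) (W : Finset V) (b b' : QuditBasis p B) :
    ∑ T : N.Choice p, N.contraction φ (N.partialMatrices W T) b b' =
      Fintype.card (N.Choice p) * N.contraction φ N.mixedMatrices b b' := by
  change ∑ T : N.Choice p, ∑ x, ∑ x', ∏ v, _ = _ * ∑ x, ∑ x', ∏ v, _
  rw [Finset.sum_comm, Finset.mul_sum]
  refine Finset.sum_congr rfl fun x _ => ?_
  rw [Finset.sum_comm, Finset.mul_sum]
  refine Finset.sum_congr rfl fun x' _ => ?_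
  let h : ∀ v, StabState p (N.Leg v) → ℂ := fun v σ =>
    φ v (x.1 v) * star (φ v (x'.1 v)) * (if v ∈ W then σ.1 else N.mixedMatrices v)
      (N.legVal x.1 x.2 b v) (N.legVal x'.1 x'.2 b' v)
  change ∑ T : N.Choice p, ∏ v, h v (T v) = _
  rw [sum_choice_prod, card_choice, ← Finset.prod_mul_distrib]
  refine Finset.prod_congr rfl fun v _ => ?_
  simp only [h]
  rw [← Finset.mul_sum, contractionTerm]
  have h1 : ∑ σ : StabState p (N.Leg v), (if v ∈ W then σ.1 else N.mixedMatrices v)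
      (N.legVal x.1 x.2 b v) (N.legVal x'.1 x'.2 b' v) =
      Fintype.card (StabState p (N.Leg v)) * N.mixedMatrices v
        (N.legVal x.1 x.2 b v) (N.legVal x'.1 x'.2 b' v) := by
    by_cases hv : v ∈ W
    · simp only [if_pos hv]
      exact StabState.sum_apply _ _
    · simp only [if_neg hv, Finset.sum_const, Finset.card_univ, nsmul_eq_mul]
  rw [h1]
  ring

end TensorNetwork

/-! ### The part of the network connected to the boundary -/

namespace TensorNetwork

open Matrix ZMod

variable {V E B : Type*} [Fintype V] [DecidableEq V] [Fintype E] [DecidableEq E]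
  [Fintype B] [DecidableEq B]

open Classical in
/-- The tensors connected to the boundary by contracted legs. -/
def boundaryComponent (N : TensorNetwork V E B) : Finset V :=
  Finset.univ.filter fun v =>
    ∃ b, Relation.EqvGen (fun u w => ∃ e, N.src e = u ∧ N.tgt e = w) (N.att b) v

omit [DecidableEq V] [Fintype E] [DecidableEq E] [DecidableEq B] in
lemma mem_boundaryComponent {N : TensorNetwork V E B} {v : V} : v ∈ N.boundaryComponent ↔
    ∃ b, Relation.EqvGen (fun u w => ∃ e, N.src e = u ∧ N.tgt e = w) (N.att b) v := by
  simp only [boundaryComponent, Finset.mem_filter, Finset.mem_univ, true_and]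

omit [DecidableEq V] [Fintype E] [DecidableEq E] [DecidableEq B] in
lemma isClosed_boundaryComponent (N : TensorNetwork V E B) : N.IsClosed N.boundaryComponent where
  att_mem b := mem_boundaryComponent.2 ⟨b, Relation.EqvGen.refl _⟩
  src_mem_iff e := by
    simp only [mem_boundaryComponent]
    exact ⟨fun ⟨b, hb⟩ => ⟨b, hb.trans _ _ _ (.rel _ _ ⟨e, rfl, rfl⟩)⟩,
      fun ⟨b, hb⟩ => ⟨b, hb.trans _ _ _ ((Relation.EqvGen.rel _ _ ⟨e, rfl, rfl⟩).symm _ _)⟩⟩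

omit [DecidableEq E] in
/-- A set of tensors connected to the boundary is determined by its surface. -/
lemma injOn_surface (N : TensorNetwork V E B) (A : Finset B) :
    Set.InjOn (N.surface A) (N.boundaryComponent.powerset : Set (Finset V)) := by
  intro Γ hΓ Γ' hΓ' h
  rw [Finset.mem_coe, Finset.mem_powerset] at hΓ hΓ'
  have hE : ∀ e, (N.src e ∈ Γ ↔ N.tgt e ∈ Γ) ↔ (N.src e ∈ Γ' ↔ N.tgt e ∈ Γ') := by
    intro e
    have := Finset.ext_iff.1 h (Sum.inl e)
    simpa [surface, not_iff_not] using this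
  have hB : ∀ b, N.att b ∈ Γ ↔ N.att b ∈ Γ' := by
    intro b
    have := Finset.ext_iff.1 h (Sum.inr b)
    simp only [surface, Finset.inr_mem_disjSum, Finset.mem_filter, Finset.mem_univ, true_and,
      not_iff_not] at this
    tauto
  -- Both sets cut the same contracted legs, so whether they agree at a tensor is constant along
  -- legs; equality of the boundary parts gives agreement where the boundary is attached.
  have key : ∀ u v, Relation.EqvGen (fun u w => ∃ e, N.src e = u ∧ N.tgt e = w) u v →
      ((u ∈ Γ ↔ u ∈ Γ') ↔ (v ∈ Γ ↔ v ∈ Γ')) := by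
    intro u v huv
    induction huv with
    | rel u v h =>
      obtain ⟨e, rfl, rfl⟩ := h
      have := hE e
      tauto
    | refl => rfl
    | symm _ _ _ ih => exact ih.symm
    | trans _ _ _ _ _ ih ih' => exact ih.trans ih'
  ext v
  by_cases hv : v ∈ N.boundaryComponent
  · obtain ⟨b, hb⟩ := mem_boundaryComponent.1 hv
    exact (key _ _ hb).1 (hB b)
  · exact ⟨fun h => absurd (hΓ h) hv, fun h => absurd (hΓ' h) hv⟩

lemma card_surfaces_le (N : TensorNetwork V E B) (A : Finset B) :
    (N.surfaces A).card ≤ 2 ^ Fintype.card V :=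
  Finset.card_image_le.trans_eq (by rw [Finset.card_univ, Fintype.card_finset])

lemma numMinimal_le (N : TensorNetwork V E B) (A : Finset B) :
    N.numMinimal A ≤ 2 ^ Fintype.card V :=
  (Finset.card_le_card (Finset.filter_subset _ _)).trans (N.card_surfaces_le A)

lemma numMinimal_pos (N : TensorNetwork V E B) (A : Finset B) : 0 < N.numMinimal A := by
  obtain ⟨Γ, hΓ⟩ := N.exists_card_surface_eq_minCut A
  exact Finset.card_pos.2 ⟨N.surface A Γ,
    Finset.mem_filter.2 ⟨Finset.mem_image_of_mem _ (Finset.mem_univ _), hΓ⟩⟩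

omit [Fintype V] [DecidableEq E] in
lemma minCut_empty (N : TensorNetwork V E B) : N.minCut ∅ = 0 :=
  Nat.le_zero.1 ((N.minCut_le ∅ ∅).trans_eq (by simp [surface]))

/-- Only the empty surface has no legs. With leading coefficient one, the second moment of the norm
is close to its squared mean. -/
lemma numMinimal_empty (N : TensorNetwork V E B) : N.numMinimal ∅ = 1 := by
  refine le_antisymm (Finset.card_le_one.2 fun x hx y hy => ?_) (N.numMinimal_pos ∅)
  have hx := (Finset.mem_filter.1 hx).2
  have hy := (Finset.mem_filter.1 hy).2
  rw [minCut_empty, Finset.card_eq_zero] at hx hy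
  rw [hx, hy]

omit [Fintype V] [DecidableEq E] in
lemma minCut_le_card (N : TensorNetwork V E B) (A : Finset B) :
    N.minCut A ≤ Fintype.card E + Fintype.card B := by
  refine (N.minCut_le A ∅).trans ((Finset.card_le_univ _).trans_eq ?_)
  rw [Fintype.card_sum]

/-- The sum over surfaces is dominated by the minimal ones. -/
lemma sum_inv_pow_card_surface_le (N : TensorNetwork V E B) (A : Finset B) {p : ℕ} (hp : 0 < p) :
    ∑ Γ ∈ N.boundaryComponent.powerset, ((p : ℝ) ^ (N.surface A Γ).card)⁻¹ ≤
      (N.numMinimal A + 2 ^ Fintype.card V / p) * ((p : ℝ) ^ N.minCut A)⁻¹ := by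
  have hp0 : (0 : ℝ) < p := Nat.cast_pos.2 hp
  have hp1 : (1 : ℝ) ≤ p := Nat.one_le_cast.2 hp
  have hmin : ∀ γ ∈ N.surfaces A, N.minCut A ≤ γ.card := by
    intro γ hγ
    obtain ⟨Γ, -, rfl⟩ := Finset.mem_image.1 hγ
    exact N.minCut_le A Γ
  calc _ = ∑ γ ∈ N.boundaryComponent.powerset.image (N.surface A), ((p : ℝ) ^ γ.card)⁻¹ :=
        (Finset.sum_image (N.injOn_surface A)).symm
    _ ≤ ∑ γ ∈ N.surfaces A, ((p : ℝ) ^ γ.card)⁻¹ :=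
        Finset.sum_le_sum_of_subset_of_nonneg (Finset.image_subset_image (Finset.subset_univ _))
          fun _ _ _ => by positivity
    _ = ∑ γ ∈ (N.surfaces A).filter (fun γ => γ.card = N.minCut A), ((p : ℝ) ^ γ.card)⁻¹ +
        ∑ γ ∈ (N.surfaces A).filter (fun γ => ¬ γ.card = N.minCut A), ((p : ℝ) ^ γ.card)⁻¹ :=
        (Finset.sum_filter_add_sum_filter_not _ _ _).symm
    _ ≤ N.numMinimal A * ((p : ℝ) ^ N.minCut A)⁻¹ +
        2 ^ Fintype.card V * ((p : ℝ) ^ (N.minCut A + 1))⁻¹ := by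
        refine add_le_add (le_of_eq ?_) ?_
        · rw [Finset.sum_congr rfl fun γ hγ => by rw [(Finset.mem_filter.1 hγ).2],
            Finset.sum_const, nsmul_eq_mul]
          rfl
        -- A nonminimal surface has at least one extra leg, and there are at most $2^{|V|}$
        -- surfaces.
        · have hle : ∀ γ ∈ (N.surfaces A).filter (fun γ => ¬ γ.card = N.minCut A),
              ((p : ℝ) ^ γ.card)⁻¹ ≤ ((p : ℝ) ^ (N.minCut A + 1))⁻¹ := by
            intro γ hγ
            obtain ⟨h1, h2⟩ := Finset.mem_filter.1 hγ
            have h3 := hmin γ h1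
            gcongr
            omega
          refine (Finset.sum_le_sum hle).trans ?_
          rw [Finset.sum_const, nsmul_eq_mul]
          gcongr
          exact_mod_cast (Finset.card_le_card (Finset.filter_subset _ _)).trans
            (N.card_surfaces_le A)
    _ = _ := by
        rw [pow_succ]
        field_simp

end TensorNetwork

/-! ### Moments of the boundary state -/

namespace TensorNetwork

open Matrix ZMod

variable {V E B : Type*} [Fintype V] [DecidableEq V] [Fintype E] [DecidableEq E]
  [Fintype B] [DecidableEq B]

variable {p : ℕ} [NeZero p] {N : TensorNetwork V E B}

/-- The tensors `T` inside a set `W` and `τ` outside of it. -/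
def mixChoice (W : Finset V) (T τ : N.Choice p) : N.Choice p := fun v => if v ∈ W then T v else τ v

omit [Fintype V] in
lemma partialMatrices_mixChoice (W : Finset V) (T τ : N.Choice p) :
    N.partialMatrices W (mixChoice W T τ) = N.partialMatrices W T := by
  ext v : 1
  simp only [partialMatrices, mixMatrices, mixChoice]
  split_ifs <;> rfl

/-- The maximally mixed state inside a set `W`, and the tensors of a choice outside of it. -/
def exteriorMatrices (W : Finset V) (T : N.Choice p) : N.LegMatrices p :=
  N.mixMatrices W N.mixedMatrices fun v => (T v).1

omit [Fintype V] in
lemma exteriorMatrices_congr {W : Finset V} {T T' : N.Choice p} (h : ∀ v ∉ W, T v = T' v) :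
    N.exteriorMatrices W T = N.exteriorMatrices W T' := by
  ext v : 1
  simp only [exteriorMatrices, mixMatrices]
  split_ifs with hv
  · rfl
  · rw [h v hv]

omit [Fintype V] in
lemma exteriorMatrices_mixChoice (W : Finset V) (T τ : N.Choice p) :
    N.exteriorMatrices W (mixChoice W T τ) = N.exteriorMatrices W τ :=
  exteriorMatrices_congr fun _ hv => if_neg hv

lemma trace_contraction_mixedMatrices_ne_zero {φ : V → ZMod p → ℂ}
    (hφ : ∀ v, ∑ i, ‖φ v i‖ ^ 2 = 1) : (N.contraction φ N.mixedMatrices).trace ≠ 0 := by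
  rw [trace_contraction_mixedMatrices _ hφ]
  exact mul_ne_zero (Finset.prod_ne_zero_iff.2 fun v _ => inv_ne_zero (N.tensorDim_ne_zero v))
    (pow_ne_zero _ (NeZero.ne _))

/-- The exchange identity against the fully mixed network, traced over the second copy: the tensors
outside `W` enter only through a scalar. -/
lemma rawState_mul_trace (φ : V → ZMod p → ℂ) {W : Finset V} (hW : N.IsClosed W)
    (T : N.Choice p) (b b' : QuditBasis p B) :
    N.rawState (fun i => ∏ v, φ v (i v)) T b b' * (N.contraction φ N.mixedMatrices).trace =
      N.contraction φ (N.partialMatrices W T) b b' *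
        (N.contraction φ (N.exteriorMatrices W T)).trace := by
  simp only [rawState_eq_contraction, trace, diag, Finset.mul_sum]
  exact Finset.sum_congr rfl fun c _ => N.contraction_exchange φ hW _ _ b b' c c

lemma sum_trace_contraction [Fact p.Prime] (φ : V → ZMod p → ℂ) (W : Finset V) :
    ∑ T : N.Choice p, (N.contraction φ (N.partialMatrices W T)).trace =
      Fintype.card (N.Choice p) * (N.contraction φ N.mixedMatrices).trace := by
  simp only [trace, diag]
  rw [Finset.sum_comm, Finset.mul_sum]
  exact Finset.sum_congr rfl fun b _ => N.sum_contraction φ W b b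

/-- The mean of the trace is the trace of the mixed network, which is nonzero. Hence the
conditioning event is nonempty. -/
lemma exists_rawState_ne_zero [Fact p.Prime] {φ : V → ZMod p → ℂ}
    (hφ : ∀ v, ∑ i, ‖φ v i‖ ^ 2 = 1) :
    ∃ T : N.Choice p, N.rawState (fun i => ∏ v, φ v (i v)) T ≠ 0 := by
  by_contra! h
  have h1 := sum_trace_contraction (N := N) φ Finset.univ
  have h2 : ∀ T : N.Choice p, (N.contraction φ (N.partialMatrices Finset.univ T)).trace = 0 := by
    intro T
    have : N.partialMatrices Finset.univ T = fun v => (T v).1 := by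
      ext v : 1
      exact if_pos (Finset.mem_univ v)
    rw [this, ← rawState_eq_contraction, h, trace_zero]
  simp only [h2, Finset.sum_const_zero] at h1
  exact mul_ne_zero (Nat.cast_ne_zero.2 Fintype.card_ne_zero)
    (trace_contraction_mixedMatrices_ne_zero hφ) h1.symm

/-- Up to a scalar the boundary state depends only on the tensors of a closed set. -/
lemma exists_rawState_eq_smul {φ : V → ZMod p → ℂ} (hφ : ∀ v, ∑ i, ‖φ v i‖ ^ 2 = 1)
    {W : Finset V} (hW : N.IsClosed W) {τ : N.Choice p}
    (hτ : N.rawState (fun i => ∏ v, φ v (i v)) τ ≠ 0) :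
    ∃ c : N.Choice p → ℂ, (∀ T T', (∀ v ∉ W, T v = T' v) → c T = c T') ∧
      ∀ T, N.rawState (fun i => ∏ v, φ v (i v)) T =
        c T • N.rawState (fun i => ∏ v, φ v (i v)) (mixChoice W T τ) := by
  have h0 := trace_contraction_mixedMatrices_ne_zero (N := N) hφ
  have hz : (N.contraction φ (N.exteriorMatrices W τ)).trace ≠ 0 := by
    intro hz
    refine hτ ?_
    ext b b'
    have := rawState_mul_trace φ hW τ b b'
    rw [hz, mul_zero] at this
    exact (mul_eq_zero.1 this).resolve_right h0
  refine ⟨fun T => (N.contraction φ (N.exteriorMatrices W T)).trace /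
    (N.contraction φ (N.exteriorMatrices W τ)).trace, fun T T' h => ?_, fun T => ?_⟩
  · simp only [exteriorMatrices_congr h]
  · ext b b'
    have h1 := rawState_mul_trace φ hW T b b'
    have h2 := rawState_mul_trace φ hW (mixChoice W T τ) b b'
    rw [partialMatrices_mixChoice, exteriorMatrices_mixChoice] at h2
    rw [Matrix.smul_apply, smul_eq_mul, div_mul_eq_mul_div, eq_div_iff hz]
    refine mul_right_cancel₀ h0 ?_
    linear_combination (N.contraction φ (N.exteriorMatrices W τ)).trace * h1 -
      (N.contraction φ (N.exteriorMatrices W T)).trace * h2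

omit [DecidableEq E] [DecidableEq B] in
-- From $D(D+1)\ge D^2$ at each random tensor; this turns the exact second moment into a bound by
-- the squared mean.
lemma exists_prod_momentConst_eq (W : Finset V) : ∃ r : ℝ, ∏ v, N.momentConst p W v = r ∧
    r ≤ (∏ v, ((p : ℝ) ^ Fintype.card (N.Leg v))⁻¹) ^ 2 := by
  refine ⟨∏ v, if v ∈ W then ((p : ℝ) ^ Fintype.card (N.Leg v) *
    ((p : ℝ) ^ Fintype.card (N.Leg v) + 1))⁻¹ else (((p : ℝ) ^ Fintype.card (N.Leg v))⁻¹) ^ 2,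
    ?_, ?_⟩
  · rw [Complex.ofReal_prod]
    refine Finset.prod_congr rfl fun v _ => ?_
    rw [momentConst, tensorDim]
    split_ifs <;> push_cast <;> rfl
  · rw [← Finset.prod_pow]
    have hp : (0 : ℝ) < p := Nat.cast_pos.2 (NeZero.pos p)
    refine Finset.prod_le_prod (fun v _ => by split_ifs <;> positivity) fun v _ => ?_
    split_ifs
    · rw [inv_pow, sq]
      gcongr
      linarith
    · rfl

/-- Makes the second moment of the norm the case $A=\emptyset$ of the purity bound. -/
lemma rawPurity_empty (Φ : QuditBasis p V → ℂ) (T : N.Choice p) :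
    N.rawPurity Φ ∅ T = N.normSq Φ T ^ 2 := by
  have h : (N.rawPurity Φ ∅ T : ℂ) = (N.normSq Φ T : ℂ) ^ 2 := by
    rw [← trace_reducedState_rawState_mul_self, trace_reducedState_mul_self, ← trace_rawState,
      sq, trace, Finset.sum_mul_sum]
    rfl
  exact_mod_cast h

/-- The first and second moments of the boundary state when the tensors of a closed set are
random. -/
lemma exists_moments [Fact p.Prime] {φ : V → ZMod p → ℂ} (hφ : ∀ v, ∑ i, ‖φ v i‖ ^ 2 = 1)
    {W : Finset V} (hW : N.IsClosed W) {τ : N.Choice p}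
    (hτ : N.rawState (fun i => ∏ v, φ v (i v)) τ ≠ 0) :
    ∃ m : ℝ, 0 < m ∧
      ∑ T, N.normSq (fun i => ∏ v, φ v (i v)) (mixChoice W T τ) =
        Fintype.card (N.Choice p) * m ∧
      ∀ A, ∑ T, N.rawPurity (fun i => ∏ v, φ v (i v)) A (mixChoice W T τ) ≤
        Fintype.card (N.Choice p) * m ^ 2 *
          ∑ Γ ∈ W.powerset, ((p : ℝ) ^ (N.surface A Γ).card)⁻¹ := by
  set Φ : QuditBasis p V → ℂ := fun i => ∏ v, φ v (i v) with hΦ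
  set n := Fintype.card (N.Choice p) with hn
  have hn0 : n ≠ 0 := Fintype.card_ne_zero
  set I := (N.contraction φ N.mixedMatrices).trace with hI
  have hI0 : I ≠ 0 := trace_contraction_mixedMatrices_ne_zero hφ
  set z := (N.contraction φ (N.exteriorMatrices W τ)).trace with hzdef
  have hz : z ≠ 0 := by
    intro hz
    refine hτ ?_
    ext b b'
    have := rawState_mul_trace φ hW τ b b'
    rw [← hzdef, hz, mul_zero] at this
    exact (mul_eq_zero.1 this).resolve_right hI0
  have hraw : ∀ T b b', N.rawState Φ (mixChoice W T τ) b b' * I =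
      N.contraction φ (N.partialMatrices W T) b b' * z := by
    intro T b b'
    have h2 := rawState_mul_trace φ hW (mixChoice W T τ) b b'
    rwa [partialMatrices_mixChoice, exteriorMatrices_mixChoice] at h2
  set m : ℝ := (∑ T, N.normSq Φ (mixChoice W T τ)) / n with hm
  have hmn : ∑ T, N.normSq Φ (mixChoice W T τ) = n * m := by
    rw [hm]; field_simp
  -- The average over `W` replaces its tensors by mixed states, so the mean norm is the scalar of
  -- the fixed exterior tensors.
  have hmz : (m : ℂ) = z := by
    have h1 : ((∑ T, N.normSq Φ (mixChoice W T τ) : ℝ) : ℂ) * I = n * z * I := by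
      have : ∀ T, (N.rawState Φ (mixChoice W T τ)).trace * I =
          (N.contraction φ (N.partialMatrices W T)).trace * z := by
        intro T
        simp only [trace, diag, Finset.sum_mul, hraw]
      rw [Complex.ofReal_sum, Finset.sum_mul]
      simp only [← trace_rawState, this]
      rw [← Finset.sum_mul, sum_trace_contraction]
      ring
    have h2 := mul_right_cancel₀ hI0 h1
    rw [hm, Complex.ofReal_div, h2]
    push_cast
    field_simp
  have hm0 : 0 < m := by
    refine lt_of_le_of_ne (div_nonneg (Finset.sum_nonneg fun T _ => normSq_nonneg Φ _)
      (Nat.cast_nonneg _)) fun h => hz ?_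
    rw [← hmz, ← h, Complex.ofReal_zero]
  refine ⟨m, hm0, hmn, fun A => ?_⟩
  obtain ⟨r, hr, hr2⟩ := N.exists_prod_momentConst_eq (p := p) W
  have hp : (0 : ℝ) < p := Nat.cast_pos.2 (NeZero.pos p)
  set d : ℝ := ∏ v, ((p : ℝ) ^ Fintype.card (N.Leg v))⁻¹ with hd
  have hd0 : 0 < d := Finset.prod_pos fun v _ => by positivity
  set P : ℝ := (p : ℝ) ^ (Fintype.card E + Fintype.card B) with hP
  have hP0 : 0 < P := by positivity
  have hId : I = ((d * P : ℝ) : ℂ) := by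
    rw [hI, trace_contraction_mixedMatrices _ hφ, hd, hP]
    push_cast
    rfl
  have hsw : ∀ Γ, ∑ b, ∑ c, N.swapTerm φ Γ b (mixLegs A c b) c (mixLegs A b c) =
      ((P ^ 2 * ((p : ℝ) ^ (N.surface A Γ).card)⁻¹ : ℝ) : ℂ) := by
    intro Γ
    have h := N.sum_swapTerm hφ A Γ
    have hpc : (p : ℂ) ^ (N.surface A Γ).card ≠ 0 := pow_ne_zero _ (NeZero.ne _)
    rw [eq_comm, ← div_eq_iff hpc] at h
    rw [← h, hP]
    push_cast
    rw [← pow_mul, mul_comm 2, div_eq_mul_inv]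
  -- The exact second moment. Multiplying by $(dP)^2=I^2$ clears the denominators in `hraw`, and
  -- both copies carry the exterior scalar, whence $m^2$.
  have key : (∑ T, N.rawPurity Φ A (mixChoice W T τ)) * (d * P) ^ 2 =
      m ^ 2 * (n * (r * ∑ Γ ∈ W.powerset, P ^ 2 * ((p : ℝ) ^ (N.surface A Γ).card)⁻¹)) := by
    have hc : (((∑ T, N.rawPurity Φ A (mixChoice W T τ)) * (d * P) ^ 2 : ℝ) : ℂ) =
        ((m ^ 2 * (n * (r * ∑ Γ ∈ W.powerset,
          P ^ 2 * ((p : ℝ) ^ (N.surface A Γ).card)⁻¹)) : ℝ) : ℂ) := by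
      rw [Complex.ofReal_mul, Complex.ofReal_pow, ← hId, Complex.ofReal_sum, Finset.sum_mul]
      have hT : ∀ T, (N.rawPurity Φ A (mixChoice W T τ) : ℂ) * I ^ 2 = z ^ 2 * ∑ b, ∑ c,
          N.contraction φ (N.partialMatrices W T) b (mixLegs A c b) *
            N.contraction φ (N.partialMatrices W T) c (mixLegs A b c) := by
        intro T
        rw [← trace_reducedState_rawState_mul_self, trace_reducedState_mul_self]
        simp only [Finset.sum_mul, Finset.mul_sum]
        refine Finset.sum_congr rfl fun b _ => Finset.sum_congr rfl fun c _ => ?_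
        linear_combination (N.rawState Φ (mixChoice W T τ) c (mixLegs A b c) * I) *
          hraw T b (mixLegs A c b) + (N.contraction φ (N.partialMatrices W T) b (mixLegs A c b) * z)
            * hraw T c (mixLegs A b c)
      rw [Finset.sum_congr rfl fun T _ => hT T, ← Finset.mul_sum, Finset.sum_comm]
      have hb : ∀ b : QuditBasis p B, ∑ T : N.Choice p, ∑ c,
          N.contraction φ (N.partialMatrices W T) b (mixLegs A c b) *
            N.contraction φ (N.partialMatrices W T) c (mixLegs A b c) =
          n * (r * ∑ Γ ∈ W.powerset, ∑ c, N.swapTerm φ Γ b (mixLegs A c b) c (mixLegs A b c)) := by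
        intro b
        rw [Finset.sum_comm, Finset.sum_comm (s := W.powerset), Finset.mul_sum, Finset.mul_sum]
        refine Finset.sum_congr rfl fun c _ => ?_
        rw [sum_contraction_mul_contraction, hr]
      simp only [hb, ← Finset.mul_sum]
      rw [Finset.sum_comm, Finset.sum_congr rfl fun Γ _ => hsw Γ, ← hmz]
      push_cast
      simp only [Finset.mul_sum]
    exact_mod_cast hc
  rw [← Finset.mul_sum] at key
  set s := ∑ Γ ∈ W.powerset, ((p : ℝ) ^ (N.surface A Γ).card)⁻¹ with hs
  have hs0 : 0 ≤ s := Finset.sum_nonneg fun Γ _ => by positivity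
  have hdP : (0 : ℝ) < (d * P) ^ 2 := by positivity
  refine le_of_mul_le_mul_right ?_ hdP
  rw [key]
  calc m ^ 2 * (n * (r * (P ^ 2 * s))) = r * (m ^ 2 * n * P ^ 2 * s) := by ring
    _ ≤ d ^ 2 * (m ^ 2 * n * P ^ 2 * s) := mul_le_mul_of_nonneg_right hr2
        (mul_nonneg (mul_nonneg (mul_nonneg (sq_nonneg m) (Nat.cast_nonneg n)) (sq_nonneg P)) hs0)
    _ = n * m ^ 2 * s * (d * P) ^ 2 := by ring

end TensorNetwork

/-! ### From moments to the mean entropy deficit -/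

/-- A bound on the mean of a function that is dominated by `log (y / w ^ 2)`, where `w` is
concentrated near `1` and the mean of `y` is close to `k`. -/
lemma sum_le_of_le_log_div {Ω : Type*} [Fintype Ω] (w y X : Ω → ℝ) {k L θ η β : ℝ}
    (hk : 1 ≤ k) (hL : 0 ≤ L) (hη : 0 < η) (hη1 : η < 1) (hβ : β ≤ 1 / 2) (hθ : 0 ≤ θ)
    (hθβ : θ ≤ β * η ^ 2)
    (hy0 : ∀ T, 0 ≤ y T) (hy : ∀ T, w T ≠ 0 → 0 < y T)
    (hXL : ∀ T, w T ≠ 0 → X T ≤ L) (hX : ∀ T, w T ≠ 0 → X T ≤ Real.log (y T / w T ^ 2))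
    (hw1 : ∑ T, w T = Fintype.card Ω) (hw2 : ∑ T, w T ^ 2 ≤ Fintype.card Ω * (1 + θ))
    (hys : ∑ T, y T ≤ Fintype.card Ω * (k + θ)) :
    ∑ T with w T ≠ 0, X T ≤ (Finset.univ.filter fun T => w T ≠ 0).card *
      (Real.log k + 2 * (-1 + β + (1 + θ) / (1 - η) ^ 2 + β * L)) := by
  classical
  set n : ℝ := (Fintype.card Ω : ℝ) with hn
  have hn0 : 0 ≤ n := Nat.cast_nonneg _
  have hη2 : 0 < 1 - η := sub_pos.2 hη1
  have hk0 : 0 < k := one_pos.trans_le hk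
  have hlogk : 0 ≤ Real.log k := Real.log_nonneg hk
  have hβ0 : 0 ≤ β := by
    by_contra! h
    nlinarith [mul_pos_of_neg_of_neg h (neg_neg_of_pos (pow_pos hη 2))]
  set S := Finset.univ.filter fun T => w T ≠ 0 with hS
  set G := Finset.univ.filter fun T => 1 - η ≤ w T with hG
  have hGS : G ⊆ S := fun T hT => Finset.mem_filter.2
    ⟨Finset.mem_univ _, (hη2.trans_le (Finset.mem_filter.1 hT).2).ne'⟩
  -- Chebyshev: the mean of $(w-1)^2$ is at most $\theta\le\beta\eta^2$.
  have hbad : (Gᶜ.card : ℝ) ≤ n * β := by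
    have h1 : ∑ T ∈ Gᶜ, η ^ 2 ≤ ∑ T, (w T - 1) ^ 2 := by
      refine (Finset.sum_le_sum fun T hT => ?_).trans
        (Finset.sum_le_sum_of_subset_of_nonneg (Finset.subset_univ Gᶜ) fun _ _ _ => sq_nonneg _)
      have h2 : w T < 1 - η := by
        by_contra! h
        exact Finset.mem_compl.1 hT (Finset.mem_filter.2 ⟨Finset.mem_univ _, h⟩)
      nlinarith
    have h2 : ∑ T, (w T - 1) ^ 2 = ∑ T, w T ^ 2 - n := by
      have : ∀ T, (w T - 1) ^ 2 = w T ^ 2 - 2 * w T + 1 := fun T => by ring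
      simp only [this, Finset.sum_add_distrib, Finset.sum_sub_distrib, ← Finset.mul_sum, hw1,
        Finset.sum_const, Finset.card_univ, nsmul_eq_mul, mul_one, ← hn]
      ring
    rw [Finset.sum_const, nsmul_eq_mul, h2] at h1
    have h3 : (Gᶜ.card : ℝ) * η ^ 2 ≤ (n * β) * η ^ 2 := by nlinarith
    exact le_of_mul_le_mul_right h3 (pow_pos hη 2)
  have hcard : (G.card : ℝ) + Gᶜ.card = n := by
    rw [hn, ← Finset.card_add_card_compl G]
    push_cast
    rfl
  have hGScard : (G.card : ℝ) ≤ S.card := Nat.cast_le.2 (Finset.card_le_card hGS)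
  -- Here $w\ge1-\eta$ bounds the denominator, and $\ln x\le x-1$ at $x=y/(k(1-\eta)^2)$ linearises
  -- the logarithm, so the mean of $y$ suffices.
  have hgood : ∑ T ∈ G, X T ≤ G.card * (Real.log k - 1) + n * ((1 + θ) / (1 - η) ^ 2) := by
    have h1 : ∀ T ∈ G, X T ≤ Real.log k - 1 + y T * (k * (1 - η) ^ 2)⁻¹ := by
      intro T hT
      have hwT := (Finset.mem_filter.1 hT).2
      have hwT0 : 0 < w T := hη2.trans_le hwT
      have hyT := hy T hwT0.ne'
      refine (hX T hwT0.ne').trans ?_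
      have h2 : Real.log (y T / w T ^ 2) ≤ Real.log (y T / (1 - η) ^ 2) :=
        Real.log_le_log (by positivity) (by gcongr)
      have h3 : y T / (1 - η) ^ 2 = k * (y T * (k * (1 - η) ^ 2)⁻¹) := by field_simp
      have h4 : 0 < y T * (k * (1 - η) ^ 2)⁻¹ := by positivity
      rw [h3, Real.log_mul hk0.ne' h4.ne'] at h2
      linarith [Real.log_le_sub_one_of_pos h4]
    refine (Finset.sum_le_sum h1).trans ?_
    rw [Finset.sum_add_distrib, Finset.sum_const, nsmul_eq_mul, ← Finset.sum_mul]
    refine add_le_add le_rfl ?_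
    have h2 : ∑ T ∈ G, y T ≤ n * (k * (1 + θ)) :=
      (Finset.sum_le_sum_of_subset_of_nonneg (Finset.subset_univ G) fun T _ _ => hy0 T).trans
        (hys.trans (by gcongr; nlinarith))
    calc _ ≤ n * (k * (1 + θ)) * (k * (1 - η) ^ 2)⁻¹ := by gcongr
      _ = _ := by field_simp
  -- On the exceptional set only the trivial bound `L` is available.
  have hrest : ∑ T ∈ S \ G, X T ≤ n * β * L := by
    have h1 : ∀ T ∈ S \ G, X T ≤ L := fun T hT =>
      hXL T (Finset.mem_filter.1 (Finset.mem_sdiff.1 hT).1).2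
    refine (Finset.sum_le_sum h1).trans ?_
    rw [Finset.sum_const, nsmul_eq_mul]
    refine mul_le_mul_of_nonneg_right (le_trans ?_ hbad) hL
    refine Nat.cast_le.2 (Finset.card_le_card fun T hT => ?_)
    exact Finset.mem_compl.2 (Finset.mem_sdiff.1 hT).2
  set r := -1 + β + (1 + θ) / (1 - η) ^ 2 + β * L with hr
  have hr0 : 0 ≤ r := by
    have h1 : 1 ≤ (1 + θ) / (1 - η) ^ 2 := by
      rw [le_div_iff₀ (by positivity)]
      nlinarith
    have := mul_nonneg hβ0 hL
    linarith
  -- As $\beta\le1/2$, at least half of all choices satisfy $w\ne0$; this is the factor $2$ lost by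
  -- conditioning.
  have hnS : n ≤ 2 * S.card := by nlinarith
  rw [← Finset.sum_sdiff hGS]
  calc _ ≤ n * β * L + (G.card * (Real.log k - 1) + n * ((1 + θ) / (1 - η) ^ 2)) :=
        add_le_add hrest hgood
    _ ≤ S.card * Real.log k + n * r := by
        have h1 : (G.card : ℝ) * Real.log k ≤ S.card * Real.log k := by gcongr
        have h2 : n * (1 - β) ≤ G.card := by linarith
        rw [hr]
        nlinarith
    _ ≤ S.card * Real.log k + 2 * S.card * r := by gcongr
    _ = _ := by ring

/-- Exchanging the components in `W` of two families shows that functions of the components inside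
and outside of `W` are independent. -/
lemma sum_mul_sum_of_complementary {V : Type*} {κ : V → Type*} [Fintype (∀ v, κ v)]
    [DecidableEq V] (W : Finset V) (f g : (∀ v, κ v) → ℝ)
    (hf : ∀ T T', (∀ v ∉ W, T v = T' v) → f T = f T')
    (hg : ∀ T T', (∀ v ∈ W, T v = T' v) → g T = g T') :
    (∑ T, f T) * ∑ T, g T = Fintype.card (∀ v, κ v) * ∑ T, f T * g T := by
  let s : (∀ v, κ v) × (∀ v, κ v) → (∀ v, κ v) × (∀ v, κ v) := fun q =>
    (fun v => if v ∈ W then q.2 v else q.1 v, fun v => if v ∈ W then q.1 v else q.2 v)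
  have hs : Function.Involutive s := by
    intro q
    refine Prod.ext (funext fun v => ?_) (funext fun v => ?_) <;> simp only [s] <;>
      split_ifs <;> rfl
  calc (∑ T, f T) * ∑ T, g T = ∑ q : (∀ v, κ v) × (∀ v, κ v), f q.1 * g q.2 := by
        rw [Finset.sum_mul_sum, Fintype.sum_prod_type]
    _ = ∑ q : (∀ v, κ v) × (∀ v, κ v), f q.1 * g q.1 := by
        rw [← Equiv.sum_comp (Function.Involutive.toPerm s hs)]
        refine Finset.sum_congr rfl fun q _ => ?_
        rw [Function.Involutive.coe_toPerm]
        congr 1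
        · exact hf _ _ fun v hv => if_neg hv
        · exact hg _ _ fun v hv => if_pos hv
    _ = _ := by
        rw [Fintype.sum_prod_type, Finset.mul_sum]
        simp only [Finset.sum_const, Finset.card_univ, nsmul_eq_mul]

/-! ### The error term $o(1)$ -/

namespace TensorNetwork

open Matrix ZMod

variable {V E B : Type*} [Fintype V] [DecidableEq V] [Fintype E] [DecidableEq E]
  [Fintype B] [DecidableEq B]

variable {p : ℕ} [NeZero p] {N : TensorNetwork V E B}

lemma entropy_eq_of_rawState_eq_smul {Φ : QuditBasis p V → ℂ} {T T' : N.Choice p} {c : ℂ}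
    (hc : c ≠ 0) (h : N.rawState Φ T = c • N.rawState Φ T') (A : Finset B) :
    N.entropy Φ A T = N.entropy Φ A T' := by
  have : N.boundaryState Φ T = N.boundaryState Φ T' := by
    rw [boundaryState, boundaryState, h, trace_smul, smul_smul, smul_eq_mul, _root_.mul_inv_rev, mul_assoc,
      inv_mul_cancel₀ hc, mul_one]
  rw [entropy, entropy, this]

/-- The error term of the entropy formula. -/
def entropyError (_N : TensorNetwork V E B) (p : ℕ) : ℝ :=
  -- The parameters of `sum_le_of_le_log_div` are $\eta=p^{-1/4}$, $\beta=2^{|V|}p^{-1/2}$,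
  -- $\theta=2^{|V|}/p=\beta\eta^2$ and $L=(|E|+|\mathcal B|)\ln p$. For the finitely many small
  -- positive $p$ where they are inadmissible, the trivial bound `L` plus one is used.
  if √√(p : ℝ)⁻¹ < 1 ∧ 2 ^ Fintype.card V * √(p : ℝ)⁻¹ ≤ 1 / 2 then
    2 * (-1 + 2 ^ Fintype.card V * √(p : ℝ)⁻¹ +
      (1 + 2 ^ Fintype.card V / p) / (1 - √√(p : ℝ)⁻¹) ^ 2 + 2 ^ Fintype.card V * √(p : ℝ)⁻¹ *
        ((Fintype.card E + Fintype.card B) * Real.log p))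
  else (Fintype.card E + Fintype.card B) * Real.log p + 1

omit [DecidableEq V] [DecidableEq E] [DecidableEq B] in
-- The trivial bound grows like $\ln p$, but enters with the weight $p^{-1/2}$ of the exceptional
-- set.
lemma tendsto_entropyError (N : TensorNetwork V E B) :
    Tendsto N.entropyError atTop (𝓝 0) := by
  have h1 : Tendsto (fun p : ℕ => √(p : ℝ)⁻¹) atTop (𝓝 0) := by
    have := (Real.continuous_sqrt.tendsto 0).comp
      (tendsto_inv_atTop_zero.comp (tendsto_natCast_atTop_atTop (R := ℝ)))
    rwa [Real.sqrt_zero] at this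
  have h2 : Tendsto (fun p : ℕ => √√(p : ℝ)⁻¹) atTop (𝓝 0) := by
    have := (Real.continuous_sqrt.tendsto 0).comp h1
    rwa [Real.sqrt_zero] at this
  have h3 : Tendsto (fun p : ℕ => √(p : ℝ)⁻¹ * Real.log p) atTop (𝓝 0) := by
    have h := ((isLittleO_log_rpow_atTop (r := 1 / 2) (by norm_num)).tendsto_div_nhds_zero).comp
      (tendsto_natCast_atTop_atTop (R := ℝ))
    refine h.congr fun p => ?_
    rw [Function.comp_apply, ← Real.sqrt_eq_rpow, Real.sqrt_inv, div_eq_inv_mul]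
  have h4 : Tendsto (fun p : ℕ => (2 : ℝ) ^ Fintype.card V / p) atTop (𝓝 0) :=
    tendsto_const_nhds.div_atTop tendsto_natCast_atTop_atTop
  have h5 : Tendsto (fun p : ℕ => 2 * (-1 + 2 ^ Fintype.card V * √(p : ℝ)⁻¹ +
      (1 + 2 ^ Fintype.card V / p) / (1 - √√(p : ℝ)⁻¹) ^ 2 + 2 ^ Fintype.card V *
        (Fintype.card E + Fintype.card B) * (√(p : ℝ)⁻¹ * Real.log p))) atTop
      (𝓝 ((2 : ℝ) * (-1 + 2 ^ Fintype.card V * 0 + (1 + 0) / (1 - 0) ^ 2 + 2 ^ Fintype.card V *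
        (Fintype.card E + Fintype.card B) * 0))) := by
    refine ((((tendsto_const_nhds.add (h1.const_mul _)).add
      ((tendsto_const_nhds.add h4).div ((tendsto_const_nhds.sub h2).pow 2) (by norm_num))).add
      (h3.const_mul _)).const_mul 2)
  have h6 : (2 : ℝ) * (-1 + 2 ^ Fintype.card V * 0 + (1 + 0) / (1 - 0) ^ 2 + 2 ^ Fintype.card V *
        (Fintype.card E + Fintype.card B) * 0) = 0 := by norm_num
  rw [h6] at h5
  refine h5.congr' ?_
  have h7 : ∀ᶠ p : ℕ in atTop, √√(p : ℝ)⁻¹ < 1 := h2.eventually_lt_const one_pos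
  have h8 : ∀ᶠ p : ℕ in atTop, 2 ^ Fintype.card V * √(p : ℝ)⁻¹ ≤ 1 / 2 := by
    have := h1.const_mul ((2 : ℝ) ^ Fintype.card V)
    rw [mul_zero] at this
    exact this.eventually_le_const (by norm_num)
  filter_upwards [h7, h8] with p hp7 hp8
  rw [entropyError, if_pos ⟨hp7, hp8⟩]
  ring

omit [DecidableEq V] [DecidableEq E] [DecidableEq B] in
-- Strict positivity keeps the Markov threshold positive when $k=1$, where $\ln k=0$.
lemma entropyError_pos (N : TensorNetwork V E B) {p : ℕ} (hp : 0 < p) : 0 < N.entropyError p := by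
  have hp1 : (1 : ℝ) ≤ p := Nat.one_le_cast.2 hp
  have hlog : 0 ≤ Real.log p := Real.log_nonneg hp1
  rw [entropyError]
  split_ifs with h
  · have h0 : 0 ≤ √√(p : ℝ)⁻¹ := Real.sqrt_nonneg _
    have h1 : 1 < (1 + 2 ^ Fintype.card V / (p : ℝ)) / (1 - √√(p : ℝ)⁻¹) ^ 2 := by
      have h2 : 0 < 1 - √√(p : ℝ)⁻¹ := sub_pos.2 h.1
      have h3 : 0 < 2 ^ Fintype.card V / (p : ℝ) := by positivity
      rw [lt_div_iff₀ (by positivity)]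
      nlinarith
    have h2 : 0 ≤ 2 ^ Fintype.card V * √(p : ℝ)⁻¹ *
        ((Fintype.card E + Fintype.card B) * Real.log p) := by positivity
    have h3 : 0 ≤ 2 ^ Fintype.card V * √(p : ℝ)⁻¹ := by positivity
    linarith
  · positivity

end TensorNetwork

/-- Markov's inequality for the uniform distribution on a finite set. -/
lemma uniformOn_real_le_of_sum_le {Ω : Type*} [MeasurableSpace Ω] [MeasurableSingletonClass Ω]
    {S : Finset Ω} (hS : S.Nonempty) {X : Ω → ℝ} (hX : ∀ T ∈ S, 0 ≤ X T) {μ a : ℝ} (hμ : 0 < μ)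
    (ha : 0 < a) (h : ∑ T ∈ S, X T ≤ S.card * μ) :
    (uniformOn (S : Set Ω)).real {T | X T ≥ a * μ} ≤ 1 / a := by
  classical
  have hS0 : (0 : ℝ) < S.card := Nat.cast_pos.2 (Finset.card_pos.2 hS)
  have h1 : (S : Set Ω) ∩ {T | X T ≥ a * μ} = (S.filter fun T => X T ≥ a * μ : Finset Ω) := by
    ext T
    simp
  have h2 : ((S.filter fun T => X T ≥ a * μ).card : ℝ) * (a * μ) ≤ S.card * μ := by
    refine le_trans ?_ h
    rw [← nsmul_eq_mul, ← Finset.sum_const]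
    refine (Finset.sum_le_sum fun T hT => (Finset.mem_filter.1 hT).2).trans ?_
    exact Finset.sum_le_sum_of_subset_of_nonneg (Finset.filter_subset _ _) fun T hT _ => hX T hT
  rw [measureReal_def, uniformOn, cond_apply S.measurableSet, h1, Measure.count_apply_finset,
    Measure.count_apply_finset, ENNReal.toReal_mul, ENNReal.toReal_inv, ENNReal.toReal_natCast,
    ENNReal.toReal_natCast, inv_mul_le_iff₀ hS0, mul_one_div, le_div_iff₀ ha]
  refine le_of_mul_le_mul_right ?_ hμ
  rwa [mul_assoc]

/-! ### The mean deficit and its tail bounds -/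

namespace TensorNetwork

open Matrix ZMod

variable {V E B : Type*} [Fintype V] [DecidableEq V] [Fintype E] [DecidableEq E]
  [Fintype B] [DecidableEq B]

variable {p : ℕ} [NeZero p] {N : TensorNetwork V E B}

omit [Fintype V] [DecidableEq E] in
omit [NeZero p] in
lemma entropyRT_le (A : Finset B) :
    N.entropyRT p A ≤ (Fintype.card E + Fintype.card B) * Real.log p := by
  refine mul_le_mul_of_nonneg_right ?_ (Real.log_natCast_nonneg p)
  exact_mod_cast N.minCut_le_card A

/-- The logarithmic domination required by `sum_le_of_le_log_div`, from the bound of the entropy by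
the purity. -/
lemma entropyRT_sub_entropy_le_log {Φ : QuditBasis p V → ℂ} (A : Finset B) {T : N.Choice p}
    (h : N.normSq Φ T ≠ 0) : N.entropyRT p A - N.entropy Φ A T ≤
      Real.log ((p : ℝ) ^ N.minCut A * N.rawPurity Φ A T / N.normSq Φ T ^ 2) := by
  obtain ⟨h1, h2⟩ := neg_log_le_entropy A h
  have hp : (p : ℝ) ^ N.minCut A ≠ 0 := pow_ne_zero _ (NeZero.ne _)
  rw [mul_div_assoc, Real.log_mul hp (div_pos h1 (by positivity)).ne', Real.log_pow, entropyRT]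
  linarith

/-- The mean entropy deficit when the tensors connected to the boundary are random. -/
lemma sum_deficit_mixChoice_le [Fact p.Prime] {φ : V → ZMod p → ℂ}
    (hφ : ∀ v, ∑ i, ‖φ v i‖ ^ 2 = 1) {τ : N.Choice p}
    (hτ : N.rawState (fun i => ∏ v, φ v (i v)) τ ≠ 0) (A : Finset B) :
    ∑ T with N.normSq (fun i => ∏ v, φ v (i v)) (mixChoice N.boundaryComponent T τ) ≠ 0,
      (N.entropyRT p A -
        N.entropy (fun i => ∏ v, φ v (i v)) A (mixChoice N.boundaryComponent T τ)) ≤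
      (Finset.univ.filter fun T =>
        N.normSq (fun i => ∏ v, φ v (i v)) (mixChoice N.boundaryComponent T τ) ≠ 0).card *
        (Real.log (N.numMinimal A) + N.entropyError p) := by
  have hp0 : (0 : ℝ) < p := Nat.cast_pos.2 (NeZero.pos p)
  have hlogp : 0 ≤ Real.log p := Real.log_natCast_nonneg p
  have hk : (1 : ℝ) ≤ N.numMinimal A := Nat.one_le_cast.2 (N.numMinimal_pos A)
  obtain ⟨m, hm, hm1, hm2⟩ := exists_moments hφ N.isClosed_boundaryComponent hτ
  set Φ : QuditBasis p V → ℂ := fun i => ∏ v, φ v (i v) with hΦ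
  set W := N.boundaryComponent with hW
  have hXL : ∀ T : N.Choice p, N.normSq Φ (mixChoice W T τ) ≠ 0 →
      N.entropyRT p A - N.entropy Φ A (mixChoice W T τ) ≤
        (Fintype.card E + Fintype.card B) * Real.log p := fun T hT =>
    (sub_le_self _ (entropy_nonneg A hT)).trans (entropyRT_le A)
  by_cases hcase : √√(p : ℝ)⁻¹ < 1 ∧ 2 ^ Fintype.card V * √(p : ℝ)⁻¹ ≤ 1 / 2
  · rw [entropyError, if_pos hcase]
    have hw : ∀ T : N.Choice p, N.normSq Φ (mixChoice W T τ) ≠ 0 ↔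
        N.normSq Φ (mixChoice W T τ) / m ≠ 0 := fun T => by
      rw [ne_eq, ne_eq, div_eq_zero_iff, or_iff_left hm.ne']
    have hpur : ∀ T : N.Choice p, 0 ≤ N.rawPurity Φ A (mixChoice W T τ) := by
      intro T
      by_cases h : N.normSq Φ (mixChoice W T τ) = 0
      · rw [rawPurity, (normSq_eq_zero_iff _ _).1 h]
        simp [Matrix.trace, reducedState, Matrix.mul_apply]
      · exact (neg_log_le_entropy A h).1.le
    simp only [hw]
    refine sum_le_of_le_log_div (fun T => N.normSq Φ (mixChoice W T τ) / m)
      (fun T => (p : ℝ) ^ N.minCut A * N.rawPurity Φ A (mixChoice W T τ) / m ^ 2)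
      (fun T => N.entropyRT p A - N.entropy Φ A (mixChoice W T τ)) hk (by positivity)
      (Real.sqrt_pos.2 (Real.sqrt_pos.2 (inv_pos.2 hp0))) hcase.1 hcase.2 (by positivity) ?_
      ?_ ?_ (fun T hT => hXL T ((hw T).2 hT)) ?_ ?_ ?_ ?_
    · rw [Real.sq_sqrt (Real.sqrt_nonneg _), mul_assoc, Real.mul_self_sqrt (by positivity),
        div_eq_mul_inv]
    · intro T
      have := hpur T
      positivity
    · intro T hT
      have := (neg_log_le_entropy A ((hw T).2 hT)).1
      positivity
    · intro T hT
      refine (entropyRT_sub_entropy_le_log A ((hw T).2 hT)).trans_eq ?_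
      congr 1
      have := (hw T).2 hT
      field_simp
    · rw [← Finset.sum_div, hm1, mul_div_cancel_right₀ _ hm.ne']
    -- The second moment of the norm is the purity bound for the empty region, with $k=1$ and
    -- minimal cut $0$.
    · have h := (hm2 ∅).trans (mul_le_mul_of_nonneg_left
        (N.sum_inv_pow_card_surface_le ∅ (NeZero.pos p)) (by positivity))
      simp only [rawPurity_empty, numMinimal_empty, minCut_empty, pow_zero, inv_one, mul_one,
        Nat.cast_one] at h
      simp only [div_pow]
      rw [← Finset.sum_div, div_le_iff₀ (by positivity)]
      linarith
    · have h := (hm2 A).trans (mul_le_mul_of_nonneg_left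
        (N.sum_inv_pow_card_surface_le A (NeZero.pos p)) (by positivity))
      rw [← Finset.sum_div, ← Finset.mul_sum, div_le_iff₀ (by positivity)]
      calc _ ≤ (p : ℝ) ^ N.minCut A * _ := mul_le_mul_of_nonneg_left h (by positivity)
        _ = _ := by field_simp
  · rw [entropyError, if_neg hcase, ← nsmul_eq_mul, ← Finset.sum_const]
    refine Finset.sum_le_sum fun T hT => (hXL T (Finset.mem_filter.1 hT).2).trans ?_
    have := Real.log_nonneg hk
    linarith

/-- The mean entropy deficit of a random stabilizer tensor network. -/
lemma sum_deficit_le [Fact p.Prime] {Φ : QuditBasis p V → ℂ} (hΦ : IsProductState Φ)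
    (A : Finset B) :
    ∑ T with N.normSq Φ T ≠ 0, (N.entropyRT p A - N.entropy Φ A T) ≤
      (Finset.univ.filter fun T => N.normSq Φ T ≠ 0).card *
        (Real.log (N.numMinimal A) + N.entropyError p) := by
  classical
  obtain ⟨φ, hφ, hΦφ⟩ := hΦ
  obtain rfl : Φ = fun i => ∏ v, φ v (i v) := funext hΦφ
  obtain ⟨τ, hτ⟩ := exists_rawState_ne_zero (N := N) hφ
  have h0 := sum_deficit_mixChoice_le hφ hτ A
  obtain ⟨c, hc, hcT⟩ := exists_rawState_eq_smul hφ N.isClosed_boundaryComponent hτ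
  set Φ : QuditBasis p V → ℂ := fun i => ∏ v, φ v (i v) with hΦ
  set W := N.boundaryComponent with hW
  set M := Real.log (N.numMinimal A) + N.entropyError p with hM
  let X : N.Choice p → ℝ := fun T => N.entropyRT p A - N.entropy Φ A T
  -- The factor `f` depends only on the tensors outside `W`, `g` and `h` only on those inside. The
  -- nonvanishing event is a product of the two kinds, and the entropy is unaffected by the scalar
  -- `c`.
  let f : N.Choice p → ℝ := fun T => if c T ≠ 0 then 1 else 0
  let g : N.Choice p → ℝ := fun T =>
    if N.normSq Φ (mixChoice W T τ) ≠ 0 then X (mixChoice W T τ) else 0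
  let h : N.Choice p → ℝ := fun T => if N.normSq Φ (mixChoice W T τ) ≠ 0 then 1 else 0
  have hiff : ∀ T, N.normSq Φ T ≠ 0 ↔ c T ≠ 0 ∧ N.normSq Φ (mixChoice W T τ) ≠ 0 := by
    intro T
    simp only [ne_eq, normSq_eq_zero_iff]
    rw [hcT T, smul_eq_zero, not_or]
  have hmix : ∀ T T' : N.Choice p, (∀ v ∈ W, T v = T' v) → mixChoice W T τ = mixChoice W T' τ := by
    intro T T' hTT
    refine funext fun v => ?_
    simp only [mixChoice]
    split_ifs with hv
    · exact hTT v hv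
    · rfl
  have hf : ∀ T T' : N.Choice p, (∀ v ∉ W, T v = T' v) → f T = f T' := fun T T' hT => by
    simp only [f, hc T T' hT]
  have hsum : ∑ T with N.normSq Φ T ≠ 0, X T = ∑ T, f T * g T := by
    rw [Finset.sum_filter]
    refine Finset.sum_congr rfl fun T _ => ?_
    simp only [f, g, hiff T, ite_and, ite_mul, one_mul, zero_mul]
    split_ifs with h1 h2
    · simp only [X, entropy_eq_of_rawState_eq_smul h1 (hcT T)]
    · rfl
    · rfl
  have hcard : ((Finset.univ.filter fun T => N.normSq Φ T ≠ 0).card : ℝ) = ∑ T, f T * h T := by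
    rw [← Finset.sum_boole]
    refine Finset.sum_congr rfl fun T _ => ?_
    simp only [f, h, hiff T, ite_and, ite_mul, one_mul, zero_mul]
  -- Independence lets the outside factor cancel from the conditional mean, leaving the bound with
  -- exterior tensors fixed to `τ`.
  have h1 := sum_mul_sum_of_complementary (κ := fun v => StabState p (N.Leg v)) W f g hf
    fun T T' hT => by simp only [g, hmix T T' hT]
  have h2 := sum_mul_sum_of_complementary (κ := fun v => StabState p (N.Leg v)) W f h hf
    fun T T' hT => by simp only [h, hmix T T' hT]
  have h3 : ∑ T, g T ≤ (∑ T, h T) * M := by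
    simp only [g, h]
    rw [← Finset.sum_filter, Finset.sum_boole]
    exact h0
  have hf0 : 0 ≤ ∑ T, f T := Finset.sum_nonneg fun T _ => by
    simp only [f]
    split_ifs
    · exact zero_le_one
    · rfl
  have hn : (0 : ℝ) < Fintype.card (N.Choice p) := Nat.cast_pos.2 Fintype.card_pos
  refine hsum.le.trans ?_
  rw [hcard]
  refine le_of_mul_le_mul_left ?_ hn
  calc _ = (∑ T, f T) * ∑ T, g T := h1.symm
    _ ≤ (∑ T, f T) * ((∑ T, h T) * M) := mul_le_mul_of_nonneg_left h3 hf0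
    _ = (Fintype.card (N.Choice p) * ∑ T, f T * h T) * M := by
      rw [← mul_assoc]
      exact congrArg (· * M) h2
    _ = _ := mul_assoc _ _ _

instance : DiscreteMeasurableSpace (N.Choice p) := ⟨fun _ => trivial⟩

lemma law_eq (Φ : QuditBasis p V → ℂ) :
    N.law Φ = uniformOn ((Finset.univ.filter fun T => N.normSq Φ T ≠ 0 : Finset (N.Choice p)) :
      Set (N.Choice p)) := by
  rw [law]
  congr 1
  ext T
  simp [normSq_eq_zero_iff]

lemma nonempty_normSq_ne_zero [Fact p.Prime] {Φ : QuditBasis p V → ℂ} (hΦ : IsProductState Φ) :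
    (Finset.univ.filter fun T : N.Choice p => N.normSq Φ T ≠ 0).Nonempty := by
  obtain ⟨φ, hφ, hΦφ⟩ := hΦ
  obtain rfl : Φ = fun i => ∏ v, φ v (i v) := funext hΦφ
  obtain ⟨τ, hτ⟩ := exists_rawState_ne_zero (N := N) hφ
  exact ⟨τ, Finset.mem_filter.2 ⟨Finset.mem_univ _, mt (normSq_eq_zero_iff _ _).1 hτ⟩⟩

lemma isProbabilityMeasure_law [Fact p.Prime] {Φ : QuditBasis p V → ℂ} (hΦ : IsProductState Φ) :
    IsProbabilityMeasure (N.law Φ) := by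
  rw [law_eq]
  exact isProbabilityMeasure_uniformOn (Finset.finite_toSet _) (nonempty_normSq_ne_zero hΦ)

/-- Large entropy deficits are unlikely. -/
lemma law_deficit_ge_le [Fact p.Prime] {Φ : QuditBasis p V → ℂ} (hΦ : IsProductState Φ)
    (A : Finset B) {a : ℝ} (ha : 0 < a) :
    (N.law Φ).real {T | N.entropyRT p A - N.entropy Φ A T ≥
      a * (Real.log (N.numMinimal A) + N.entropyError p)} ≤ 1 / a := by
  rw [law_eq]
  refine uniformOn_real_le_of_sum_le (nonempty_normSq_ne_zero hΦ) (fun T hT => ?_) ?_ ha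
    (sum_deficit_le hΦ A)
  · exact sub_nonneg.2 (entropy_le_entropyRT _ hΦ A (Finset.mem_filter.1 hT).2)
  · have h1 := Real.log_natCast_nonneg (N.numMinimal A)
    have h2 := N.entropyError_pos (NeZero.pos p)
    linarith

/-- An event containing all nonvanishing networks with a small entropy deficit is likely. -/
lemma one_sub_le_law [Fact p.Prime] {Φ : QuditBasis p V → ℂ} (hΦ : IsProductState Φ)
    (A : Finset B) {a : ℝ} (ha : 0 < a) {s : Set (N.Choice p)}
    (hs : ∀ T, N.normSq Φ T ≠ 0 → N.entropyRT p A - N.entropy Φ A T <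
      a * (Real.log (N.numMinimal A) + N.entropyError p) → T ∈ s) :
    1 - 1 / a ≤ (N.law Φ).real s := by
  have := isProbabilityMeasure_law (N := N) hΦ
  have h1 : (N.law Φ).real sᶜ ≤ 1 / a := by
    refine le_trans ?_ (law_deficit_ge_le (N := N) hΦ A ha)
    rw [law_eq, measureReal_def, measureReal_def, ← uniformOn_inter_self (Finset.finite_toSet _)]
    refine ENNReal.toReal_mono (measure_ne_top _ _) (measure_mono fun T hT => ?_)
    by_contra! h
    refine hT.2 (hs T ?_ (not_le.1 h))
    exact (Finset.mem_filter.1 (Finset.mem_coe.1 hT.1)).2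
  rw [probReal_compl_eq_one_sub (MeasurableSet.of_discrete)] at h1
  linarith

/-- Both entropies are integer multiples of $\ln p$, so a deficit in $[0,\ln p)$ is zero. -/
lemma one_sub_le_law_eq [Fact p.Prime] {Φ : QuditBasis p V → ℂ} (hΦ : IsProductState Φ)
    (hΦS : IsStabilizerState Φ) (A : Finset B) {a : ℝ} (ha : 0 < a)
    (h : a * (Real.log (N.numMinimal A) + N.entropyError p) < Real.log p) :
    1 - 1 / a ≤ (N.law Φ).real {T | N.entropyRT p A = N.entropy Φ A T} := by
  refine one_sub_le_law hΦ A ha fun T hT hlt => ?_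
  obtain ⟨m, hm⟩ := exists_entropy_eq hΦS A hT
  have hle := entropy_le_entropyRT _ hΦ A hT
  have hlog : 0 < Real.log p := Real.log_pos (Nat.one_lt_cast.2 (Fact.out : p.Prime).one_lt)
  have hlt' := hlt.trans h
  rw [Set.mem_ofPred_eq]
  rw [hm, entropyRT] at hle hlt' ⊢
  have h1 : m ≤ N.minCut A := by exact_mod_cast le_of_mul_le_mul_right hle hlog
  have h2 : N.minCut A < m + 1 := by
    have : (N.minCut A : ℝ) * Real.log p < (m + 1) * Real.log p := by linarith
    exact_mod_cast lt_of_mul_lt_mul_right this hlog.le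
  rw [le_antisymm h1 (Nat.lt_succ_iff.1 h2)]

/-- A bound independent of `A`, so that one threshold for $p$ serves all regions. -/
lemma log_numMinimal_le (N : TensorNetwork V E B) (A : Finset B) :
    Real.log (N.numMinimal A) ≤ Real.log (2 ^ Fintype.card V) := by
  refine Real.log_le_log (Nat.cast_pos.2 (N.numMinimal_pos A)) ?_
  exact_mod_cast N.numMinimal_le A

end TensorNetwork

end

theorem mainTheorem7 {V E B : Type*} [Fintype V] [DecidableEq V] [Fintype E] [DecidableEq E]
    [Fintype B] [DecidableEq B] (N : TensorNetwork V E B) :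
    (∃ δ : ℕ → ℝ, Tendsto δ atTop (𝓝 0) ∧
      ∀ (p : ℕ) [Fact p.Prime] (Φ : QuditBasis p V → ℂ), IsProductState Φ →
        IsProbabilityMeasure (N.law Φ) ∧
        ∀ (A : Finset B) (a : ℝ), 0 < a →
          (N.law Φ).real {T | N.entropyRT p A - N.entropy Φ A T ≥
              a * (Real.log (N.numMinimal A) + δ p)} ≤ 1 / a ∧
          (IsStabilizerState Φ → Real.log p > a * (Real.log (N.numMinimal A) + δ p) →
            (N.law Φ).real {T | N.entropyRT p A = N.entropy Φ A T} ≥ 1 - 1 / a)) ∧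
    (∀ a : ℝ, 0 < a → ∀ ε : ℝ, 0 < ε → ∀ᶠ p : ℕ in atTop, ∀ [Fact p.Prime]
      (Φ : QuditBasis p V → ℂ), IsProductState Φ → ∀ A : Finset B,
        (N.law Φ).real {T | |N.entropyRT p A - N.entropy Φ A T| <
            a * Real.log (N.numMinimal A) + ε} ≥ 1 - 1 / a) ∧
    (∀ ε : ℝ, 0 < ε → ∀ᶠ p : ℕ in atTop, ∀ [Fact p.Prime]
      (Φ : QuditBasis p V → ℂ), IsProductState Φ → IsStabilizerState Φ → ∀ A : Finset B,
        (N.law Φ).real {T | N.entropyRT p A = N.entropy Φ A T} ≥ 1 - ε) := by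
  refine ⟨⟨N.entropyError, N.tendsto_entropyError, fun p _ Φ hΦ =>
    ⟨TensorNetwork.isProbabilityMeasure_law hΦ, fun A a ha =>
      ⟨TensorNetwork.law_deficit_ge_le hΦ A ha, fun hΦS h =>
        TensorNetwork.one_sub_le_law_eq hΦ hΦS A ha h⟩⟩⟩, fun a ha ε hε => ?_, fun ε hε => ?_⟩
  -- Below $\varepsilon/a$ the error term, multiplied by $a$, costs less than $\varepsilon$.
  · have h1 : ∀ᶠ p : ℕ in atTop, N.entropyError p < ε / a :=
      N.tendsto_entropyError.eventually_lt_const (by positivity)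
    filter_upwards [h1] with p hp hprime Φ hΦ A
    refine TensorNetwork.one_sub_le_law hΦ A ha fun T hT hlt => ?_
    rw [lt_div_iff₀ ha] at hp
    rw [Set.mem_ofPred_eq, abs_of_nonneg
      (sub_nonneg.2 (TensorNetwork.entropy_le_entropyRT _ hΦ A hT))]
    linarith
  · have h1 : ∀ᶠ p : ℕ in atTop, N.entropyError p < 1 :=
      N.tendsto_entropyError.eventually_lt_const one_pos
    have h2 : ∀ᶠ p : ℕ in atTop,
        1 / ε * (Real.log (2 ^ Fintype.card V) + 1) < Real.log p :=
      (Real.tendsto_log_atTop.comp tendsto_natCast_atTop_atTop).eventually_gt_atTop _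
    filter_upwards [h1, h2] with p hp1 hp2 hprime Φ hΦ hΦS A
    -- Taken with $a=1/\varepsilon$, so that the failure probability $1/a$ is $\varepsilon$.
    have h3 := TensorNetwork.one_sub_le_law_eq hΦ hΦS A (one_div_pos.2 hε)
      (lt_of_le_of_lt (mul_le_mul_of_nonneg_left
        (add_le_add (N.log_numMinimal_le A) hp1.le) (by positivity)) hp2)
    rwa [one_div_one_div] at h3
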